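/- Let $a:\mathbb{R}\to\mathbb{R}$ be a measurable weight with $A_0\ge a(x)\ge a_0>0$ for a.e. $x\in\mathbb{R}$, where $a_0,A_0$ are constants. For $m=(m_1,m_2,m_3):\mathbb{R}\to\mathbb{S}^2\subset\mathbb{R}^3$ let $$F(m)=\int_{\mathbb{R}}\Big(a(x)|\partial_x m|^2+a(x)(m_2^2+m_3^2)\Big)\,dx\in[0,\infty],$$ with $F(m)=\infty$ if $m$ is not locally absolutely continuous, and write $e_1=(1,0,0)$, $e_2=(0,1,0)$. There exists a unique minimizer $m:\mathbb{R}\to\mathbb{S}^2$ of $F$ under the constraints $m(0)=e_2$ and $m(\pm\infty)=\pm e_1$, and $F(m)<\infty$. This minimizer has the form $m=(\sin\varphi,\cos\varphi,0)$, where $\varphi:\mathbb{R}\to\mathbb{R}$ is a (strictly) increasing Lipschitz function with $\partial_x\varphi\in L^2(\mathbb{R})$, $$\varphi(0)=0,\qquad \varphi(\pm\infty)=\pm\frac{\pi}{2},$$ and $\varphi$ solves the weighted pendulum equation $$\partial_x\big(a(x)\,\partial_x\varphi\big)+a(x)\sin\varphi\cos\varphi=0\qquad(\ast)$$ in the sense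 of distributions in $\mathbb{R}\setminus\{0\}$. Moreover $\varphi$ is the only locally absolutely continuous function with $\partial_x\varphi\in L^2(\mathbb{R})$ that solves $(\ast)$ in $\mathbb{R}\setminus\{0\}$, satisfies $\varphi(0)=0$ and $\varphi(\pm\infty)=\pm\frac\pi2$, and satisfies $-\frac\pi2\le\varphi(-x)\le0\le\varphi(x)\le\frac\pi2$ for every $x>0$. If in addition $a$ is even in $\mathbb{R}$ and non-decreasing in $(0,+\infty)$, then $\varphi$ is odd, $(\ast)$ holds in the sense of distributions in the entire $\mathbb{R}$, and $m$ is a stable critical point of $F$ in the following sense. With $\lambda(x)=a(x)|\partial_x m|^2+a(x)m_2^2$, the equation $$-\partial_x(a\,\partial_x m)+a\,(m_2e_2+m_3e_3)=\lambda m$$ holds in the sense of distributions in $\mathbb{R}$, where $e_3=(0,0,1)$ (so $\lambda$ is the Lagrange multiplier for the constraint $|m|=1$). For every $v\in H^1(\mathbb{R},\mathbb{R}^3)$ with $v\cdot m=0$ in $\mathbb{R}$, the function $t\mapsto F\big(\frac{m+tv}{|m+tv|}\big)$ is finite on $\mathbb{R}$ and twice differentiable at $t=0$, its first derivative at $t=0$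 vanishes, and $$T(v)=\frac12\frac{d^2}{dt^2}\bigg|_{t=0}F\Big(\frac{m+tv}{|m+tv|}\Big)=\int_{\mathbb{R}}\Big(a(x)|\partial_x v|^2+a(x)(v_2^2+v_3^2)-\lambda(x)|v|^2\Big)\,dx\ge0.$$ -/

import Mathlib

open MeasureTheory Filter Topology
open scoped ENNReal ContDiff

noncomputable section

namespace DomainWall

/-- The space `ℝ³` with its Euclidean norm; the components `m₁, m₂, m₃` of a vector `m` are
`m 0, m 1, m 2`. -/
abbrev E3 : Type := EuclideanSpace ℝ (Fin 3)

/-- The vector `e₁ = (1, 0, 0)`. -/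
def e₁ : E3 := !₂[1, 0, 0]

/-- The vector `e₂ = (0, 1, 0)`. -/
def e₂ : E3 := !₂[0, 1, 0]

/-- Local absolute continuity on `ℝ`, i.e. `f` is the continuous representative of a function in
`W^{1,1}_loc(ℝ)`; its weak derivative is then its almost everywhere derivative `deriv f`. -/
def LocAC {X : Type*} [PseudoMetricSpace X] (f : ℝ → X) : Prop :=
  ∀ b c : ℝ, AbsolutelyContinuousOnInterval f b c

/-- The (continuous representatives of the) functions of the homogeneous Sobolev space
`Ḣ¹(ℝ)`: locally absolutely continuous functions with square integrable derivative. -/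
def MemHdot1 (f : ℝ → ℝ) : Prop :=
  LocAC f ∧ MemLp (deriv f) 2 volume

/-- The (continuous representatives of the) maps of the Sobolev space `H¹(ℝ, ℝ³)`. -/
def MemH1 (v : ℝ → E3) : Prop :=
  LocAC v ∧ MemLp v 2 volume ∧ MemLp (deriv v) 2 volume

open Classical in
/-- The energy `F(m) = ∫ a |m'|² + a (m₂² + m₃²)`, with values in `[0, ∞]`; it is infinite for maps
which are not locally absolutely continuous. -/
def energy (a : ℝ → ℝ) (m : ℝ → E3) : ℝ≥0∞ :=
  if LocAC m then
    ∫⁻ x, ENNReal.ofReal (a x * ‖deriv m x‖ ^ 2 + a x * ((m x 1) ^ 2 + (m x 2) ^ 2))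
  else ⊤

/-- Maps `m : ℝ → 𝕊²` with `m(0) = e₂` and `m(±∞) = ±e₁`. -/
def Admissible (m : ℝ → E3) : Prop :=
  (∀ x, ‖m x‖ = 1) ∧ m 0 = e₂ ∧ Tendsto m atTop (𝓝 e₁) ∧ Tendsto m atBot (𝓝 (-e₁))

/-- `m` minimizes the energy under the constraints. -/
def IsMinimizer (a : ℝ → ℝ) (m : ℝ → E3) : Prop :=
  Admissible m ∧ ∀ n : ℝ → E3, Admissible n → energy a m ≤ energy a n

/-- The weighted pendulum equation `(a φ')' + a sin φ cos φ = 0` in the sense of distributions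
in the open set `U`. -/
def PendulumIn (a φ : ℝ → ℝ) (U : Set ℝ) : Prop :=
  ∀ η : ℝ → ℝ, ContDiff ℝ ∞ η → HasCompactSupport η → tsupport η ⊆ U →
    ∫ x, a x * deriv φ x * deriv η x = ∫ x, a x * (Real.sin (φ x) * Real.cos (φ x)) * η x

/-- `φ ∈ Ḣ¹(ℝ)` solves the weighted pendulum equation in `ℝ \ {0}`, with `φ(0) = 0`,
`φ(±∞) = ±π/2` and `-π/2 ≤ φ(-x) ≤ 0 ≤ φ(x) ≤ π/2` for `x > 0`. -/
def IsWallAngle (a φ : ℝ → ℝ) : Prop :=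
  MemHdot1 φ ∧ φ 0 = 0 ∧
    Tendsto φ atTop (𝓝 (Real.pi / 2)) ∧ Tendsto φ atBot (𝓝 (-(Real.pi / 2))) ∧
    (∀ x, 0 < x →
      -(Real.pi / 2) ≤ φ (-x) ∧ φ (-x) ≤ 0 ∧ 0 ≤ φ x ∧ φ x ≤ Real.pi / 2) ∧
    PendulumIn a φ {0}ᶜ

/-- The planar map `(sin φ, cos φ, 0)`. -/
def planar (φ : ℝ → ℝ) (x : ℝ) : E3 := !₂[Real.sin (φ x), Real.cos (φ x), 0]

/-- The function `λ = a |m'|² + a m₂²`. -/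
def multiplier (a : ℝ → ℝ) (m : ℝ → E3) (x : ℝ) : ℝ :=
  a x * ‖deriv m x‖ ^ 2 + a x * (m x 1) ^ 2

/-- The equation `-(a m')' + a (m₂ e₂ + m₃ e₃) = λ m` on `ℝ` in the sense of distributions: `λ` is
a Lagrange multiplier for the constraint `|m| = 1`. -/
def IsLagrangeMultiplier (a : ℝ → ℝ) (m : ℝ → E3) (l : ℝ → ℝ) : Prop :=
  ∀ w : ℝ → E3, ContDiff ℝ ∞ w → HasCompactSupport w →
    ∫ x, (a x * inner ℝ (deriv m x) (deriv w x) + a x * (m x 1 * w x 1 + m x 2 * w x 2))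
      = ∫ x, l x * inner ℝ (m x) (w x)

/-- The variation `(m + t v) / |m + t v|`. -/
def variation (m v : ℝ → E3) (t : ℝ) (x : ℝ) : E3 :=
  ‖m x + t • v x‖⁻¹ • (m x + t • v x)

/-- The real function `t ↦ F((m + t v) / |m + t v|)`. -/
def energyAlong (a : ℝ → ℝ) (m v : ℝ → E3) (t : ℝ) : ℝ :=
  (energy a (variation m v t)).toReal

/-- The integrand `a |v'|² + a (v₂² + v₃²) - λ |v|²`. -/
def secondVarIntegrand (a : ℝ → ℝ) (m v : ℝ → E3) (x : ℝ) : ℝ :=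
  a x * ‖deriv v x‖ ^ 2 + a x * ((v x 1) ^ 2 + (v x 2) ^ 2) - multiplier a m x * ‖v x‖ ^ 2

/-- `T(v) = ∫ a |v'|² + a (v₂² + v₃²) - λ |v|²`. -/
def secondVar (a : ℝ → ℝ) (m v : ℝ → E3) : ℝ :=
  ∫ x, secondVarIntegrand a m v x

end DomainWall

end

open DomainWall

namespace DomainWall

open Set

/-! ### Absolutely continuous functions -/

/-! Minimality and uniqueness come from a calibration, existence of the wall from a shooting
argument, and stability from a second calibration for the quadratic form.

Prescribing the value at the origin decouples the two half lines, and a reflection turns the left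
one into a right one. Let φ solve the pendulum equation on (0,∞) with flux p = a φ'. Where sin φ and
cos φ are positive, the energy density of any competitor (u, v, w) equals the density of the wall,
plus the derivative of p cot φ u² - p tan φ (v² + w²), plus a weighted sum of squares, the defect
(`hasDerivAt_calibration`). The boundary terms disappear: at 0 because u vanishes there and u' is
square integrable (`calibration_le`), at infinity because p ≤ A₀ cos φ absorbs the pole of tan φ
(`neg_le_calibration`). So the wall minimizes. Equality forces zero defect, that is, u/sin φ, v/cos
φ and w/cos φ are constant, and the boundary values fix the constants. Any two wall angles yield
minimizers, so uniqueness of the angle follows from uniqueness of the minimizer.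

The bounds on φ rest on p² - K cos² φ, a first integral for constant weights: its derivative has the
sign of K - a², and it tends to 0 at infinity. This gives a₀ cos φ ≤ p ≤ A₀ cos φ, hence strict
monotonicity and the Lipschitz bound; if a is non-decreasing on (0,∞), it gives cos φ ≤ φ' almost
everywhere.

For existence, the initial flux α varies in [a₀/2, 5A₀]. The trajectories that turn back and those
that pass π/2 form disjoint, nonempty, relatively open sets of parameters, so by connectedness some
α belongs to neither, and its trajectory is a wall (`exists_halfWall`). As a is only measurable,
solutions and their dependence on α come from a contraction for the integral equation
(`exists_volterra`).

If a is even, uniqueness makes φ odd, so the fluxes from both sides agree at 0 and the equation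
crosses the origin. Adding the derivative of P tan φ |v|² to the second variation integrand leaves a
(|v' + φ' tan φ v|² - v₀²), where v₀ is the component of v along e₁; this is nonnegative because v ⟂
m and cos φ ≤ φ'. -/

theorem _root_.LipschitzOnWith.comp_absolutelyContinuousOnInterval {X Y : Type*}
    [PseudoMetricSpace X] [PseudoMetricSpace Y] {K : NNReal} {g : X → Y} {s : Set X} {f : ℝ → X}
    {b c : ℝ} (hg : LipschitzOnWith K g s) (hf : AbsolutelyContinuousOnInterval f b c)
    (hs : MapsTo f (uIcc b c) s) : AbsolutelyContinuousOnInterval (fun x => g (f x)) b c := by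
  unfold AbsolutelyContinuousOnInterval at hf ⊢
  apply squeeze_zero' ?_ ?_ (by simpa using hf.const_mul (K : ℝ))
  · exact Eventually.of_forall fun _ => Finset.sum_nonneg fun i hi => dist_nonneg
  rw [eventually_inf_principal]
  filter_upwards with E hE
  rw [Finset.mul_sum]
  exact Finset.sum_le_sum fun i hi =>
    hg.dist_le_mul _ (hs (hE.1 i hi).1) _ (hs (hE.1 i hi).2)

theorem _root_.AbsolutelyContinuousOnInterval.inv_of_le {f : ℝ → ℝ} {b c δ : ℝ} (hδ : 0 < δ)
    (hf : AbsolutelyContinuousOnInterval f b c) (h : ∀ x ∈ uIcc b c, δ ≤ f x) :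
    AbsolutelyContinuousOnInterval (fun x => (f x)⁻¹) b c := by
  refine LipschitzOnWith.comp_absolutelyContinuousOnInterval (g := fun y : ℝ => y⁻¹)
    (s := Ici δ) (K := (δ * δ)⁻¹.toNNReal) ?_ hf h
  refine LipschitzOnWith.of_dist_le_mul fun x hx y hy => ?_
  have hx : δ ≤ x := hx
  have hy : δ ≤ y := hy
  rw [Real.coe_toNNReal _ (by positivity), Real.dist_eq, Real.dist_eq,
    inv_sub_inv (by linarith) (by linarith), abs_div, abs_sub_comm, div_eq_inv_mul]
  gcongr
  rw [abs_of_pos (mul_pos (by linarith) (by linarith))]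
  exact mul_le_mul hx hy hδ.le (by linarith)

theorem _root_.AbsolutelyContinuousOnInterval.inv_of_pos {f : ℝ → ℝ} {b c : ℝ}
    (hf : AbsolutelyContinuousOnInterval f b c) (h : ∀ x ∈ uIcc b c, 0 < f x) :
    AbsolutelyContinuousOnInterval (fun x => (f x)⁻¹) b c := by
  obtain ⟨z, hz, hmin⟩ := isCompact_uIcc.exists_isMinOn nonempty_uIcc hf.continuousOn
  exact hf.inv_of_le (h z hz) fun x hx => hmin hx

/-- Confining the hypothesis to the open interval allows equations known only on (0,∞) to be
integrated from 0. Integrability of `f'` is an output, which is how the calibration defect gets its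
integrability. -/
theorem _root_.AbsolutelyContinuousOnInterval.intervalIntegrable_and_integral_eq {f f' : ℝ → ℝ}
    {b c : ℝ} (hf : AbsolutelyContinuousOnInterval f b c) (hbc : b ≤ c)
    (h : ∀ᵐ x, x ∈ Ioo b c → HasDerivAt f (f' x) x) :
    IntervalIntegrable f' volume b c ∧ ∫ x in b..c, f' x = f c - f b := by
  have h1 : ∀ᵐ x, x ∈ uIoc b c → deriv f x = f' x := by
    filter_upwards [h, Measure.ae_ne volume c] with x hx hxc hm
    rw [uIoc_of_le hbc] at hm
    exact (hx ⟨hm.1, lt_of_le_of_ne hm.2 hxc⟩).deriv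
  refine ⟨hf.intervalIntegrable_deriv.congr_ae ?_, ?_⟩
  · rwa [EventuallyEq, ae_restrict_iff' measurableSet_uIoc]
  · rw [← hf.integral_deriv_eq_sub]
    exact (intervalIntegral.integral_congr_ae h1).symm

theorem _root_.AbsolutelyContinuousOnInterval.le_of_deriv_nonpos {f f' : ℝ → ℝ}
    {b c : ℝ} (hf : AbsolutelyContinuousOnInterval f b c) (hbc : b ≤ c)
    (h : ∀ᵐ x, x ∈ Ioo b c → HasDerivAt f (f' x) x ∧ f' x ≤ 0) : f c ≤ f b := by
  have h1 := hf.intervalIntegrable_and_integral_eq hbc (h.mono fun x hx hm => (hx hm).1)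
  have h2 : ∫ x in b..c, -f' x = -(f c - f b) := by
    rw [intervalIntegral.integral_neg, h1.2]
  have h3 : 0 ≤ ∫ x in b..c, -f' x := by
    apply intervalIntegral.integral_nonneg_of_ae_restrict hbc
    rw [EventuallyLE, ae_restrict_iff' measurableSet_Icc]
    filter_upwards [h, Measure.ae_ne volume c, Measure.ae_ne volume b] with x hx hc hb hm
    have := (hx ⟨lt_of_le_of_ne hm.1 hb.symm, lt_of_le_of_ne hm.2 hc⟩).2
    simpa using this
  linarith

theorem LocAC.continuous {X : Type*} [SeminormedAddCommGroup X] {f : ℝ → X} (hf : LocAC f) :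
    Continuous f := by
  rw [continuous_iff_continuousAt]
  intro x
  refine (hf (x - 1) (x + 1)).continuousOn.continuousAt ?_
  rw [uIcc_of_le (by linarith)]
  exact Icc_mem_nhds (by linarith) (by linarith)

theorem _root_.LipschitzWith.locAC {X : Type*} [PseudoMetricSpace X] {f : ℝ → X} {K : NNReal}
    (hf : LipschitzWith K f) : LocAC f :=
  fun _ _ => (hf.lipschitzOnWith).absolutelyContinuousOnInterval

theorem _root_.LipschitzWith.comp_locAC {X Y : Type*} [PseudoMetricSpace X] [PseudoMetricSpace Y]
    {K : NNReal} {g : X → Y} {f : ℝ → X} (hg : LipschitzWith K g) (hf : LocAC f) :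
    LocAC (fun x => g (f x)) :=
  fun b c => (hg.lipschitzOnWith (s := univ)).comp_absolutelyContinuousOnInterval (hf b c)
    (mapsTo_univ _ _)

theorem LocAC.add {X : Type*} [SeminormedAddCommGroup X] {f g : ℝ → X} (hf : LocAC f)
    (hg : LocAC g) : LocAC (fun x => f x + g x) := fun b c => (hf b c).fun_add (hg b c)

theorem LocAC.sub {X : Type*} [SeminormedAddCommGroup X] {f g : ℝ → X} (hf : LocAC f)
    (hg : LocAC g) : LocAC (fun x => f x - g x) := fun b c => (hf b c).fun_sub (hg b c)

theorem LocAC.neg {X : Type*} [SeminormedAddCommGroup X] {f : ℝ → X} (hf : LocAC f) :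
    LocAC (fun x => -f x) := fun b c => (hf b c).fun_neg

theorem LocAC.smul {X : Type*} [SeminormedAddCommGroup X] [NormedSpace ℝ X] {f : ℝ → ℝ}
    {g : ℝ → X} (hf : LocAC f) (hg : LocAC g) : LocAC (fun x => f x • g x) :=
  fun b c => (hf b c).fun_smul (hg b c)

theorem LocAC.mul {f g : ℝ → ℝ} (hf : LocAC f) (hg : LocAC g) : LocAC (fun x => f x * g x) :=
  hf.smul hg

theorem LocAC.inv_of_pos {f : ℝ → ℝ} (hf : LocAC f) (h : ∀ x, 0 < f x) :
    LocAC (fun x => (f x)⁻¹) := fun b c => (hf b c).inv_of_pos fun x _ => h x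

theorem locAC_const {X : Type*} [PseudoMetricSpace X] (z : X) : LocAC (fun _ : ℝ => z) :=
  (LipschitzWith.const z).locAC

theorem LocAC.sin {f : ℝ → ℝ} (hf : LocAC f) : LocAC (fun x => Real.sin (f x)) :=
  Real.lipschitzWith_sin.comp_locAC hf

theorem LocAC.cos {f : ℝ → ℝ} (hf : LocAC f) : LocAC (fun x => Real.cos (f x)) :=
  Real.lipschitzWith_cos.comp_locAC hf

theorem LocAC.ae_differentiableAt {V : Type*} [NormedAddCommGroup V] [NormedSpace ℝ V]
    [FiniteDimensional ℝ V] {f : ℝ → V} (hf : LocAC f) : ∀ᵐ x, DifferentiableAt ℝ f x := by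
  have h : ∀ n : ℕ, ∀ᵐ x, x ∈ uIcc (-(n : ℝ)) n → DifferentiableAt ℝ f x := fun n =>
    (hf _ _).boundedVariationOn.ae_differentiableAt_of_mem_uIcc
  filter_upwards [ae_all_iff.2 h] with x hx
  obtain ⟨n, hn⟩ := exists_nat_ge |x|
  refine hx n ?_
  rw [uIcc_of_le (by linarith [abs_nonneg x])]
  exact abs_le.1 hn

theorem LocAC.ae_hasDerivAt {V : Type*} [NormedAddCommGroup V] [NormedSpace ℝ V]
    [FiniteDimensional ℝ V] {f : ℝ → V} (hf : LocAC f) : ∀ᵐ x, HasDerivAt f (deriv f x) x :=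
  hf.ae_differentiableAt.mono fun _ hx => hx.hasDerivAt

theorem LocAC.integral_eq {f f' : ℝ → ℝ} (hf : LocAC f) (h : ∀ᵐ x, HasDerivAt f (f' x) x)
    (b c : ℝ) : ∫ x in b..c, f' x = f c - f b := by
  rw [← (hf b c).integral_deriv_eq_sub]
  exact intervalIntegral.integral_congr_ae (h.mono fun x hx _ => hx.deriv.symm)

theorem locAC_primitive {g : ℝ → ℝ} (hg : ∀ b c, IntervalIntegrable g volume b c) (z : ℝ) :
    LocAC (fun x => ∫ t in z..x, g t) := fun b c =>
  ((hg (min (min b c) z) (max (max b c) z)).absolutelyContinuousOnInterval_intervalIntegral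
    (c := z) (by rw [uIcc_of_le (by simp)]; simp)).mono (by
      rw [uIcc_of_le (a := min (min b c) z) (by simp)]
      exact Icc_subset_Icc (by simp) (by simp))

theorem ae_hasDerivAt_primitive {g : ℝ → ℝ} (hg : ∀ b c, IntervalIntegrable g volume b c) (z : ℝ) :
    ∀ᵐ x, HasDerivAt (fun x => ∫ t in z..x, g t) (g x) x := by
  have h : ∀ n : ℕ, ∀ᵐ x, x ∈ uIcc (z - n) (z + n) →
      HasDerivAt (fun x => ∫ t in z..x, g t) (g x) x := fun n => by
    filter_upwards [(hg (z - n) (z + n)).ae_hasDerivAt_integral] with x hx hm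
    refine hx hm z ?_
    rw [uIcc_of_le (by linarith [n.cast_nonneg (α := ℝ)])]
    constructor <;> linarith [n.cast_nonneg (α := ℝ)]
  filter_upwards [ae_all_iff.2 h] with x hx
  obtain ⟨n, hn⟩ := exists_nat_ge |x - z|
  refine hx n ?_
  rw [uIcc_of_le (by linarith [n.cast_nonneg (α := ℝ)])]
  have := abs_le.1 hn
  constructor <;> linarith

theorem ae_comp_neg {P : ℝ → Prop} (h : ∀ᵐ x, P x) : ∀ᵐ x : ℝ, P (-x) :=
  (Measure.measurePreserving_neg (volume : Measure ℝ)).quasiMeasurePreserving.ae h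

/-- Written as a primitive of its derivative, the function reflects by substitution, which avoids
reflecting the interval families in the definition. -/
theorem LocAC.comp_neg {f : ℝ → ℝ} (hf : LocAC f) : LocAC (fun x => f (-x)) := by
  have h1 : ∀ b c, IntervalIntegrable (deriv f) volume b c := fun b c =>
    (hf b c).intervalIntegrable_deriv
  have h2 : ∀ b c, IntervalIntegrable (fun x => -deriv f (-x)) volume b c := fun b c => by
    simpa [Pi.neg_def] using ((h1 (-b) (-c)).comp_sub_left 0).neg
  have h3 : (fun x => f (-x)) = fun x => f 0 + ∫ t in (0 : ℝ)..x, -deriv f (-t) := by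
    ext x
    rw [intervalIntegral.integral_neg, intervalIntegral.integral_comp_neg (deriv f),
      intervalIntegral.integral_symm, (hf _ _).integral_deriv_eq_sub]
    simp
  rw [h3]
  exact (locAC_const _).add (locAC_primitive h2 0)

/-- An integrable derivative forces a limit, and integrability of the function forces that limit to
be 0 because half lines have infinite measure. -/
theorem LocAC.tendsto_atTop_of_integrable {f : ℝ → ℝ} (hf : LocAC f) (hi : Integrable f)
    (hd : Integrable (deriv f)) : Tendsto f atTop (𝓝 0) := by
  have h1 : Tendsto (fun x => ∫ t in (0 : ℝ)..x, deriv f t) atTop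
      (𝓝 (∫ t in Ioi (0 : ℝ), deriv f t)) :=
    intervalIntegral_tendsto_integral_Ioi 0 hd.integrableOn tendsto_id
  have h2 : Tendsto f atTop (𝓝 (f 0 + ∫ t in Ioi (0 : ℝ), deriv f t)) := by
    refine (h1.const_add (f 0)).congr fun x => ?_
    rw [(hf _ _).integral_deriv_eq_sub]; ring
  have h3 : f 0 + ∫ t in Ioi (0 : ℝ), deriv f t = 0 := by
    refine IntegrableAtFilter.eq_zero_of_tendsto (μ := volume) ⟨univ, univ_mem, hi.integrableOn⟩ ?_ h2
    intro s hs
    obtain ⟨b, hb⟩ := mem_atTop_sets.1 hs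
    exact top_unique ((Real.volume_Ici (a := b)).symm.le.trans (measure_mono fun x hx => hb x hx))
  rwa [h3] at h2

theorem LocAC.tendsto_atBot_of_integrable {f : ℝ → ℝ} (hf : LocAC f) (hi : Integrable f)
    (hd : Integrable (deriv f)) : Tendsto f atBot (𝓝 0) := by
  have h1 : Tendsto (fun x => f (-x)) atTop (𝓝 0) := by
    refine hf.comp_neg.tendsto_atTop_of_integrable hi.comp_neg ?_
    rw [funext (deriv_comp_neg f)]
    exact hd.comp_neg.neg
  simpa [Function.comp_def] using h1.comp tendsto_neg_atBot_atTop

theorem LocAC.integral_eq_zero {f f' : ℝ → ℝ} (hf : LocAC f) (h : ∀ᵐ x, HasDerivAt f (f' x) x)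
    (hi : Integrable f') (htop : Tendsto f atTop (𝓝 0)) (hbot : Tendsto f atBot (𝓝 0)) :
    ∫ x, f' x = 0 := by
  have h1 := intervalIntegral_tendsto_integral hi tendsto_neg_atTop_atBot tendsto_id
  refine tendsto_nhds_unique h1 ?_
  have h2 := htop.sub (hbot.comp tendsto_neg_atTop_atBot)
  rw [sub_zero] at h2
  exact h2.congr fun x => (hf.integral_eq h _ _).symm

theorem LocAC.integral_Ioi_eq {f f' : ℝ → ℝ} (hf : LocAC f)
    (h : ∀ᵐ x, 0 < x → HasDerivAt f (f' x) x)
    (hi : IntegrableOn f' (Ioi 0)) (htop : Tendsto f atTop (𝓝 0)) :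
    ∫ x in Ioi (0 : ℝ), f' x = - f 0 := by
  refine tendsto_nhds_unique (intervalIntegral_tendsto_integral_Ioi 0 hi tendsto_id) ?_
  have h2 := htop.sub_const (f 0)
  rw [zero_sub] at h2
  refine h2.congr' ?_
  filter_upwards [eventually_ge_atTop 0] with x hx
  exact ((hf 0 x).intervalIntegrable_and_integral_eq hx (h.mono fun y hy hm => hy hm.1)).2.symm

/-! ### Maps into `ℝ³` -/

theorem lipschitzWith_apply (i : Fin 3) : LipschitzWith 1 (fun y : E3 => y i) :=
  LipschitzWith.of_dist_le_mul fun x y => by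
    simpa [dist_eq_norm] using PiLp.norm_apply_le (x - y) i

theorem LocAC.apply {f : ℝ → E3} (hf : LocAC f) (i : Fin 3) : LocAC (fun x => f x i) :=
  (lipschitzWith_apply i).comp_locAC hf

theorem hasDerivAt_apply {f : ℝ → E3} {f' : E3} {x : ℝ} (hf : HasDerivAt f f' x) (i : Fin 3) :
    HasDerivAt (fun x => f x i) (f' i) x := by
  simpa [Function.comp_def] using ((EuclideanSpace.proj (𝕜 := ℝ) i).hasFDerivAt.comp_hasDerivAt x hf)

theorem norm_sq_eq (y : E3) : ‖y‖ ^ 2 = y 0 ^ 2 + y 1 ^ 2 + y 2 ^ 2 := by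
  rw [EuclideanSpace.norm_sq_eq, Fin.sum_univ_three]; simp

theorem inner_eq (y z : E3) : inner ℝ y z = y 0 * z 0 + y 1 * z 1 + y 2 * z 2 := by
  rw [PiLp.inner_apply, Fin.sum_univ_three]
  simp [mul_comm]

theorem planar_eq (φ : ℝ → ℝ) (x : ℝ) :
    planar φ x = Real.sin (φ x) • e₁ + Real.cos (φ x) • e₂ := by
  ext i; fin_cases i <;> simp [planar, e₁, e₂]

@[simp] theorem planar_apply_zero (φ : ℝ → ℝ) (x : ℝ) : planar φ x 0 = Real.sin (φ x) := rfl
@[simp] theorem planar_apply_one (φ : ℝ → ℝ) (x : ℝ) : planar φ x 1 = Real.cos (φ x) := rfl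
@[simp] theorem planar_apply_two (φ : ℝ → ℝ) (x : ℝ) : planar φ x 2 = 0 := rfl

theorem LocAC.planar {φ : ℝ → ℝ} (hφ : LocAC φ) : LocAC (planar φ) := by
  rw [funext (planar_eq φ)]
  exact (hφ.sin.smul (locAC_const _)).add (hφ.cos.smul (locAC_const _))

theorem hasDerivAt_planar {φ : ℝ → ℝ} {φ' x : ℝ} (h : HasDerivAt φ φ' x) :
    HasDerivAt (planar φ) ((Real.cos (φ x) * φ') • e₁ + (-Real.sin (φ x) * φ') • e₂) x := by
  rw [funext (planar_eq φ)]
  exact (h.sin.smul_const _).add (h.cos.smul_const _)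

theorem norm_planar (φ : ℝ → ℝ) (x : ℝ) : ‖planar φ x‖ = 1 := by
  have := norm_sq_eq (planar φ x)
  simp only [planar_apply_zero, planar_apply_one, planar_apply_two, Real.sin_sq_add_cos_sq] at this
  nlinarith [norm_nonneg (planar φ x)]


/-! ### Half walls -/

/-- `φ` is a wall angle on `[0, ∞)`, and `p` is the continuous representative of the flux `a φ'`
on `(0, ∞)`. -/
structure HalfWall (a φ p : ℝ → ℝ) : Prop where
  locAC : LocAC φ
  flux_locAC : LocAC p
  map_zero : φ 0 = 0
  tendsto : Tendsto φ atTop (𝓝 (Real.pi / 2))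
  nonneg : ∀ x, 0 < x → 0 ≤ φ x
  le : ∀ x, 0 < x → φ x ≤ Real.pi / 2
  sq_integrable : IntegrableOn (fun x => deriv φ x ^ 2) (Ioi 0)
  flux_eq : ∀ᵐ x, 0 < x → a x * deriv φ x = p x
  flux_deriv : ∀ᵐ x, 0 < x → HasDerivAt p (-(a x * (Real.sin (φ x) * Real.cos (φ x)))) x

/-! ### A priori bounds for half walls -/

namespace HalfWall

variable {a φ p : ℝ → ℝ} {a₀ A₀ : ℝ}

theorem mem_Icc (h : HalfWall a φ p) {x : ℝ} (hx : 0 ≤ x) : φ x ∈ Icc 0 (Real.pi / 2) := by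
  rcases hx.eq_or_lt with rfl | hx
  · rw [h.map_zero]; exact ⟨le_rfl, by positivity⟩
  · exact ⟨h.nonneg x hx, h.le x hx⟩

theorem sin_nonneg (h : HalfWall a φ p) {x : ℝ} (hx : 0 ≤ x) : 0 ≤ Real.sin (φ x) :=
  Real.sin_nonneg_of_nonneg_of_le_pi (h.mem_Icc hx).1
    (by linarith [(h.mem_Icc hx).2, Real.pi_pos])

theorem cos_nonneg (h : HalfWall a φ p) {x : ℝ} (hx : 0 ≤ x) : 0 ≤ Real.cos (φ x) :=
  Real.cos_nonneg_of_neg_pi_div_two_le_of_le (by linarith [(h.mem_Icc hx).1, Real.pi_pos])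
    (h.mem_Icc hx).2

theorem flux_antitone (h : HalfWall a φ p) (ha₀ : 0 < a₀) (hb : ∀ᵐ x, a₀ ≤ a x ∧ a x ≤ A₀)
    {x y : ℝ} (hx : 0 ≤ x) (hxy : x ≤ y) : p y ≤ p x := by
  refine (h.flux_locAC x y).le_of_deriv_nonpos hxy
    (f' := fun x => -(a x * (Real.sin (φ x) * Real.cos (φ x)))) ?_
  filter_upwards [h.flux_deriv, hb] with t ht hbt hm
  have h0 : 0 < t := hx.trans_lt hm.1
  refine ⟨ht h0, ?_⟩
  have := mul_nonneg (ha₀.le.trans hbt.1) (mul_nonneg (h.sin_nonneg h0.le) (h.cos_nonneg h0.le))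
  linarith

theorem flux_sq_integrableOn (h : HalfWall a φ p) (ha₀ : 0 < a₀)
    (hb : ∀ᵐ x, a₀ ≤ a x ∧ a x ≤ A₀) : IntegrableOn (fun x => p x ^ 2) (Ioi 0) := by
  refine Integrable.mono' (h.sq_integrable.const_mul (A₀ ^ 2))
    (h.flux_locAC.continuous.pow 2).aestronglyMeasurable ?_
  rw [ae_restrict_iff' measurableSet_Ioi]
  filter_upwards [h.flux_eq, hb] with t ht hbt hm
  rw [← ht hm, Real.norm_of_nonneg (sq_nonneg _), mul_pow]
  have : 0 < a t := ha₀.trans_le hbt.1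
  gcongr
  exact hbt.2

/-- The flux is non-increasing, so a negative value would keep p² above a positive constant on a
half line, against square integrability. -/
theorem flux_nonneg (h : HalfWall a φ p) (ha₀ : 0 < a₀) (hb : ∀ᵐ x, a₀ ≤ a x ∧ a x ≤ A₀)
    {x : ℝ} (hx : 0 ≤ x) : 0 ≤ p x := by
  by_contra! hneg
  have h1 : IntegrableOn (fun _ : ℝ => p x ^ 2) (Ioi x) := by
    refine Integrable.mono' ((h.flux_sq_integrableOn ha₀ hb).mono_set (Ioi_subset_Ioi hx))
      aestronglyMeasurable_const ?_
    rw [ae_restrict_iff' measurableSet_Ioi]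
    refine Eventually.of_forall fun t ht => ?_
    have := h.flux_antitone ha₀ hb hx (le_of_lt ht)
    rw [Real.norm_of_nonneg (sq_nonneg _)]
    nlinarith
  rw [integrableOn_const_iff] at h1
  simp [hneg.ne] at h1

theorem flux_tendsto (h : HalfWall a φ p) (ha₀ : 0 < a₀) (hb : ∀ᵐ x, a₀ ≤ a x ∧ a x ≤ A₀) :
    Tendsto p atTop (𝓝 0) := by
  rw [Metric.tendsto_atTop]
  intro ε hε
  by_contra! hcon
  have h0 : ∀ x, 0 ≤ x → ε ≤ p x := fun x hx => by
    obtain ⟨y, hy, hd⟩ := hcon x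
    rw [Real.dist_eq, sub_zero, abs_of_nonneg (h.flux_nonneg ha₀ hb (hx.trans hy))] at hd
    exact hd.trans (h.flux_antitone ha₀ hb hx hy)
  have h1 : IntegrableOn (fun _ : ℝ => ε ^ 2) (Ioi 0) := by
    refine Integrable.mono' (h.flux_sq_integrableOn ha₀ hb) aestronglyMeasurable_const ?_
    rw [ae_restrict_iff' measurableSet_Ioi]
    refine Eventually.of_forall fun t ht => ?_
    rw [Real.norm_of_nonneg (sq_nonneg _)]
    have := h0 t (le_of_lt ht)
    gcongr
  rw [integrableOn_const_iff] at h1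
  simp [hε.ne'] at h1

theorem cos_tendsto (h : HalfWall a φ p) : Tendsto (fun x => Real.cos (φ x)) atTop (𝓝 0) := by
  have := (Real.continuous_cos.tendsto (Real.pi / 2)).comp h.tendsto
  rwa [Real.cos_pi_div_two] at this

theorem sin_tendsto (h : HalfWall a φ p) : Tendsto (fun x => Real.sin (φ x)) atTop (𝓝 1) := by
  have := (Real.continuous_sin.tendsto (Real.pi / 2)).comp h.tendsto
  rwa [Real.sin_pi_div_two] at this

theorem deriv_nonneg (h : HalfWall a φ p) (ha₀ : 0 < a₀) (hb : ∀ᵐ x, a₀ ≤ a x ∧ a x ≤ A₀) :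
    ∀ᵐ x, 0 < x → 0 ≤ deriv φ x := by
  filter_upwards [h.flux_eq, hb] with x hx hbx h0
  have h1 := h.flux_nonneg ha₀ hb h0.le
  rw [← hx h0] at h1
  exact nonneg_of_mul_nonneg_right h1 (ha₀.trans_le hbx.1)

/-- This is the conserved energy of the pendulum when a² = K. For variable weights the sign of K -
a² decides its monotonicity, since sin φ, cos φ and φ' are nonnegative. -/
theorem hasDerivAt_flux_sq_sub (h : HalfWall a φ p) (K : ℝ) :
    ∀ᵐ x, 0 < x → HasDerivAt (fun x => p x ^ 2 - K * Real.cos (φ x) ^ 2)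
      (2 * (Real.sin (φ x) * Real.cos (φ x) * deriv φ x) * (K - a x ^ 2)) x := by
  filter_upwards [h.flux_eq, h.flux_deriv, h.locAC.ae_hasDerivAt] with x h1 h2 h3 h0
  have h4 := ((h2 h0).pow 2).sub ((h3.cos.pow 2).const_mul K)
  rw [← h1 h0] at h4
  refine h4.congr_deriv ?_
  push_cast
  ring

theorem locAC_flux_sq_sub (h : HalfWall a φ p) (K : ℝ) :
    LocAC (fun x => p x ^ 2 - K * Real.cos (φ x) ^ 2) := by
  simp_rw [pow_two]
  exact (h.flux_locAC.mul h.flux_locAC).sub ((locAC_const K).mul (h.locAC.cos.mul h.locAC.cos))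

theorem tendsto_flux_sq_sub (h : HalfWall a φ p) (ha₀ : 0 < a₀)
    (hb : ∀ᵐ x, a₀ ≤ a x ∧ a x ≤ A₀) (K : ℝ) :
    Tendsto (fun x => p x ^ 2 - K * Real.cos (φ x) ^ 2) atTop (𝓝 0) := by
  simpa using ((h.flux_tendsto ha₀ hb).pow 2).sub ((h.cos_tendsto.pow 2).const_mul K)

/-- The first integral decreases to 0 beyond x. The constant may depend on x: besides K = a₀², the
choice K = a(x)² is used for monotone weights. -/
theorem mul_cos_sq_le_flux_sq (h : HalfWall a φ p) (ha₀ : 0 < a₀)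
    (hb : ∀ᵐ x, a₀ ≤ a x ∧ a x ≤ A₀) {K x : ℝ} (hx : 0 ≤ x) (hK : ∀ᵐ t, x < t → K ≤ a t ^ 2) :
    K * Real.cos (φ x) ^ 2 ≤ p x ^ 2 := by
  suffices 0 ≤ p x ^ 2 - K * Real.cos (φ x) ^ 2 by linarith
  -- The point |y| + x tends to infinity with y and never lies below x, so the comparison holds for
  -- every y.
  refine le_of_tendsto' ((h.tendsto_flux_sq_sub ha₀ hb K).comp (tendsto_atTop_add_const_right _ x
    tendsto_abs_atTop_atTop)) fun y => ?_
  have hxy : x ≤ |y| + x := by linarith [abs_nonneg y]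
  refine (h.locAC_flux_sq_sub K x _).le_of_deriv_nonpos hxy
    (f' := fun x => 2 * (Real.sin (φ x) * Real.cos (φ x) * deriv φ x) * (K - a x ^ 2)) ?_
  filter_upwards [h.hasDerivAt_flux_sq_sub K, h.deriv_nonneg ha₀ hb, hK] with t h1 h2 h3 hm
  have h0 : 0 < t := hx.trans_lt hm.1
  refine ⟨h1 h0, mul_nonpos_of_nonneg_of_nonpos ?_ (by linarith [h3 hm.1])⟩
  have := mul_nonneg (mul_nonneg (h.sin_nonneg h0.le) (h.cos_nonneg h0.le)) (h2 h0)
  linarith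

theorem flux_sq_le_mul_cos_sq (h : HalfWall a φ p) (ha₀ : 0 < a₀)
    (hb : ∀ᵐ x, a₀ ≤ a x ∧ a x ≤ A₀) {x : ℝ} (hx : 0 ≤ x) :
    p x ^ 2 ≤ A₀ ^ 2 * Real.cos (φ x) ^ 2 := by
  suffices 0 ≤ -(p x ^ 2 - A₀ ^ 2 * Real.cos (φ x) ^ 2) by linarith
  have hlim := (h.tendsto_flux_sq_sub ha₀ hb (A₀ ^ 2)).neg
  rw [neg_zero] at hlim
  refine le_of_tendsto' (hlim.comp (tendsto_atTop_add_const_right _ x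
    tendsto_abs_atTop_atTop)) fun y => ?_
  have hxy : x ≤ |y| + x := by linarith [abs_nonneg y]
  refine (h.locAC_flux_sq_sub (A₀ ^ 2)).neg x _ |>.le_of_deriv_nonpos hxy
    (f' := fun x => -(2 * (Real.sin (φ x) * Real.cos (φ x) * deriv φ x) * (A₀ ^ 2 - a x ^ 2))) ?_
  filter_upwards [h.hasDerivAt_flux_sq_sub (A₀ ^ 2), h.deriv_nonneg ha₀ hb, hb] with t h1 h2 h3 hm
  have h0 : 0 < t := hx.trans_lt hm.1
  have h4 := mul_nonneg (mul_nonneg (h.sin_nonneg h0.le) (h.cos_nonneg h0.le)) (h2 h0)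
  refine ⟨(h1 h0).neg, neg_nonpos.2 (mul_nonneg (by linarith) ?_)⟩
  nlinarith

theorem mul_cos_le_flux (h : HalfWall a φ p) (ha₀ : 0 < a₀)
    (hb : ∀ᵐ x, a₀ ≤ a x ∧ a x ≤ A₀) {x : ℝ} (hx : 0 ≤ x) : a₀ * Real.cos (φ x) ≤ p x := by
  refine le_of_sq_le_sq ?_ (h.flux_nonneg ha₀ hb hx)
  rw [mul_pow]
  refine h.mul_cos_sq_le_flux_sq ha₀ hb hx (hb.mono fun t ht _ => ?_)
  have := ht.1
  gcongr

theorem flux_le_mul_cos (h : HalfWall a φ p) (ha₀ : 0 < a₀) (hA₀ : a₀ ≤ A₀)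
    (hb : ∀ᵐ x, a₀ ≤ a x ∧ a x ≤ A₀) {x : ℝ} (hx : 0 ≤ x) : p x ≤ A₀ * Real.cos (φ x) := by
  refine le_of_sq_le_sq ?_ (mul_nonneg (ha₀.le.trans hA₀) (h.cos_nonneg hx))
  rw [mul_pow]
  exact h.flux_sq_le_mul_cos_sq ha₀ hb hx

theorem deriv_le (h : HalfWall a φ p) (ha₀ : 0 < a₀) (hA₀ : a₀ ≤ A₀)
    (hb : ∀ᵐ x, a₀ ≤ a x ∧ a x ≤ A₀) :
    ∀ᵐ x, 0 < x → deriv φ x ≤ A₀ / a₀ * Real.cos (φ x) := by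
  filter_upwards [h.flux_eq, hb, h.deriv_nonneg ha₀ hb] with x hx hbx h2 h0
  have h1 := h.flux_le_mul_cos ha₀ hA₀ hb h0.le
  rw [← hx h0] at h1
  have h3 := mul_le_mul_of_nonneg_right hbx.1 (h2 h0)
  rw [div_mul_eq_mul_div, le_div_iff₀ ha₀]
  linarith

/-- By φ' ≤ (A₀/a₀) cos φ, the function exp(A₀ x/a₀) cos φ is non-decreasing, and it equals 1 at the
origin: the angle π/2 is not reached in finite time. -/
theorem cos_pos (h : HalfWall a φ p) (ha₀ : 0 < a₀) (hA₀ : a₀ ≤ A₀)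
    (hb : ∀ᵐ x, a₀ ≤ a x ∧ a x ≤ A₀) {x : ℝ} (hx : 0 ≤ x) : 0 < Real.cos (φ x) := by
  have hexp : LocAC fun x : ℝ => Real.exp (A₀ / a₀ * x) := fun b c =>
    ContDiffOn.absolutelyContinuousOnInterval (by fun_prop)
  have h1 := (hexp.mul h.locAC.cos).neg 0 x |>.le_of_deriv_nonpos hx
    (f' := fun x => -(Real.exp (A₀ / a₀ * x) *
      (A₀ / a₀ * Real.cos (φ x) - Real.sin (φ x) * deriv φ x))) (by
    filter_upwards [h.deriv_le ha₀ hA₀ hb, h.deriv_nonneg ha₀ hb, h.locAC.ae_hasDerivAt]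
      with t h1 h2 h3 hm
    have h4 := ((((hasDerivAt_id t).const_mul (A₀ / a₀)).exp).mul h3.cos).neg
    refine ⟨h4.congr_deriv (by simp; ring), neg_nonpos.2 (mul_nonneg (Real.exp_pos _).le ?_)⟩
    have := mul_le_mul_of_nonneg_right (Real.sin_le_one (φ t)) (h2 hm.1)
    linarith [h1 hm.1])
  simp only [h.map_zero, mul_zero, Real.exp_zero, Real.cos_zero, neg_le_neg_iff, mul_one] at h1
  by_contra! hneg
  have := mul_nonpos_of_nonneg_of_nonpos (Real.exp_pos (A₀ / a₀ * x)).le hneg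
  linarith

/-- As the flux decreases, φ' ≥ p(y)/A₀ before y. Besides strict monotonicity, this gives φ(x) ≥
p(x) x/A₀, which controls the calibration at the origin. -/
theorem mul_flux_le_sub (h : HalfWall a φ p) (ha₀ : 0 < a₀) (hA₀ : a₀ ≤ A₀)
    (hb : ∀ᵐ x, a₀ ≤ a x ∧ a x ≤ A₀) {x y : ℝ} (hx : 0 ≤ x) (hxy : x ≤ y) :
    p y / A₀ * (y - x) ≤ φ y - φ x := by
  have hid : LocAC fun x : ℝ => x := LipschitzWith.id.locAC
  have h1 := ((locAC_const (p y / A₀)).mul hid).sub h.locAC x y |>.le_of_deriv_nonpos hxy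
    (f' := fun x => p y / A₀ * 1 - deriv φ x) (by
    filter_upwards [h.flux_eq, h.deriv_nonneg ha₀ hb, h.locAC.ae_hasDerivAt, hb]
      with t h1 h2 h3 h4 hm
    have h0 : 0 < t := hx.trans_lt hm.1
    refine ⟨((hasDerivAt_id t).const_mul (p y / A₀)).sub h3, ?_⟩
    have h5 := h.flux_antitone ha₀ hb h0.le hm.2.le
    rw [← h1 h0] at h5
    have h6 := mul_le_mul_of_nonneg_right h4.2 (h2 h0)
    rw [mul_one, sub_nonpos, div_le_iff₀ (ha₀.trans_le hA₀)]
    linarith)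
  linarith

theorem sub_le_mul (h : HalfWall a φ p) (ha₀ : 0 < a₀) (hA₀ : a₀ ≤ A₀)
    (hb : ∀ᵐ x, a₀ ≤ a x ∧ a x ≤ A₀) {x y : ℝ} (hx : 0 ≤ x) (hxy : x ≤ y) :
    φ y - φ x ≤ A₀ / a₀ * (y - x) := by
  have hid : LocAC fun x : ℝ => x := LipschitzWith.id.locAC
  have h1 := (h.locAC.sub ((locAC_const (A₀ / a₀)).mul hid)) x y |>.le_of_deriv_nonpos hxy
    (f' := fun x => deriv φ x - A₀ / a₀ * 1) (by
    filter_upwards [h.deriv_le ha₀ hA₀ hb, h.locAC.ae_hasDerivAt] with t h1 h3 hm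
    refine ⟨h3.sub ((hasDerivAt_id t).const_mul (A₀ / a₀)), ?_⟩
    have := mul_le_mul_of_nonneg_left (Real.cos_le_one (φ t)) (div_nonneg (ha₀.le.trans hA₀) ha₀.le)
    linarith [h1 (hx.trans_lt hm.1)])
  linarith

theorem flux_pos (h : HalfWall a φ p) (ha₀ : 0 < a₀) (hA₀ : a₀ ≤ A₀)
    (hb : ∀ᵐ x, a₀ ≤ a x ∧ a x ≤ A₀) {x : ℝ} (hx : 0 ≤ x) : 0 < p x :=
  (mul_pos ha₀ (h.cos_pos ha₀ hA₀ hb hx)).trans_le (h.mul_cos_le_flux ha₀ hb hx)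

theorem strictMonoOn (h : HalfWall a φ p) (ha₀ : 0 < a₀) (hA₀ : a₀ ≤ A₀)
    (hb : ∀ᵐ x, a₀ ≤ a x ∧ a x ≤ A₀) : StrictMonoOn φ (Ici 0) := by
  intro x hx y hy hxy
  have h1 := h.mul_flux_le_sub ha₀ hA₀ hb hx hxy.le
  have h2 := mul_pos (div_pos (h.flux_pos ha₀ hA₀ hb hy) (ha₀.trans_le hA₀)) (sub_pos.2 hxy)
  linarith

theorem pos (h : HalfWall a φ p) (ha₀ : 0 < a₀) (hA₀ : a₀ ≤ A₀)
    (hb : ∀ᵐ x, a₀ ≤ a x ∧ a x ≤ A₀) {x : ℝ} (hx : 0 < x) : 0 < φ x := by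
  have := h.strictMonoOn ha₀ hA₀ hb (mem_Ici.2 le_rfl) (mem_Ici.2 hx.le) hx
  rwa [h.map_zero] at this

theorem sin_pos (h : HalfWall a φ p) (ha₀ : 0 < a₀) (hA₀ : a₀ ≤ A₀)
    (hb : ∀ᵐ x, a₀ ≤ a x ∧ a x ≤ A₀) {x : ℝ} (hx : 0 < x) : 0 < Real.sin (φ x) :=
  Real.sin_pos_of_pos_of_lt_pi (h.pos ha₀ hA₀ hb hx) (by linarith [h.le x hx, Real.pi_pos])

/-- The energy density of a half wall is integrable. -/
theorem integrableOn_density (h : HalfWall a φ p) (ha : AEMeasurable a) (ha₀ : 0 < a₀)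
    (hA₀ : a₀ ≤ A₀) (hb : ∀ᵐ x, a₀ ≤ a x ∧ a x ≤ A₀) :
    IntegrableOn (fun x => a x * (deriv φ x ^ 2 + Real.cos (φ x) ^ 2)) (Ioi 0) := by
  have hm : AEStronglyMeasurable (fun x => a x * (deriv φ x ^ 2 + Real.cos (φ x) ^ 2)) :=
    (ha.mul (((measurable_deriv φ).pow_const 2).add
      (h.locAC.cos.continuous.measurable.pow_const 2)).aemeasurable).aestronglyMeasurable
  refine Integrable.mono' (h.sq_integrable.const_mul (A₀ * (1 + (A₀ / a₀) ^ 2))) hm.restrict ?_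
  rw [ae_restrict_iff' measurableSet_Ioi]
  filter_upwards [h.flux_eq, hb] with t ht hbt hm
  have hpos : 0 < a t := ha₀.trans_le hbt.1
  have hA : 0 ≤ A₀ := ha₀.le.trans hA₀
  -- The potential term is dominated by the gradient term, through a₀ cos φ ≤ p = a φ' ≤ A₀ φ'.
  have h1 : Real.cos (φ t) ^ 2 ≤ (A₀ / a₀) ^ 2 * deriv φ t ^ 2 := by
    have h2 := h.mul_cos_sq_le_flux_sq ha₀ hb (le_of_lt hm) (K := a₀ ^ 2)
      (hb.mono fun t ht _ => by have := ht.1; gcongr)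
    rw [← ht hm] at h2
    rw [div_pow, div_mul_eq_mul_div, le_div_iff₀ (by positivity)]
    have h3 : a t ^ 2 * deriv φ t ^ 2 ≤ A₀ ^ 2 * deriv φ t ^ 2 := by
      gcongr; exact hbt.2
    linarith [mul_pow (a t) (deriv φ t) 2]
  rw [Real.norm_of_nonneg (by positivity)]
  calc a t * (deriv φ t ^ 2 + Real.cos (φ t) ^ 2)
      ≤ A₀ * (deriv φ t ^ 2 + (A₀ / a₀) ^ 2 * deriv φ t ^ 2) := by gcongr; exact hbt.2
    _ = _ := by ring

end HalfWall


/-! ### Calibration on a half line -/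

theorem tendsto_primitive_zero {f : ℝ → ℝ} (hf : IntegrableOn f (Ioi 0)) :
    Tendsto (fun ε => ∫ t in (0 : ℝ)..ε, f t) (𝓝[>] 0) (𝓝 0) := by
  have h1 : IntegrableOn f (uIcc 0 1) := by
    rw [uIcc_of_le zero_le_one, integrableOn_Icc_iff_integrableOn_Ioc]
    exact hf.mono_set Ioc_subset_Ioi_self
  have h2 := (intervalIntegral.continuousOn_primitive_interval h1) 0 left_mem_uIcc
  rw [uIcc_of_le zero_le_one] at h2
  have h3 := h2.tendsto
  rw [intervalIntegral.integral_same] at h3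
  refine h3.mono_left ?_
  rw [← nhdsWithin_Ioc_eq_nhdsGT (zero_lt_one' ℝ)]
  exact nhdsWithin_mono _ Ioc_subset_Icc_self

/-- Cauchy–Schwarz, obtained by integrating the square of the deviation of u' from its mean slope
u(x)/x. -/
theorem sq_le_mul_integral_deriv_sq {u : ℝ → ℝ} {x : ℝ} (hx : 0 < x)
    (hu : AbsolutelyContinuousOnInterval u 0 x) (h0 : u 0 = 0)
    (hi : IntervalIntegrable (fun t => deriv u t ^ 2) volume 0 x) :
    u x ^ 2 ≤ x * ∫ t in (0 : ℝ)..x, deriv u t ^ 2 := by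
  have h1 : 0 ≤ ∫ t in (0 : ℝ)..x, (deriv u t ^ 2 - 2 * (u x / x) * deriv u t + (u x / x) ^ 2) := by
    refine intervalIntegral.integral_nonneg hx.le fun t _ => ?_
    nlinarith [sq_nonneg (deriv u t - u x / x)]
  have h2 := (hu.intervalIntegrable_deriv).const_mul (2 * (u x / x))
  rw [intervalIntegral.integral_add (hi.sub h2) intervalIntegrable_const,
    intervalIntegral.integral_sub hi h2, intervalIntegral.integral_const_mul,
    hu.integral_deriv_eq_sub, intervalIntegral.integral_const, h0, sub_zero, sub_zero,
    smul_eq_mul] at h1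
  have h3 : x * ((∫ t in (0 : ℝ)..x, deriv u t ^ 2) - 2 * (u x / x) * u x + x * (u x / x) ^ 2)
      = x * (∫ t in (0 : ℝ)..x, deriv u t ^ 2) - u x ^ 2 := by
    field_simp; ring
  have h4 := mul_nonneg hx.le h1
  linarith

/-- The energy density of the map `(u, v, w)`. -/
noncomputable def density (a u v w : ℝ → ℝ) (x : ℝ) : ℝ :=
  a x * (deriv u x ^ 2 + deriv v x ^ 2 + deriv w x ^ 2) + a x * (v x ^ 2 + w x ^ 2)

/-- The defect of the calibration associated with `φ`. -/
noncomputable def defect (a φ u v w : ℝ → ℝ) (x : ℝ) : ℝ :=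
  a x * ((deriv u x - deriv φ x * (Real.cos (φ x) * (Real.sin (φ x))⁻¹) * u x) ^ 2 +
    (deriv v x + deriv φ x * (Real.sin (φ x) * (Real.cos (φ x))⁻¹) * v x) ^ 2 +
    (deriv w x + deriv φ x * (Real.sin (φ x) * (Real.cos (φ x))⁻¹) * w x) ^ 2)

/-- The boundary term of the calibration associated with `φ`. -/
noncomputable def calibration (φ p u v w : ℝ → ℝ) (x : ℝ) : ℝ :=
  p x * (Real.cos (φ x) * (Real.sin (φ x))⁻¹) * (u x * u x) -
    p x * (Real.sin (φ x) * (Real.cos (φ x))⁻¹) * (v x * v x + w x * w x)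

theorem aestronglyMeasurable_density {a u v w : ℝ → ℝ} (ha : AEMeasurable a) (hv : Continuous v)
    (hw : Continuous w) : AEStronglyMeasurable (density a u v w) :=
  ((ha.mul ((((measurable_deriv u).pow_const 2).add ((measurable_deriv v).pow_const 2)).add
    ((measurable_deriv w).pow_const 2)).aemeasurable).add (ha.mul ((hv.measurable.pow_const 2).add
      (hw.measurable.pow_const 2)).aemeasurable)).aestronglyMeasurable

theorem density_nonneg {a u v w : ℝ → ℝ} {x : ℝ} (h : 0 ≤ a x) : 0 ≤ density a u v w x := by
  unfold density; positivity

theorem hasDerivAt_cos_mul_inv_sin {φ : ℝ → ℝ} {φ' x : ℝ} (h : HasDerivAt φ φ' x)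
    (hs : Real.sin (φ x) ≠ 0) : HasDerivAt (fun x => Real.cos (φ x) * (Real.sin (φ x))⁻¹)
      (-(1 + (Real.cos (φ x) * (Real.sin (φ x))⁻¹) ^ 2) * φ') x := by
  refine (h.cos.mul (h.sin.inv hs)).congr_deriv ?_
  simp only [Pi.inv_apply]
  field_simp
  ring

theorem hasDerivAt_sin_mul_inv_cos {φ : ℝ → ℝ} {φ' x : ℝ} (h : HasDerivAt φ φ' x)
    (hc : Real.cos (φ x) ≠ 0) : HasDerivAt (fun x => Real.sin (φ x) * (Real.cos (φ x))⁻¹)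
      ((1 + (Real.sin (φ x) * (Real.cos (φ x))⁻¹) ^ 2) * φ') x := by
  refine (h.sin.mul (h.cos.inv hc)).congr_deriv ?_
  simp only [Pi.inv_apply]
  field_simp

/-- The null Lagrangian identity: the cross terms of the squares in the defect belong to the
derivative of the calibration, and the remaining quadratic terms collapse by the flux equation and
the constraint u² + v² + w² = 1. -/
theorem hasDerivAt_calibration {a φ p u v w : ℝ → ℝ} {x : ℝ} (hs : Real.sin (φ x) ≠ 0)
    (hc : Real.cos (φ x) ≠ 0) (hφ : HasDerivAt φ (deriv φ x) x) (hpx : a x * deriv φ x = p x)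
    (hp : HasDerivAt p (-(a x * (Real.sin (φ x) * Real.cos (φ x)))) x)
    (hu : HasDerivAt u (deriv u x) x) (hv : HasDerivAt v (deriv v x) x)
    (hw : HasDerivAt w (deriv w x) x) (h1 : u x ^ 2 + v x ^ 2 + w x ^ 2 = 1) :
    HasDerivAt (calibration φ p u v w) (density a u v w x -
      a x * (deriv φ x ^ 2 + Real.cos (φ x) ^ 2) - defect a φ u v w x) x := by
  have hk := hasDerivAt_cos_mul_inv_sin hφ hs
  have ht := hasDerivAt_sin_mul_inv_cos hφ hc
  have hD := ((hp.mul hk).mul (hu.mul hu)).sub ((hp.mul ht).mul ((hv.mul hv).add (hw.mul hw)))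
  refine hD.congr_deriv ?_
  -- These two relations are all that the identity needs about cot φ and tan φ, which can then be
  -- treated as free variables.
  have e1 : Real.sin (φ x) * Real.cos (φ x) * (Real.cos (φ x) * (Real.sin (φ x))⁻¹)
      = Real.cos (φ x) ^ 2 := by field_simp
  have e2 : Real.sin (φ x) * Real.cos (φ x) * (Real.sin (φ x) * (Real.cos (φ x))⁻¹)
      = 1 - Real.cos (φ x) ^ 2 := by rw [← Real.sin_sq]; field_simp
  simp only [Pi.mul_apply, Pi.add_apply, ← hpx, density, defect]
  generalize Real.cos (φ x) * (Real.sin (φ x))⁻¹ = k at *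
  generalize Real.sin (φ x) * (Real.cos (φ x))⁻¹ = t at *
  linear_combination (-(a x) * (u x ^ 2)) * e1 + (a x * (v x ^ 2 + w x ^ 2)) * e2 +
    (-(a x) * (deriv φ x ^ 2 + Real.cos (φ x) ^ 2)) * h1

/-! ### The calibration inequality for competitors -/

namespace HalfWall

variable {a φ p : ℝ → ℝ} {a₀ A₀ : ℝ}

theorem calibration_absolutelyContinuous (h : HalfWall a φ p) (ha₀ : 0 < a₀) (hA₀ : a₀ ≤ A₀)
    (hb : ∀ᵐ x, a₀ ≤ a x ∧ a x ≤ A₀) {u v w : ℝ → ℝ} (hu : LocAC u) (hv : LocAC v) (hw : LocAC w)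
    {c d : ℝ} (hc : 0 < c) (hcd : c ≤ d) :
    AbsolutelyContinuousOnInterval (calibration φ p u v w) c d := by
  have hs := (h.locAC.sin c d).inv_of_pos fun x hx => by
    rw [uIcc_of_le hcd] at hx
    exact h.sin_pos ha₀ hA₀ hb (hc.trans_le hx.1)
  have hcos := (h.locAC.cos c d).inv_of_pos fun x hx => by
    rw [uIcc_of_le hcd] at hx
    exact h.cos_pos ha₀ hA₀ hb (hc.le.trans hx.1)
  exact (((h.flux_locAC c d).fun_mul ((h.locAC.cos c d).fun_mul hs)).fun_mul
    (hu.mul hu c d)).fun_sub (((h.flux_locAC c d).fun_mul ((h.locAC.sin c d).fun_mul hcos)).fun_mul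
      (((hv.mul hv).add (hw.mul hw)) c d))

/-- The pole of cot φ at the origin is absorbed by u² ≤ x ∫ u'²: Jordan's inequality sin φ ≥ 2φ/π
and φ ≥ p x/A₀ bound p x/sin φ by π A₀/2. The tangent term only lowers the value. -/
theorem calibration_le (h : HalfWall a φ p) (ha₀ : 0 < a₀) (hA₀ : a₀ ≤ A₀)
    (hb : ∀ᵐ x, a₀ ≤ a x ∧ a x ≤ A₀) {u v w : ℝ → ℝ} (hu : LocAC u) (hu0 : u 0 = 0)
    (hi : IntegrableOn (fun t => deriv u t ^ 2) (Ioi 0)) {x : ℝ} (hx : 0 < x) :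
    calibration φ p u v w x ≤ Real.pi * A₀ / 2 * ∫ t in (0 : ℝ)..x, deriv u t ^ 2 := by
  have hs := h.sin_pos ha₀ hA₀ hb hx
  have hc := h.cos_pos ha₀ hA₀ hb hx.le
  have hp := h.flux_pos ha₀ hA₀ hb hx.le
  have hA : 0 < A₀ := ha₀.trans_le hA₀
  have h1 := sq_le_mul_integral_deriv_sq hx (hu 0 x) hu0
    ((intervalIntegrable_iff_integrableOn_Ioc_of_le hx.le).2 (hi.mono_set Ioc_subset_Ioi_self))
  have h2 := h.mul_flux_le_sub ha₀ hA₀ hb le_rfl hx.le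
  rw [h.map_zero, sub_zero, sub_zero] at h2
  have h3 : 2 / Real.pi * (p x / A₀ * x) ≤ Real.sin (φ x) :=
    (mul_le_mul_of_nonneg_left h2 (by positivity)).trans
      (Real.mul_le_sin (h.nonneg x hx) (h.le x hx))
  set I := ∫ t in (0 : ℝ)..x, deriv u t ^ 2
  have hI : 0 ≤ I := nonneg_of_mul_nonneg_right ((sq_nonneg _).trans h1) hx
  have h4 : 0 ≤ p x * (Real.sin (φ x) * (Real.cos (φ x))⁻¹) * (v x * v x + w x * w x) :=
    mul_nonneg (by positivity) (by nlinarith [sq_nonneg (v x), sq_nonneg (w x)])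
  have h5 : p x * (Real.cos (φ x) * (Real.sin (φ x))⁻¹) * (u x * u x)
      ≤ Real.pi * A₀ / 2 * I := by
    calc p x * (Real.cos (φ x) * (Real.sin (φ x))⁻¹) * (u x * u x)
        ≤ p x * (1 * (Real.sin (φ x))⁻¹) * (x * I) := by
          rw [← pow_two]
          gcongr
          exact Real.cos_le_one _
      _ = p x * x * I / Real.sin (φ x) := by field_simp
      _ ≤ Real.pi * A₀ / 2 * I := by
          rw [div_le_iff₀ hs]
          calc p x * x * I = Real.pi * A₀ / 2 * I * (2 / Real.pi * (p x / A₀ * x)) := by field_simp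
            _ ≤ _ := by gcongr
  unfold calibration
  linarith

/-- The pole of tan φ at infinity is cancelled by p ≤ A₀ cos φ, so the tangent term is controlled by
v² + w² = 1 - u², which tends to 0 for competitors. -/
theorem neg_le_calibration (h : HalfWall a φ p) (ha₀ : 0 < a₀) (hA₀ : a₀ ≤ A₀)
    (hb : ∀ᵐ x, a₀ ≤ a x ∧ a x ≤ A₀) {u v w : ℝ → ℝ} {x : ℝ} (hx : 0 < x)
    (h1 : u x ^ 2 + v x ^ 2 + w x ^ 2 = 1) :
    -(A₀ * (1 - u x ^ 2)) ≤ calibration φ p u v w x := by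
  have hs := h.sin_pos ha₀ hA₀ hb hx
  have hc := h.cos_pos ha₀ hA₀ hb hx.le
  have hp := h.flux_pos ha₀ hA₀ hb hx.le
  have hA : 0 < A₀ := ha₀.trans_le hA₀
  have h2 : p x * (Real.sin (φ x) * (Real.cos (φ x))⁻¹) ≤ A₀ := by
    rw [← mul_assoc, ← div_eq_mul_inv, div_le_iff₀ hc]
    calc p x * Real.sin (φ x) ≤ p x * 1 := by gcongr; exact Real.sin_le_one _
      _ ≤ _ := by rw [mul_one]; exact h.flux_le_mul_cos ha₀ hA₀ hb hx.le
  have h3 : v x * v x + w x * w x = 1 - u x ^ 2 := by linarith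
  have h4 : 0 ≤ 1 - u x ^ 2 := by nlinarith [sq_nonneg (v x), sq_nonneg (w x)]
  have h5 : 0 ≤ p x * (Real.cos (φ x) * (Real.sin (φ x))⁻¹) * (u x * u x) :=
    mul_nonneg (by positivity) (mul_self_nonneg _)
  unfold calibration
  rw [h3]
  have := mul_le_mul_of_nonneg_right h2 h4
  linarith

theorem integral_defect_le (h : HalfWall a φ p) (ha : AEMeasurable a) (ha₀ : 0 < a₀)
    (hA₀ : a₀ ≤ A₀) (hb : ∀ᵐ x, a₀ ≤ a x ∧ a x ≤ A₀) {u v w : ℝ → ℝ} (hu : LocAC u)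
    (hv : LocAC v) (hw : LocAC w) (h1 : ∀ x, 0 < x → u x ^ 2 + v x ^ 2 + w x ^ 2 = 1)
    (hu0 : u 0 = 0) (hlim : Tendsto u atTop (𝓝 1))
    (hi : IntegrableOn (density a u v w) (Ioi 0)) {c d : ℝ} (hc : 0 < c) (hcd : c ≤ d) :
    IntervalIntegrable (defect a φ u v w) volume c d ∧
    ∫ x in c..d, defect a φ u v w x ≤ (∫ x in Ioi (0 : ℝ), density a u v w x) -
      ∫ x in Ioi (0 : ℝ), a x * (deriv φ x ^ 2 + Real.cos (φ x) ^ 2) := by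
  have hl := h.integrableOn_density ha ha₀ hA₀ hb
  set g : ℝ → ℝ := fun x => density a u v w x - a x * (deriv φ x ^ 2 + Real.cos (φ x) ^ 2) with hg
  have hgi : IntegrableOn g (Ioi 0) := hi.sub hl
  have hgI : ∀ {b c : ℝ}, 0 ≤ b → b ≤ c → IntervalIntegrable g volume b c := fun hb hc =>
    (intervalIntegrable_iff_integrableOn_Ioc_of_le hc).2
      (hgi.mono_set (Ioc_subset_Ioi_self.trans (Ioi_subset_Ioi hb)))
  have hui : IntegrableOn (fun t => deriv u t ^ 2) (Ioi 0) := by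
    refine Integrable.mono' (hi.const_mul a₀⁻¹)
      ((measurable_deriv u).pow_const 2).aestronglyMeasurable.restrict ?_
    refine ae_restrict_of_ae ?_
    filter_upwards [hb] with x hx
    rw [Real.norm_of_nonneg (sq_nonneg _), le_inv_mul_iff₀ ha₀]
    unfold density
    have := ha₀.trans_le hx.1
    calc a₀ * deriv u x ^ 2 ≤ a x * deriv u x ^ 2 := by gcongr; exact hx.1
      _ ≤ _ := by
        have : 0 ≤ a x * (deriv v x ^ 2 + deriv w x ^ 2) + a x * (v x ^ 2 + w x ^ 2) := by
          positivity
        linarith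
  -- Away from 0 the calibration is absolutely continuous with derivative g minus the defect; the
  -- defect is integrable as a difference of two integrable functions.
  have key : ∀ b c : ℝ, 0 < b → b ≤ c → IntervalIntegrable (defect a φ u v w) volume b c ∧
      ∫ x in b..c, defect a φ u v w x
        = (∫ x in b..c, g x) - (calibration φ p u v w c - calibration φ p u v w b) := by
    intro b c hb0 hbc
    obtain ⟨k1, k2⟩ :=
      (h.calibration_absolutelyContinuous ha₀ hA₀ hb hu hv hw hb0
        hbc).intervalIntegrable_and_integral_eq hbc
        (f' := fun x => g x - defect a φ u v w x) (by
        filter_upwards [h.locAC.ae_hasDerivAt, h.flux_eq, h.flux_deriv, hu.ae_hasDerivAt,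
          hv.ae_hasDerivAt, hw.ae_hasDerivAt] with x e1 e2 e3 e4 e5 e6 hm
        have h0 : 0 < x := hb0.trans hm.1
        exact hasDerivAt_calibration (h.sin_pos ha₀ hA₀ hb h0).ne'
          (h.cos_pos ha₀ hA₀ hb h0.le).ne' e1 (e2 h0) (e3 h0) e4 e5 e6 (h1 x h0))
    have k3 : IntervalIntegrable (defect a φ u v w) volume b c := by
      have := (hgI hb0.le hbc).sub k1
      simpa [Pi.sub_def] using this
    refine ⟨k3, ?_⟩
    rw [intervalIntegral.integral_sub (hgI hb0.le hbc) k3] at k2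
    linarith
  refine ⟨(key c d hc hcd).1, ?_⟩
  -- The interval [c, d] is enlarged to [ε, R], and both boundary errors are explicit. The limit ε →
  -- 0 removes the one at the origin, and R → ∞ the other.
  have step : ∀ ε R : ℝ, 0 < ε → ε ≤ c → d ≤ R → ∫ x in c..d, defect a φ u v w x ≤
      (∫ x in (0 : ℝ)..R, g x) - (∫ x in (0 : ℝ)..ε, g x) +
        (Real.pi * A₀ / 2 * (∫ t in (0 : ℝ)..ε, deriv u t ^ 2) + A₀ * (1 - u R ^ 2)) := by
    intro ε R hε hεc hdR
    have hεR : ε ≤ R := hεc.trans (hcd.trans hdR)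
    have k1 : ∫ x in c..d, defect a φ u v w x ≤ ∫ x in ε..R, defect a φ u v w x := by
      refine intervalIntegral.integral_mono_interval hεc hcd hdR ?_ (key ε R hε hεR).1
      refine ae_restrict_of_ae (hb.mono fun x hx => ?_)
      have := ha₀.le.trans hx.1
      simp only [Pi.zero_apply, defect]
      positivity
    rw [(key ε R hε hεR).2] at k1
    have k2 : (∫ x in (0 : ℝ)..ε, g x) + ∫ x in ε..R, g x = ∫ x in (0 : ℝ)..R, g x :=
      intervalIntegral.integral_add_adjacent_intervals (hgI le_rfl hε.le) (hgI hε.le hεR)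
    have k3 := h.calibration_le ha₀ hA₀ hb (v := v) (w := w) hu hu0 hui hε
    have k4 := h.neg_le_calibration ha₀ hA₀ hb (hε.trans_le hεR) (h1 R (hε.trans_le hεR))
    linarith
  have step2 : ∀ R : ℝ, d ≤ R → ∫ x in c..d, defect a φ u v w x ≤
      (∫ x in (0 : ℝ)..R, g x) + A₀ * (1 - u R ^ 2) := by
    intro R hdR
    have hT := ((tendsto_primitive_zero hgi).const_sub (∫ x in (0 : ℝ)..R, g x)).add
      (((tendsto_primitive_zero hui).const_mul (Real.pi * A₀ / 2)).add_const (A₀ * (1 - u R ^ 2)))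
    rw [sub_zero, mul_zero, zero_add] at hT
    refine ge_of_tendsto hT ?_
    filter_upwards [Ioc_mem_nhdsGT hc] with ε hε
    exact step ε R hε.1 hε.2 hdR
  have hT := (intervalIntegral_tendsto_integral_Ioi 0 hgi tendsto_id).add
    (((hlim.pow 2).const_sub 1).const_mul A₀)
  rw [one_pow, sub_self, mul_zero, add_zero, integral_sub hi hl] at hT
  refine ge_of_tendsto hT ?_
  filter_upwards [eventually_ge_atTop d] with R hR
  exact step2 R hR

/-- A half wall minimizes the energy on the half line. -/
theorem lintegral_le (h : HalfWall a φ p) (ha : AEMeasurable a) (ha₀ : 0 < a₀)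
    (hA₀ : a₀ ≤ A₀) (hb : ∀ᵐ x, a₀ ≤ a x ∧ a x ≤ A₀) {u v w : ℝ → ℝ} (hu : LocAC u)
    (hv : LocAC v) (hw : LocAC w) (h1 : ∀ x, 0 < x → u x ^ 2 + v x ^ 2 + w x ^ 2 = 1)
    (hu0 : u 0 = 0) (hlim : Tendsto u atTop (𝓝 1)) :
    ∫⁻ x in Ioi (0 : ℝ), ENNReal.ofReal (a x * (deriv φ x ^ 2 + Real.cos (φ x) ^ 2)) ≤
      ∫⁻ x in Ioi (0 : ℝ), ENNReal.ofReal (density a u v w x) := by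
  by_cases hfin : ∫⁻ x in Ioi (0 : ℝ), ENNReal.ofReal (density a u v w x) = ⊤
  · rw [hfin]; exact le_top
  have hpos : 0 ≤ᵐ[volume.restrict (Ioi (0 : ℝ))] density a u v w :=
    ae_restrict_of_ae (hb.mono fun x hx => density_nonneg (ha₀.le.trans hx.1))
  have hi : IntegrableOn (density a u v w) (Ioi 0) :=
    ⟨(aestronglyMeasurable_density ha hv.continuous hw.continuous).restrict,
      (hasFiniteIntegral_iff_ofReal hpos).2 (lt_top_iff_ne_top.2 hfin)⟩
  have hpos' : 0 ≤ᵐ[volume.restrict (Ioi (0 : ℝ))]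
      fun x => a x * (deriv φ x ^ 2 + Real.cos (φ x) ^ 2) :=
    ae_restrict_of_ae (hb.mono fun x hx => by
      have := ha₀.le.trans hx.1
      simp only [Pi.zero_apply]
      positivity)
  rw [← ofReal_integral_eq_lintegral_ofReal hi hpos, ← ofReal_integral_eq_lintegral_ofReal
    (h.integrableOn_density ha ha₀ hA₀ hb) hpos']
  refine ENNReal.ofReal_le_ofReal ?_
  -- On the degenerate interval [1, 1] the defect integrates to 0, which leaves the comparison of
  -- energies.
  have := (h.integral_defect_le ha ha₀ hA₀ hb hu hv hw h1 hu0 hlim hi one_pos le_rfl).2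
  rw [intervalIntegral.integral_same] at this
  linarith

/-- A half wall is the unique minimizer of the energy on the half line. -/
theorem eq_of_lintegral_le (h : HalfWall a φ p) (ha : AEMeasurable a) (ha₀ : 0 < a₀)
    (hA₀ : a₀ ≤ A₀) (hb : ∀ᵐ x, a₀ ≤ a x ∧ a x ≤ A₀) {u v w : ℝ → ℝ} (hu : LocAC u)
    (hv : LocAC v) (hw : LocAC w) (h1 : ∀ x, 0 < x → u x ^ 2 + v x ^ 2 + w x ^ 2 = 1)
    (hu0 : u 0 = 0) (hv0 : v 0 = 1) (hw0 : w 0 = 0) (hlim : Tendsto u atTop (𝓝 1))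
    (hle : ∫⁻ x in Ioi (0 : ℝ), ENNReal.ofReal (density a u v w x) ≤
      ∫⁻ x in Ioi (0 : ℝ), ENNReal.ofReal (a x * (deriv φ x ^ 2 + Real.cos (φ x) ^ 2)))
    {x : ℝ} (hx : 0 < x) : u x = Real.sin (φ x) ∧ v x = Real.cos (φ x) ∧ w x = 0 := by
  have hl := h.integrableOn_density ha ha₀ hA₀ hb
  have hpos : 0 ≤ᵐ[volume.restrict (Ioi (0 : ℝ))] density a u v w :=
    ae_restrict_of_ae (hb.mono fun x hx => density_nonneg (ha₀.le.trans hx.1))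
  have hpos' : 0 ≤ᵐ[volume.restrict (Ioi (0 : ℝ))]
      fun x => a x * (deriv φ x ^ 2 + Real.cos (φ x) ^ 2) :=
    ae_restrict_of_ae (hb.mono fun x hx => by
      have := ha₀.le.trans hx.1
      simp only [Pi.zero_apply]
      positivity)
  have hi : IntegrableOn (density a u v w) (Ioi 0) :=
    ⟨(aestronglyMeasurable_density ha hv.continuous hw.continuous).restrict,
      (hasFiniteIntegral_iff_ofReal hpos).2
        (hle.trans_lt ((hasFiniteIntegral_iff_ofReal hpos').1 hl.2))⟩
  rw [← ofReal_integral_eq_lintegral_ofReal hi hpos, ← ofReal_integral_eq_lintegral_ofReal hl hpos',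
    ENNReal.ofReal_le_ofReal_iff (integral_nonneg_of_ae hpos')] at hle
  have hdef : ∀ᵐ x, 0 < x → defect a φ u v w x = 0 := by
    -- These intervals exhaust (0,∞), and on each the integral of the nonnegative defect is at most
    -- an energy difference that is not positive.
    have hn : ∀ n : ℕ, ∀ᵐ x, x ∈ Ioc (1 / ((n : ℝ) + 1)) (n + 1) → defect a φ u v w x = 0 := by
      intro n
      have hn0 : (0 : ℝ) < 1 / (n + 1) := Nat.one_div_pos_of_nat
      have hn1 : 1 / ((n : ℝ) + 1) ≤ n + 1 :=
        ((div_le_one (by positivity)).2 (by linarith [n.cast_nonneg (α := ℝ)])).trans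
          (by linarith [n.cast_nonneg (α := ℝ)])
      obtain ⟨k1, k2⟩ := h.integral_defect_le ha ha₀ hA₀ hb hu hv hw h1 hu0 hlim hi hn0 hn1
      have k3 : 0 ≤ᵐ[volume.restrict (Ioc (1 / ((n : ℝ) + 1)) (n + 1))] defect a φ u v w := by
        refine ae_restrict_of_ae (hb.mono fun x hx => ?_)
        have := ha₀.le.trans hx.1
        simp only [Pi.zero_apply, defect]
        positivity
      have k4 : 0 ≤ ∫ x in (1 / ((n : ℝ) + 1))..(n + 1), defect a φ u v w x :=
        intervalIntegral.integral_nonneg_of_ae_restrict hn1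
          (by rwa [← restrict_Ioc_eq_restrict_Icc])
      have k5 := (intervalIntegral.integral_eq_zero_iff_of_le_of_nonneg_ae hn1 k3 k1).1
        (le_antisymm (by linarith) k4)
      rwa [EventuallyEq, ae_restrict_iff' measurableSet_Ioc] at k5
    filter_upwards [ae_all_iff.2 hn] with x hx h0
    obtain ⟨n, hn⟩ := exists_nat_gt (max x (1 / x))
    refine hx n ⟨?_, by linarith [le_max_left x (1 / x)]⟩
    rw [one_div_lt (by positivity) h0]
    linarith [le_max_right x (1 / x)]
  have hsin : ∀ {c : ℝ}, 0 < c → 0 < Real.sin (φ c) := h.sin_pos ha₀ hA₀ hb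
  have hcos : ∀ {c : ℝ}, 0 ≤ c → 0 < Real.cos (φ c) := h.cos_pos ha₀ hA₀ hb
  have hzero : ∀ᵐ x, 0 < x →
      deriv u x = deriv φ x * (Real.cos (φ x) * (Real.sin (φ x))⁻¹) * u x ∧
      deriv v x = -(deriv φ x * (Real.sin (φ x) * (Real.cos (φ x))⁻¹) * v x) ∧
      deriv w x = -(deriv φ x * (Real.sin (φ x) * (Real.cos (φ x))⁻¹) * w x) := by
    filter_upwards [hdef, hb] with x hx hbx h0
    have h2 := hx h0
    unfold defect at h2
    have h3 := (mul_eq_zero.1 h2).resolve_left (ha₀.trans_le hbx.1).ne'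
    refine ⟨?_, ?_, ?_⟩ <;> refine sub_eq_zero.1 (pow_eq_zero_iff two_ne_zero |>.1
      (le_antisymm ?_ (sq_nonneg _))) <;> nlinarith [sq_nonneg (deriv u x - deriv φ x *
        (Real.cos (φ x) * (Real.sin (φ x))⁻¹) * u x), sq_nonneg (deriv v x + deriv φ x *
        (Real.sin (φ x) * (Real.cos (φ x))⁻¹) * v x), sq_nonneg (deriv w x + deriv φ x *
        (Real.sin (φ x) * (Real.cos (φ x))⁻¹) * w x)]
  refine ⟨?_, ?_⟩
  -- Zero defect makes u/sin φ constant. The constant is read off at infinity, since both functions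
  -- vanish at the origin.
  · have hconst : ∀ d, x ≤ d → u d * (Real.sin (φ d))⁻¹ = u x * (Real.sin (φ x))⁻¹ := by
      intro d hd
      have hac := (hu x d).fun_mul ((h.locAC.sin x d).inv_of_pos fun t ht => by
        rw [uIcc_of_le hd] at ht
        exact hsin (hx.trans_le ht.1))
      have := (hac.intervalIntegrable_and_integral_eq hd (f' := fun _ => 0) (by
        filter_upwards [hzero, hu.ae_hasDerivAt, h.locAC.ae_hasDerivAt] with t e1 e2 e3 hm
        have h0 := hx.trans hm.1
        refine (e2.mul (e3.sin.inv (hsin h0).ne')).congr_deriv ?_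
        rw [(e1 h0).1]
        have := (hsin h0).ne'
        simp only [Pi.inv_apply]
        field_simp
        ring)).2
      rw [intervalIntegral.integral_zero] at this
      linarith
    have hT : Tendsto (fun d => u d * (Real.sin (φ d))⁻¹) atTop (𝓝 1) := by
      simpa using hlim.mul (h.sin_tendsto.inv₀ one_ne_zero)
    have h2 : u x * (Real.sin (φ x))⁻¹ = 1 := by
      refine tendsto_nhds_unique ?_ hT
      refine tendsto_const_nhds.congr' ?_
      filter_upwards [eventually_ge_atTop x] with d hd
      exact (hconst d hd).symm
    rwa [mul_inv_eq_one₀ (hsin hx).ne'] at h2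
  -- Here cos φ is positive down to the origin, so the constants v/cos φ and w/cos φ are the initial
  -- values 1 and 0.
  · have hconst : ∀ f : ℝ → ℝ, LocAC f → (∀ᵐ x, 0 < x →
        deriv f x = -(deriv φ x * (Real.sin (φ x) * (Real.cos (φ x))⁻¹) * f x)) →
        f x = f 0 * Real.cos (φ x) := by
      intro f hf hd
      have hac := (hf 0 x).fun_mul ((h.locAC.cos 0 x).inv_of_pos fun t ht => by
        rw [uIcc_of_le hx.le] at ht
        exact hcos ht.1)
      have := (hac.intervalIntegrable_and_integral_eq hx.le (f' := fun _ => 0) (by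
        filter_upwards [hd, hf.ae_hasDerivAt, h.locAC.ae_hasDerivAt] with t e1 e2 e3 hm
        refine (e2.mul (e3.cos.inv (hcos hm.1.le).ne')).congr_deriv ?_
        rw [e1 hm.1]
        have := (hcos hm.1.le).ne'
        simp only [Pi.inv_apply]
        field_simp
        ring)).2
      rw [intervalIntegral.integral_zero, h.map_zero, Real.cos_zero, inv_one, mul_one] at this
      rw [← sub_eq_zero.1 this.symm]
      have := (hcos hx.le).ne'
      field_simp
    have h2 := hconst v hv (hzero.mono fun t ht h0 => (ht h0).2.1)
    have h3 := hconst w hw (hzero.mono fun t ht h0 => (ht h0).2.2)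
    rw [hv0, one_mul] at h2
    rw [hw0, zero_mul] at h3
    exact ⟨h2, h3⟩

end HalfWall


/-! ### Walls on the whole line -/

theorem aemeasurable_comp_neg {a : ℝ → ℝ} (ha : AEMeasurable a) : AEMeasurable fun x => a (-x) :=
  ha.comp_quasiMeasurePreserving
    (Measure.measurePreserving_neg (volume : Measure ℝ)).quasiMeasurePreserving

theorem lintegral_eq_add_comp_neg (f : ℝ → ℝ≥0∞) :
    ∫⁻ x, f x = (∫⁻ x in Ioi (0 : ℝ), f x) + ∫⁻ x in Ioi (0 : ℝ), f (-x) := by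
  have h1 := (Measure.measurePreserving_neg (volume : Measure ℝ)).setLIntegral_comp_emb
    (MeasurableEquiv.neg ℝ).measurableEmbedding f (Ioi 0)
  rw [h1, ← lintegral_add_compl f (measurableSet_Ioi (a := (0 : ℝ))), compl_Ioi]
  congr 1
  refine setLIntegral_congr ?_
  simpa using (Iio_ae_eq_Iic (μ := (volume : Measure ℝ)) (a := (0 : ℝ))).symm

theorem density_neg (a u v w : ℝ → ℝ) (x : ℝ) :
    density a u v w (-x) =
      density (fun x => a (-x)) (fun x => -u (-x)) (fun x => v (-x)) (fun x => w (-x)) x := by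
  have h : deriv (fun x => -u (-x)) x = deriv u (-x) := by
    rw [deriv.fun_neg, deriv_comp_neg, neg_neg]
  simp only [density, h, deriv_comp_neg, neg_sq]

theorem LocAC.density_ae_eq {a : ℝ → ℝ} {n : ℝ → E3} (hn : LocAC n) : ∀ᵐ x,
    a x * ‖deriv n x‖ ^ 2 + a x * ((n x 1) ^ 2 + (n x 2) ^ 2) =
      density a (fun x => n x 0) (fun x => n x 1) (fun x => n x 2) x := by
  filter_upwards [hn.ae_hasDerivAt] with x hx
  simp only [density, (hasDerivAt_apply hx _).deriv, norm_sq_eq]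

theorem LocAC.energy_eq {n : ℝ → E3} (hn : LocAC n) (a : ℝ → ℝ) : energy a n =
    ∫⁻ x, ENNReal.ofReal (density a (fun x => n x 0) (fun x => n x 1) (fun x => n x 2) x) := by
  rw [energy, if_pos hn]
  exact lintegral_congr_ae ((hn.density_ae_eq (a := a)).mono fun x hx => by simp only [hx])

theorem deriv_planar {φ : ℝ → ℝ} {φ' x : ℝ} (h : HasDerivAt φ φ' x) :
    deriv (planar φ) x = (Real.cos (φ x) * φ') • e₁ + (-Real.sin (φ x) * φ') • e₂ :=
  (hasDerivAt_planar h).deriv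

theorem norm_deriv_planar_sq {φ : ℝ → ℝ} {φ' x : ℝ} (h : HasDerivAt φ φ' x) :
    ‖deriv (planar φ) x‖ ^ 2 = φ' ^ 2 := by
  rw [deriv_planar h, norm_sq_eq]
  simp only [e₁, e₂, PiLp.add_apply, PiLp.smul_apply, smul_eq_mul]
  simp
  linear_combination (φ' ^ 2) * Real.sin_sq_add_cos_sq (φ x)

theorem energy_planar {φ : ℝ → ℝ} (hφ : LocAC φ) (a : ℝ → ℝ) : energy a (planar φ) =
    ∫⁻ x, ENNReal.ofReal (a x * (deriv φ x ^ 2 + Real.cos (φ x) ^ 2)) := by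
  rw [energy, if_pos hφ.planar]
  refine lintegral_congr_ae ?_
  filter_upwards [hφ.ae_hasDerivAt] with x hx
  rw [norm_deriv_planar_sq hx]
  simp [mul_add]

section

variable {a φ p q : ℝ → ℝ} {a₀ A₀ : ℝ}

theorem lintegral_wall_density (a φ : ℝ → ℝ) :
    ∫⁻ x, ENNReal.ofReal (a x * (deriv φ x ^ 2 + Real.cos (φ x) ^ 2)) =
    (∫⁻ x in Ioi (0 : ℝ), ENNReal.ofReal (a x * (deriv φ x ^ 2 + Real.cos (φ x) ^ 2))) +
    ∫⁻ x in Ioi (0 : ℝ), ENNReal.ofReal (a (-x) * (deriv (fun x => -φ (-x)) x ^ 2 +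
      Real.cos (-φ (-x)) ^ 2)) := by
  rw [lintegral_eq_add_comp_neg]
  simp only [deriv.fun_neg, deriv_comp_neg, neg_neg, Real.cos_neg]

theorem strictMono_of_halfWall (h : HalfWall a φ p)
    (h' : HalfWall (fun x => a (-x)) (fun x => -φ (-x)) q) (ha₀ : 0 < a₀) (hA₀ : a₀ ≤ A₀)
    (hb : ∀ᵐ x, a₀ ≤ a x ∧ a x ≤ A₀) : StrictMono φ := by
  refine StrictMonoOn.Iic_union_Ici (a := 0) (fun x hx y hy hxy => ?_)
    (h.strictMonoOn ha₀ hA₀ hb)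
  have hx : x ≤ 0 := hx
  have hy : y ≤ 0 := hy
  have := h'.strictMonoOn ha₀ hA₀ (ae_comp_neg hb) (mem_Ici.2 (neg_nonneg.2 hy))
    (mem_Ici.2 (neg_nonneg.2 hx)) (neg_lt_neg hxy)
  simpa using this

theorem lipschitzWith_of_halfWall (h : HalfWall a φ p)
    (h' : HalfWall (fun x => a (-x)) (fun x => -φ (-x)) q) (ha₀ : 0 < a₀) (hA₀ : a₀ ≤ A₀)
    (hb : ∀ᵐ x, a₀ ≤ a x ∧ a x ≤ A₀) : LipschitzWith (A₀ / a₀).toNNReal φ := by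
  refine LipschitzWith.of_le_add_mul _ fun x y => ?_
  rw [Real.coe_toNNReal _ (div_nonneg (ha₀.le.trans hA₀) ha₀.le), Real.dist_eq]
  have hmono := (strictMono_of_halfWall h h' ha₀ hA₀ hb).monotone
  have hC : 0 ≤ A₀ / a₀ := div_nonneg (ha₀.le.trans hA₀) ha₀.le
  rcases le_total x y with hxy | hxy
  · have := hmono hxy
    have := mul_nonneg hC (abs_nonneg (x - y))
    linarith
  rw [abs_of_nonneg (sub_nonneg.2 hxy)]
  have hneg : ∀ s t : ℝ, s ≤ t → t ≤ 0 → φ t - φ s ≤ A₀ / a₀ * (t - s) := fun s t hst ht => by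
    have := h'.sub_le_mul ha₀ hA₀ (ae_comp_neg hb) (x := -t) (y := -s) (by linarith) (by linarith)
    simp only [neg_neg] at this
    linarith
  rcases le_total 0 y with hy | hy
  · linarith [h.sub_le_mul ha₀ hA₀ hb hy hxy]
  rcases le_total x 0 with hx | hx
  · linarith [hneg y x hxy hx]
  · linarith [h.sub_le_mul ha₀ hA₀ hb le_rfl hx, hneg y 0 hy le_rfl]

theorem admissible_planar (h : HalfWall a φ p)
    (h' : HalfWall (fun x => a (-x)) (fun x => -φ (-x)) q) : Admissible (planar φ) := by
  refine ⟨norm_planar φ, ?_, ?_, ?_⟩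
  · rw [planar_eq, h.map_zero]; simp
  · rw [funext (planar_eq φ)]
    simpa using (h.sin_tendsto.smul_const e₁).add (h.cos_tendsto.smul_const e₂)
  · have h1 := h'.sin_tendsto.comp tendsto_neg_atBot_atTop
    have h2 := h'.cos_tendsto.comp tendsto_neg_atBot_atTop
    simp only [Function.comp_def, neg_neg, Real.sin_neg, Real.cos_neg] at h1 h2
    rw [funext (planar_eq φ)]
    have := (h1.smul_const (-e₁)).add (h2.smul_const e₂)
    simpa using this

theorem energy_planar_lt_top (h : HalfWall a φ p)
    (h' : HalfWall (fun x => a (-x)) (fun x => -φ (-x)) q) (ha : AEMeasurable a) (ha₀ : 0 < a₀)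
    (hA₀ : a₀ ≤ A₀) (hb : ∀ᵐ x, a₀ ≤ a x ∧ a x ≤ A₀) : energy a (planar φ) < ⊤ := by
  rw [energy_planar h.locAC, lintegral_wall_density]
  exact ENNReal.add_lt_top.2 ⟨(h.integrableOn_density ha ha₀ hA₀ hb).lintegral_lt_top,
    (h'.integrableOn_density (aemeasurable_comp_neg ha) ha₀ hA₀ (ae_comp_neg hb)).lintegral_lt_top⟩

theorem Admissible.component_tendsto_atTop {n : ℝ → E3} (hn : Admissible n) :
    Tendsto (fun x => n x 0) atTop (𝓝 1) := by
  have := ((lipschitzWith_apply 0).continuous.tendsto _).comp hn.2.2.1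
  simpa [e₁, Function.comp_def] using this

theorem Admissible.component_tendsto_atBot {n : ℝ → E3} (hn : Admissible n) :
    Tendsto (fun x => n x 0) atBot (𝓝 (-1)) := by
  have := ((lipschitzWith_apply 0).continuous.tendsto _).comp hn.2.2.2
  simpa [e₁, Function.comp_def] using this

theorem Admissible.sq_add_sq_add_sq {n : ℝ → E3} (hn : Admissible n) (x : ℝ) :
    n x 0 ^ 2 + n x 1 ^ 2 + n x 2 ^ 2 = 1 := by
  rw [← norm_sq_eq, hn.1 x, one_pow]

/-- As n(0) is prescribed, the two half lines are independent problems. The change (u, v, w)(x) to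
(-u, v, w)(-x) preserves the density for the reflected weight and turns the left problem into a
right one. -/
theorem isMinimizer_planar (h : HalfWall a φ p)
    (h' : HalfWall (fun x => a (-x)) (fun x => -φ (-x)) q) (ha : AEMeasurable a) (ha₀ : 0 < a₀)
    (hA₀ : a₀ ≤ A₀) (hb : ∀ᵐ x, a₀ ≤ a x ∧ a x ≤ A₀) : IsMinimizer a (planar φ) := by
  refine ⟨admissible_planar h h', fun n hn => ?_⟩
  by_cases hac : LocAC n
  swap
  · rw [energy, energy, if_neg hac]; exact le_top
  rw [energy_planar h.locAC, hac.energy_eq, lintegral_wall_density, lintegral_eq_add_comp_neg]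
  have h0 : n 0 0 = 0 := by rw [hn.2.1]; simp [e₂]
  refine add_le_add (h.lintegral_le ha ha₀ hA₀ hb (hac.apply 0) (hac.apply 1) (hac.apply 2)
    (fun x _ => hn.sq_add_sq_add_sq x) h0 hn.component_tendsto_atTop) ?_
  simp only [density_neg]
  refine h'.lintegral_le (aemeasurable_comp_neg ha) ha₀ hA₀ (ae_comp_neg hb)
    (hac.apply 0).comp_neg.neg (hac.apply 1).comp_neg (hac.apply 2).comp_neg
    (fun x _ => by rw [neg_sq]; exact hn.sq_add_sq_add_sq _) (by simp [h0]) ?_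
  simpa [Function.comp_def] using (hn.component_tendsto_atBot.comp tendsto_neg_atTop_atBot).neg

theorem eq_planar_of_isMinimizer (h : HalfWall a φ p)
    (h' : HalfWall (fun x => a (-x)) (fun x => -φ (-x)) q) (ha : AEMeasurable a) (ha₀ : 0 < a₀)
    (hA₀ : a₀ ≤ A₀) (hb : ∀ᵐ x, a₀ ≤ a x ∧ a x ≤ A₀) {n : ℝ → E3} (hmin : IsMinimizer a n) :
    n = planar φ := by
  obtain ⟨hn, hmin⟩ := hmin
  have hle := hmin _ (admissible_planar h h')
  have hfin := energy_planar_lt_top h h' ha ha₀ hA₀ hb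
  have hac : LocAC n := by
    by_contra hac
    rw [energy, if_neg hac, top_le_iff] at hle
    exact hfin.ne hle
  rw [energy_planar h.locAC, lintegral_wall_density] at hle hfin
  rw [hac.energy_eq, lintegral_eq_add_comp_neg] at hle
  simp only [density_neg] at hle
  have h0 : n 0 0 = 0 := by rw [hn.2.1]; simp [e₂]
  have h01 : n 0 1 = 1 := by rw [hn.2.1]; simp [e₂]
  have h02 : n 0 2 = 0 := by rw [hn.2.1]; simp [e₂]
  have hlim' : Tendsto (fun x => -n (-x) 0) atTop (𝓝 1) := by
    simpa [Function.comp_def] using (hn.component_tendsto_atBot.comp tendsto_neg_atTop_atBot).neg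
  have hsq' : ∀ x, 0 < x → (-n (-x) 0) ^ 2 + n (-x) 1 ^ 2 + n (-x) 2 ^ 2 = 1 := fun x _ => by
    rw [neg_sq]; exact hn.sq_add_sq_add_sq _
  have k1 := h.lintegral_le ha ha₀ hA₀ hb (hac.apply 0) (hac.apply 1) (hac.apply 2)
    (fun x _ => hn.sq_add_sq_add_sq x) h0 hn.component_tendsto_atTop
  have k2 := h'.lintegral_le (aemeasurable_comp_neg ha) ha₀ hA₀ (ae_comp_neg hb)
    (hac.apply 0).comp_neg.neg (hac.apply 1).comp_neg (hac.apply 2).comp_neg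
    hsq' (by simp [h0]) hlim'
  rw [ENNReal.add_lt_top] at hfin
  -- Each half of the energy of `n` is at least that of the wall, so an upper bound on the sum gives
  -- one on each half. Finiteness permits the cancellation in [0,∞].
  have k3 := ENNReal.le_of_add_le_add_right hfin.2.ne ((add_le_add le_rfl k2).trans hle)
  have k4 := ENNReal.le_of_add_le_add_left hfin.1.ne ((add_le_add k1 le_rfl).trans hle)
  have hpos : ∀ x, 0 < x → n x 0 = Real.sin (φ x) ∧ n x 1 = Real.cos (φ x) ∧ n x 2 = 0 :=
    fun x hx => h.eq_of_lintegral_le ha ha₀ hA₀ hb (hac.apply 0) (hac.apply 1) (hac.apply 2)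
      (fun x _ => hn.sq_add_sq_add_sq x) h0 h01 h02 hn.component_tendsto_atTop k3 hx
  have hneg : ∀ x, 0 < x → -n (-x) 0 = Real.sin (-φ (-x)) ∧ n (-x) 1 = Real.cos (-φ (-x)) ∧
      n (-x) 2 = 0 :=
    fun x hx => h'.eq_of_lintegral_le (aemeasurable_comp_neg ha) ha₀ hA₀ (ae_comp_neg hb)
      (hac.apply 0).comp_neg.neg (hac.apply 1).comp_neg (hac.apply 2).comp_neg hsq' (by simp [h0])
      (by simp [h01]) (by simp [h02]) hlim' k4 hx
  ext x i
  suffices n x 0 = Real.sin (φ x) ∧ n x 1 = Real.cos (φ x) ∧ n x 2 = 0 by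
    fin_cases i
    exacts [this.1, this.2.1, this.2.2]
  rcases lt_trichotomy x 0 with hx | rfl | hx
  · simpa using hneg (-x) (by linarith)
  · rw [h0, h01, h02, h.map_zero]; simp
  · exact hpos x hx

/-- Walls are unique. -/
theorem eq_of_halfWall {ψ p' q' : ℝ → ℝ} (h : HalfWall a φ p)
    (h' : HalfWall (fun x => a (-x)) (fun x => -φ (-x)) q) (k : HalfWall a ψ p')
    (k' : HalfWall (fun x => a (-x)) (fun x => -ψ (-x)) q') (ha : AEMeasurable a) (ha₀ : 0 < a₀)
    (hA₀ : a₀ ≤ A₀) (hb : ∀ᵐ x, a₀ ≤ a x ∧ a x ≤ A₀) : ψ = φ := by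
  -- Uniqueness of the angle is inherited from the minimizer: the planar maps agree, and sine is
  -- injective on the common range [-π/2, π/2].
  have h1 := eq_planar_of_isMinimizer h h' ha ha₀ hA₀ hb (isMinimizer_planar k k' ha ha₀ hA₀ hb)
  have hmem : ∀ {f r s : ℝ → ℝ}, HalfWall a f r →
      HalfWall (fun x => a (-x)) (fun x => -f (-x)) s → ∀ x,
      f x ∈ Icc (-(Real.pi / 2)) (Real.pi / 2) := by
    intro f r s hf hf' x
    rcases le_total 0 x with hx | hx
    · have := hf.mem_Icc hx
      exact ⟨by linarith [this.1, Real.pi_pos], this.2⟩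
    · have := hf'.mem_Icc (x := -x) (by linarith)
      simp only [neg_neg] at this
      exact ⟨by linarith [this.2], by linarith [this.1, Real.pi_pos]⟩
  ext x
  refine Real.injOn_sin (hmem k k' x) (hmem h h' x) ?_
  simpa using congrArg (fun y : E3 => y 0) (congrFun h1 x)

end


/-! ### The weak equation -/

theorem _root_.HasCompactSupport.tendsto_atTop_atBot {η : ℝ → ℝ} (hη : HasCompactSupport η) :
    Tendsto η atTop (𝓝 0) ∧ Tendsto η atBot (𝓝 0) :=
  ⟨hη.is_zero_at_infty.mono_left atTop_le_cocompact,
    hη.is_zero_at_infty.mono_left atBot_le_cocompact⟩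

theorem _root_.ContDiff.locAC {X : Type*} [NormedAddCommGroup X] [NormedSpace ℝ X] {η : ℝ → X}
    (hη : ContDiff ℝ ∞ η) : LocAC η := fun _ _ =>
  ((hη.of_le (by exact_mod_cast le_top)).contDiffOn).absolutelyContinuousOnInterval

theorem _root_.MeasureTheory.LocallyIntegrable.integrable_mul_of_hasCompactSupport {f η : ℝ → ℝ}
    (hf : LocallyIntegrable f) (hc : Continuous η) (hη : HasCompactSupport η) :
    Integrable fun x => f x * η x := by
  simpa [mul_comm] using hf.integrable_smul_left_of_hasCompactSupport hc hη

theorem ae_norm_le_of_bounds {a : ℝ → ℝ} {a₀ A₀ : ℝ} (ha₀ : 0 < a₀)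
    (hb : ∀ᵐ x, a₀ ≤ a x ∧ a x ≤ A₀) : ∀ᵐ x, ‖a x‖ ≤ A₀ :=
  hb.mono fun x hx => by rw [Real.norm_of_nonneg (ha₀.le.trans hx.1)]; exact hx.2

theorem memLp_weight_mul {a f : ℝ → ℝ} {A : ℝ} {r : ℝ≥0∞} (ha : AEMeasurable a)
    (hb : ∀ᵐ x, ‖a x‖ ≤ A) (hf : MemLp f r) : MemLp (fun x => a x * f x) r :=
  hf.of_le_mul (c := A) (ha.aestronglyMeasurable.mul hf.1) <| hb.mono fun x hx => by
    rw [norm_mul]; gcongr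

theorem locallyIntegrable_of_bound {f : ℝ → ℝ} {A : ℝ} (ha : AEMeasurable f)
    (hb : ∀ᵐ x, ‖f x‖ ≤ A) : LocallyIntegrable f :=
  (memLp_top_of_bound ha.aestronglyMeasurable A hb).locallyIntegrable le_top

theorem norm_sin_mul_cos_le_one (y : ℝ) : ‖Real.sin y * Real.cos y‖ ≤ 1 := by
  rw [norm_mul]
  exact mul_le_one₀ (Real.abs_sin_le_one y) (norm_nonneg _) (Real.abs_cos_le_one y)

theorem locallyIntegrable_source {a φ : ℝ → ℝ} {A : ℝ} (ha : AEMeasurable a)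
    (hb : ∀ᵐ x, ‖a x‖ ≤ A) (hφ : Continuous φ) :
    LocallyIntegrable fun x => a x * (Real.sin (φ x) * Real.cos (φ x)) := by
  refine locallyIntegrable_of_bound (A := A) (ha.mul (by fun_prop)) (hb.mono fun x hx => ?_)
  rw [norm_mul]
  exact (mul_le_of_le_one_right (norm_nonneg _) (norm_sin_mul_cos_le_one _)).trans hx

theorem _root_.MeasureTheory.LocallyIntegrable.intervalIntegrable_real {f : ℝ → ℝ}
    (hf : LocallyIntegrable f) (b c : ℝ) : IntervalIntegrable f volume b c :=
  (hf.integrableOn_isCompact isCompact_uIcc).intervalIntegrable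

/-- Zero mean is what makes the primitive vanish again to the right of the support. -/
theorem exists_contDiff_primitive {θ : ℝ → ℝ} (hθ : ContDiff ℝ ∞ θ) (hc : HasCompactSupport θ)
    (hs : tsupport θ ⊆ Ioi 0) (h0 : ∫ x, θ x = 0) :
    ∃ η : ℝ → ℝ, ContDiff ℝ ∞ η ∧ HasCompactSupport η ∧ tsupport η ⊆ Ioi 0 ∧ deriv η = θ := by
  -- The point 1 is adjoined so that extreme points exist even when θ = 0; any positive number would
  -- do.
  have hK : IsCompact (tsupport θ ∪ {1}) := hc.isCompact.union isCompact_singleton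
  have hne : (tsupport θ ∪ {1}).Nonempty := ⟨1, Or.inr rfl⟩
  obtain ⟨b, hbm, hb⟩ := hK.exists_isLeast hne
  obtain ⟨d, hdm, hd⟩ := hK.exists_isGreatest hne
  have hb0 : 0 < b := by
    rcases hbm with h | h
    · exact hs h
    · rw [h]; exact one_pos
  have hout : ∀ x, x ∉ Icc b d → θ x = 0 := fun x hx => by
    by_contra hne
    have : x ∈ tsupport θ ∪ {1} := Or.inl (subset_tsupport _ hne)
    exact hx ⟨hb this, hd this⟩
  set η : ℝ → ℝ := fun x => ∫ t in (0 : ℝ)..x, θ t with hη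
  have hderiv : deriv η = θ := funext fun x => hθ.continuous.deriv_integral θ 0 x
  have hdiff : Differentiable ℝ η := fun x =>
    (intervalIntegral.integral_hasDerivAt_right (hθ.continuous.intervalIntegrable _ _)
      (hθ.continuous.stronglyMeasurableAtFilter _ _) hθ.continuous.continuousAt).differentiableAt
  have hsupp : Function.support η ⊆ Icc b d := by
    intro x hx
    by_contra hxm
    refine hx ?_
    rcases lt_or_ge x b with hxb | hxb
    · refine intervalIntegral.integral_zero_ae (Eventually.of_forall fun t ht => hout t fun hm => ?_)
      have : t ≤ max 0 x := ht.2
      have : max 0 x < b := max_lt hb0 hxb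
      linarith [hm.1]
    · have hxd : d < x := by
        by_contra! hle
        exact hxm ⟨hxb, hle⟩
      have h0x : 0 ≤ x := hb0.le.trans hxb
      rw [← h0]
      simp only [hη]
      rw [intervalIntegral.integral_of_le h0x]
      refine setIntegral_eq_integral_of_forall_compl_eq_zero fun t ht => hout t fun hm => ht ?_
      exact ⟨hb0.trans_le hm.1, hm.2.trans hxd.le⟩
  refine ⟨η, ?_, HasCompactSupport.of_support_subset_isCompact isCompact_Icc hsupp,
    (closure_minimal hsupp isClosed_Icc).trans fun x hx => hb0.trans_le hx.1, hderiv⟩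
  rw [contDiff_infty_iff_deriv, hderiv]
  exact ⟨hdiff, hθ⟩

/-- The lemma of du Bois-Reymond on the half line. -/
theorem exists_ae_eq_const {g : ℝ → ℝ} (hg : LocallyIntegrable g)
    (h : ∀ η : ℝ → ℝ, ContDiff ℝ ∞ η → HasCompactSupport η → tsupport η ⊆ Ioi 0 →
      ∫ x, g x * deriv η x = 0) : ∃ c, ∀ᵐ x, 0 < x → g x = c := by
  -- Normalized, this is a bump of mass 1 supported in [1, 3]. Subtracting (∫ ζ) ρ from ζ leaves
  -- mean zero, hence the derivative of an admissible test function.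
  let B : ContDiffBump (2 : ℝ) := ⟨1 / 2, 1, by norm_num, by norm_num⟩
  set ρ : ℝ → ℝ := B.normed volume with hρ
  have hρ1 : ContDiff ℝ ∞ ρ := B.contDiff_normed
  have hρ2 : HasCompactSupport ρ := B.hasCompactSupport_normed
  have hρ3 : tsupport ρ ⊆ Ioi 0 := by
    rw [hρ, B.tsupport_normed_eq, Real.closedBall_eq_Icc]
    intro x hx
    have : 2 - (1 : ℝ) ≤ x := hx.1
    exact lt_of_lt_of_le (by norm_num) this
  have hρ4 : ∫ x, ρ x = 1 := B.integral_normed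
  refine ⟨∫ x, g x * ρ x, ?_⟩
  set c := ∫ x, g x * ρ x with hc
  have key := isOpen_Ioi.ae_eq_zero_of_integral_contDiff_smul_eq_zero (U := Ioi (0 : ℝ))
    (f := fun x => g x - c) (μ := volume) ((hg.sub (locallyIntegrable_const c)).locallyIntegrableOn _)
  refine (key fun ζ hζ1 hζ2 hζ3 => ?_).mono fun x hx h0 => sub_eq_zero.1 (hx h0)
  have hζi : Integrable ζ := hζ1.continuous.integrable_of_hasCompactSupport hζ2
  have hρi : Integrable ρ := hρ1.continuous.integrable_of_hasCompactSupport hρ2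
  have hsub : tsupport (fun x => (∫ t, ζ t) * ρ x) ⊆ tsupport ρ :=
    closure_mono fun x hx => right_ne_zero_of_mul hx
  obtain ⟨η, h1, h2, h3, h4⟩ := exists_contDiff_primitive
    (θ := fun x => ζ x - (∫ t, ζ t) * ρ x) (hζ1.sub (contDiff_const.mul hρ1))
    (hζ2.sub (hρ2.mono' (subset_closure.trans hsub)))
    ((tsupport_sub _ _).trans (union_subset hζ3 (hsub.trans hρ3))) (by
      rw [integral_sub hζi (hρi.const_mul _), integral_const_mul, hρ4, mul_one, sub_self])
  have h5 := h η h1 h2 h3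
  rw [h4] at h5
  have i1 := hg.integrable_mul_of_hasCompactSupport hζ1.continuous hζ2
  have i2 := hg.integrable_mul_of_hasCompactSupport hρ1.continuous hρ2
  have h6 : ∫ x, g x * (ζ x - (∫ t, ζ t) * ρ x) = (∫ x, g x * ζ x) - (∫ t, ζ t) * c := by
    rw [hc, ← integral_const_mul, ← integral_sub i1 (i2.const_mul _)]
    exact integral_congr_ae (Eventually.of_forall fun x => by ring)
  rw [h6] at h5
  have h7 : ∫ x, ζ x • (g x - c) = (∫ x, g x * ζ x) - (∫ t, ζ t) * c := by
    rw [← integral_mul_const, ← integral_sub i1 (hζi.mul_const _)]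
    exact integral_congr_ae (Eventually.of_forall fun x => by simp only [smul_eq_mul]; ring)
  rw [h7, h5]

/-! ### Half walls and the weak pendulum equation -/

section

variable {a φ p q : ℝ → ℝ} {a₀ A₀ : ℝ}

theorem LocAC.integral_mul_deriv_eq {P r η : ℝ → ℝ} (hP : LocAC P)
    (hd : ∀ᵐ x, HasDerivAt P (r x) x) (hr : LocallyIntegrable r) (hη : ContDiff ℝ ∞ η)
    (hc : HasCompactSupport η) : ∫ x, P x * deriv η x = -∫ x, r x * η x := by
  have i1 := hr.integrable_mul_of_hasCompactSupport hη.continuous hc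
  have i2 := hP.continuous.locallyIntegrable.integrable_mul_of_hasCompactSupport
    (hη.continuous_deriv (by simp)) hc.deriv
  have hcP : HasCompactSupport fun x => P x * η x := hc.mul_left
  have h0 := (hP.mul hη.locAC).integral_eq_zero (f' := fun x => r x * η x + P x * deriv η x)
    (hd.mono fun x hx => hx.mul (hη.differentiable (by simp) x).hasDerivAt)
    (i1.add i2) hcP.tendsto_atTop_atBot.1 hcP.tendsto_atTop_atBot.2
  rw [integral_add i1 i2] at h0
  linarith

/-- The restriction of a wall angle to `[0, ∞)` is a half wall. -/
theorem IsWallAngle.exists_halfWall (h : IsWallAngle a φ) (ha : AEMeasurable a) (ha₀ : 0 < a₀)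
    (hb : ∀ᵐ x, a₀ ≤ a x ∧ a x ≤ A₀) : ∃ p, HalfWall a φ p := by
  obtain ⟨⟨hac, hL2⟩, h0, htop, -, hmem, hweak⟩ := h
  have hbn := ae_norm_le_of_bounds ha₀ hb
  have hsrc := locallyIntegrable_source ha hbn hac.continuous
  set B : ℝ → ℝ := fun x => ∫ t in (0 : ℝ)..x, a t * (Real.sin (φ t) * Real.cos (φ t)) with hB
  have hBac : LocAC B := locAC_primitive hsrc.intervalIntegrable_real 0
  have hBd : ∀ᵐ x, HasDerivAt B (a x * (Real.sin (φ x) * Real.cos (φ x))) x :=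
    ae_hasDerivAt_primitive hsrc.intervalIntegrable_real 0
  have hflux : LocallyIntegrable fun x => a x * deriv φ x :=
    (memLp_weight_mul ha hbn hL2).locallyIntegrable (by norm_num)
  -- With B a primitive of the source, the weak equation says that a φ' + B has zero distributional
  -- derivative on (0,∞); so c - B is the continuous representative of the flux.
  obtain ⟨c, hc⟩ := exists_ae_eq_const (g := fun x => a x * deriv φ x + B x)
    (hflux.add hBac.continuous.locallyIntegrable) (fun η h1 h2 h3 => by
      have e1 := hweak η h1 h2 (h3.trans fun x hx => ne_of_gt hx)
      have e2 := hBac.integral_mul_deriv_eq hBd hsrc h1 h2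
      have hcd : Continuous (deriv η) := h1.continuous_deriv (by simp)
      simp only [add_mul]
      rw [integral_add (hflux.integrable_mul_of_hasCompactSupport hcd h2.deriv)
        (hBac.continuous.locallyIntegrable.integrable_mul_of_hasCompactSupport hcd h2.deriv),
        e1, e2, add_neg_cancel])
  refine ⟨fun x => c - B x, hac, (locAC_const c).sub hBac, h0, htop,
    fun x hx => (hmem x hx).2.2.1, fun x hx => (hmem x hx).2.2.2,
    ((memLp_two_iff_integrable_sq hL2.1).1 hL2).integrableOn, ?_, ?_⟩
  · filter_upwards [hc] with x hx h0
    linarith [hx h0]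
  · filter_upwards [hBd] with x hx _
    exact hx.const_sub c

/-- This symmetry supplies the left half of a wall and, for even weights, oddness through
uniqueness. -/
theorem IsWallAngle.reflect (h : IsWallAngle a φ) :
    IsWallAngle (fun x => a (-x)) (fun x => -φ (-x)) := by
  obtain ⟨⟨hac, hL2⟩, h0, htop, hbot, hmem, hweak⟩ := h
  have hd : deriv (fun x => -φ (-x)) = fun x => deriv φ (-x) := by
    ext x; rw [deriv.fun_neg, deriv_comp_neg, neg_neg]
  refine ⟨⟨hac.comp_neg.neg, ?_⟩, by simp [h0], ?_, ?_, fun x hx => ?_, fun η h1 h2 h3 => ?_⟩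
  · rw [hd]
    exact hL2.comp_measurePreserving (Measure.measurePreserving_neg volume)
  · simpa [Function.comp_def] using (hbot.comp tendsto_neg_atTop_atBot).neg
  · simpa [Function.comp_def] using (htop.comp tendsto_neg_atBot_atTop).neg
  · have := hmem x hx
    simp only [neg_neg]
    refine ⟨?_, ?_, ?_, ?_⟩ <;> linarith
  · have h4 : tsupport (fun x => η (-x)) ⊆ {0}ᶜ := by
      rw [show (fun x => η (-x)) = η ∘ Homeomorph.neg ℝ from rfl, tsupport_comp_eq_preimage]
      intro x hx
      simpa using h3 hx
    have h5 := hweak (fun x => η (-x)) (h1.comp contDiff_neg)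
      (h2.comp_homeomorph (Homeomorph.neg ℝ)) h4
    have e1 := integral_neg_eq_self (μ := volume)
      (fun x => a x * deriv φ x * deriv (fun x => η (-x)) x)
    have e2 := integral_neg_eq_self (μ := volume)
      (fun x => a x * (Real.sin (φ x) * Real.cos (φ x)) * η (-x))
    rw [← e1, ← e2] at h5
    simp only [deriv_comp_neg, neg_neg, mul_neg, integral_neg] at h5
    simp only [hd, Real.sin_neg, Real.cos_neg, neg_mul, mul_neg, integral_neg]
    linarith

theorem HalfWall.integral_test (h : HalfWall a φ p) (ha : AEMeasurable a)
    (hb : ∀ᵐ x, ‖a x‖ ≤ A₀) {η : ℝ → ℝ} (hη : ContDiff ℝ ∞ η) (hc : HasCompactSupport η)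
    (hL2 : MemLp (deriv φ) 2) :
    ∫ x in Ioi (0 : ℝ), (a x * deriv φ x * deriv η x -
      a x * (Real.sin (φ x) * Real.cos (φ x)) * η x) = -(p 0 * η 0) := by
  have hcP : HasCompactSupport fun x => p x * η x := hc.mul_left
  refine (h.flux_locAC.mul hη.locAC).integral_Ioi_eq ?_ ?_ hcP.tendsto_atTop_atBot.1
  · filter_upwards [h.flux_deriv, h.flux_eq] with x h1 h2 h0
    refine ((h1 h0).mul (hη.differentiable (by simp) x).hasDerivAt).congr_deriv ?_
    rw [h2 h0]; ring
  · refine Integrable.integrableOn (Integrable.sub ?_ ?_)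
    · exact ((memLp_weight_mul ha hb hL2).locallyIntegrable
        (by norm_num)).integrable_mul_of_hasCompactSupport (hη.continuous_deriv (by simp)) hc.deriv
    · exact (locallyIntegrable_source ha hb h.locAC.continuous).integrable_mul_of_hasCompactSupport
        hη.continuous hc

theorem memLp_deriv_of_halfWall (h : HalfWall a φ p)
    (h' : HalfWall (fun x => a (-x)) (fun x => -φ (-x)) q) : MemLp (deriv φ) 2 := by
  rw [memLp_two_iff_integrable_sq (measurable_deriv φ).aestronglyMeasurable]
  have h1 := h'.sq_integrable
  simp only [deriv.fun_neg, deriv_comp_neg, neg_neg] at h1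
  have h2 : IntegrableOn (fun x => deriv φ x ^ 2) (Iic 0) := by
    have h3 := ((Measure.measurePreserving_neg (volume : Measure ℝ)).integrableOn_comp_preimage
      (MeasurableEquiv.neg ℝ).measurableEmbedding (f := fun x => deriv φ x ^ 2) (s := Iio 0)).1
      (by simpa [Function.comp_def] using h1)
    rwa [integrableOn_Iic_iff_integrableOn_Iio]
  have := h2.union h.sq_integrable
  rwa [Iic_union_Ioi, integrableOn_univ] at this

/-- Since `q 0` is the flux at 0 from the left and `p 0` that from the right, the distributional
equation fails exactly by the flux jump at the origin. -/
theorem integral_test_of_halfWall (h : HalfWall a φ p)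
    (h' : HalfWall (fun x => a (-x)) (fun x => -φ (-x)) q) (ha : AEMeasurable a)
    (hb : ∀ᵐ x, ‖a x‖ ≤ A₀) {η : ℝ → ℝ} (hη : ContDiff ℝ ∞ η) (hc : HasCompactSupport η) :
    (∫ x, a x * deriv φ x * deriv η x) -
      ∫ x, a x * (Real.sin (φ x) * Real.cos (φ x)) * η x = (q 0 - p 0) * η 0 := by
  have hL2 := memLp_deriv_of_halfWall h h'
  have hd : deriv (fun x => -φ (-x)) = fun x => deriv φ (-x) := by
    ext x; rw [deriv.fun_neg, deriv_comp_neg, neg_neg]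
  have i1 : Integrable fun x => a x * deriv φ x * deriv η x :=
    ((memLp_weight_mul ha hb hL2).locallyIntegrable
      (by norm_num)).integrable_mul_of_hasCompactSupport (hη.continuous_deriv (by simp)) hc.deriv
  have i2 : Integrable fun x => a x * (Real.sin (φ x) * Real.cos (φ x)) * η x :=
    (locallyIntegrable_source ha hb h.locAC.continuous).integrable_mul_of_hasCompactSupport
      hη.continuous hc
  have h1 := h.integral_test ha hb hη hc hL2
  have h2 := h'.integral_test (aemeasurable_comp_neg ha) (ae_comp_neg hb)
    (η := fun x => η (-x)) (hη.comp contDiff_neg) (hc.comp_homeomorph (Homeomorph.neg ℝ)) (by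
      rw [hd]; exact hL2.comp_measurePreserving (Measure.measurePreserving_neg volume))
  have h3 := integral_comp_neg_Ioi 0 (fun x => a x * deriv φ x * deriv η x -
    a x * (Real.sin (φ x) * Real.cos (φ x)) * η x)
  simp only [hd, deriv_comp_neg, Real.sin_neg, Real.cos_neg] at h2
  have h4 : ∫ x in Iic (0 : ℝ), (a x * deriv φ x * deriv η x -
      a x * (Real.sin (φ x) * Real.cos (φ x)) * η x) = q 0 * η 0 := by
    rw [neg_zero] at h3
    rw [← h3]
    rw [neg_zero] at h2
    rw [← neg_neg (q 0 * η 0), ← h2, ← integral_neg]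
    exact integral_congr_ae (Eventually.of_forall fun x => by ring)
  have h5 := intervalIntegral.integral_Iic_add_Ioi (b := 0)
    (i1.sub i2).integrableOn (i1.sub i2).integrableOn
  simp only [Pi.sub_apply] at h5
  rw [← integral_sub i1 i2, ← h5, h1, h4]
  ring

theorem isWallAngle_of_halfWall (h : HalfWall a φ p)
    (h' : HalfWall (fun x => a (-x)) (fun x => -φ (-x)) q) (ha : AEMeasurable a)
    (hb : ∀ᵐ x, ‖a x‖ ≤ A₀) : IsWallAngle a φ := by
  refine ⟨⟨h.locAC, memLp_deriv_of_halfWall h h'⟩, h.map_zero, h.tendsto, ?_, fun x hx => ?_,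
    fun η h1 h2 h3 => ?_⟩
  · simpa [Function.comp_def] using (h'.tendsto.comp tendsto_neg_atBot_atTop).neg
  · have h1 := h'.nonneg x hx
    have h2 := h'.le x hx
    exact ⟨by linarith, by linarith, h.nonneg x hx, h.le x hx⟩
  · have h4 : η 0 = 0 := by
      by_contra hne
      exact h3 (subset_tsupport _ hne) rfl
    have := integral_test_of_halfWall h h' ha hb h1 h2
    rw [h4, mul_zero] at this
    linarith

/-- If the weight is even, a wall solves the pendulum equation across the origin. -/
theorem pendulumIn_univ_of_odd (h : HalfWall a φ p)
    (h' : HalfWall (fun x => a (-x)) (fun x => -φ (-x)) q) (ha : AEMeasurable a)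
    (hb : ∀ᵐ x, ‖a x‖ ≤ A₀) (heven : Function.Even a) (hodd : Function.Odd φ) :
    (∀ x, 0 ≤ x → q x = p x) ∧ PendulumIn a φ univ := by
  have h1 : (fun x => a (-x)) = a := funext heven
  have h2 : (fun x => -φ (-x)) = φ := funext fun x => by rw [hodd, neg_neg]
  rw [h1, h2] at h'
  -- By symmetry both fluxes represent the same a φ' on (0,∞); continuity carries their equality up
  -- to 0, where the jump disappears.
  have h3 : ∀ᵐ x, x ∈ Ioi (0 : ℝ) → q x = p x := by
    filter_upwards [h.flux_eq, h'.flux_eq] with x e1 e2 h0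
    rw [← e1 h0, ← e2 h0]
  have h4 : EqOn q p (Ioi 0) := by
    refine Measure.eqOn_open_of_ae_eq (μ := volume) ?_ isOpen_Ioi
      h'.flux_locAC.continuous.continuousOn h.flux_locAC.continuous.continuousOn
    rwa [EventuallyEq, ae_restrict_iff' measurableSet_Ioi]
  have h5 : EqOn q p (Ici 0) := by
    have := h4.closure h'.flux_locAC.continuous h.flux_locAC.continuous
    rwa [closure_Ioi] at this
  refine ⟨fun x hx => h5 hx, fun η k1 k2 _ => ?_⟩
  have := integral_test_of_halfWall (q := q) h (by rwa [h1, h2]) ha hb k1 k2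
  rw [h5 (mem_Ici.2 le_rfl), sub_self, zero_mul] at this
  linarith

end


/-! ### A Volterra equation with measurable coefficients -/

/-- Each integration gains a factor 1/K in the exponentially weighted norm, which is what makes the
Volterra map contract for large K. -/
theorem norm_integral_le_exp {F : ℝ → ℝ} {D K t : ℝ} (hK : 0 < K) (hD : 0 ≤ D) (ht : 0 ≤ t)
    (h : ∀ᵐ s, s ∈ Ioc 0 t → ‖F s‖ ≤ D * Real.exp (K * s)) :
    ‖∫ s in (0 : ℝ)..t, F s‖ ≤ D / K * Real.exp (K * t) := by
  have hi : ∀ u v, IntervalIntegrable (fun s => D * Real.exp (K * s)) volume u v := fun u v =>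
    (by fun_prop : Continuous fun s => D * Real.exp (K * s)).intervalIntegrable u v
  refine (intervalIntegral.norm_integral_le_of_norm_le ht h (hi 0 t)).trans ?_
  have h1 : ∫ s in (0 : ℝ)..t, D * Real.exp (K * s)
      = D / K * Real.exp (K * t) - D / K * Real.exp (K * 0) := by
    refine intervalIntegral.integral_eq_sub_of_hasDerivAt
      (f := fun s => D / K * Real.exp (K * s)) (fun s _ => ?_) (hi 0 t)
    refine ((((hasDerivAt_id s).const_mul K).exp).const_mul (D / K)).congr_deriv ?_
    simp only [id, mul_one]
    field_simp
  rw [h1]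
  have : 0 ≤ D / K * Real.exp (K * 0) := by positivity
  linarith

/-- Existence and continuous dependence on `α` for `φ' = b p`, `p' = -a f(φ)`, `φ(0) = 0`,
`p(0) = α`. -/
theorem exists_volterra {a b f : ℝ → ℝ} {A B : ℝ} (hA : 0 < A) (hB : 0 < B) (ha : AEMeasurable a)
    (hb : AEMeasurable b) (haA : ∀ᵐ x, ‖a x‖ ≤ A) (hbB : ∀ᵐ x, ‖b x‖ ≤ B)
    (hb0 : ∀ x, x ≤ 0 → b x = 0) (hf : LipschitzWith 1 f) (hf1 : ∀ y, ‖f y‖ ≤ 1) :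
    ∃ Φ : ℝ → ℝ → ℝ, (∀ α, Continuous (Φ α)) ∧
      (∀ α x, Φ α x = ∫ t in (0 : ℝ)..x, b t * (α - ∫ s in (0 : ℝ)..t, a s * f (Φ α s))) ∧
      (∀ x, Continuous fun α => Φ α x) ∧
      (∀ x, 0 ≤ x → Continuous fun α => α - ∫ s in (0 : ℝ)..x, a s * f (Φ α s)) := by
  -- Two integrations contract by AB/K²; since K ≥ 1 and K ≥ 2AB, this is at most 1/2.
  set K : ℝ := 1 + 2 * (A * B) with hKdef
  have hAB : 0 < A * B := mul_pos hA hB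
  have hK : 0 < K := by positivity
  have hK1 : A * B / (K * K) ≤ 1 / 2 := by
    rw [div_le_div_iff₀ (by positivity) (by norm_num)]
    nlinarith
  have hsrc : ∀ {h : ℝ → ℝ}, Continuous h → ∀ u v,
      IntervalIntegrable (fun s => a s * f (h s)) volume u v := fun {h} hh u v =>
    ((locallyIntegrable_of_bound ha haA).intervalIntegrable_real u v).mul_continuousOn
      (hf.continuous.comp hh).continuousOn
  have hP : ∀ {h : ℝ → ℝ}, Continuous h → ∀ α : ℝ,
      Continuous fun t => α - ∫ s in (0 : ℝ)..t, a s * f (h s) := fun {h} hh α =>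
    continuous_const.sub (intervalIntegral.continuous_primitive (hsrc hh) 0)
  have hout : ∀ {P : ℝ → ℝ}, Continuous P → ∀ u v,
      IntervalIntegrable (fun t => b t * P t) volume u v := fun {P} hP u v =>
    ((locallyIntegrable_of_bound hb hbB).intervalIntegrable_real u v).mul_continuousOn
      hP.continuousOn
  -- bounds for the outer integral
  have hob : ∀ {P : ℝ → ℝ} {D : ℝ}, 0 ≤ D → (∀ t, 0 ≤ t → ‖P t‖ ≤ D * Real.exp (K * t)) → ∀ x,
      ‖∫ t in (0 : ℝ)..x, b t * P t‖ ≤ B * D / K * Real.exp (K * max x 0) := by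
    intro P D hD hPD x
    rcases le_total 0 x with hx | hx
    · rw [max_eq_left hx]
      refine norm_integral_le_exp hK (by positivity) hx (hbB.mono fun t ht hm => ?_)
      rw [norm_mul, mul_assoc]
      gcongr
      exact hPD t hm.1.le
    · have : ∫ t in (0 : ℝ)..x, b t * P t = 0 := by
        refine intervalIntegral.integral_zero_ae (Eventually.of_forall fun t ht => ?_)
        have : t ≤ max 0 x := ht.2
        rw [max_eq_left hx] at this
        rw [hb0 t this, zero_mul]
      rw [this, norm_zero]
      positivity
  have hib : ∀ {h k : ℝ → ℝ} {D : ℝ}, 0 ≤ D → Continuous h → Continuous k →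
      (∀ t, 0 ≤ t → ‖h t - k t‖ ≤ D * Real.exp (K * t)) → ∀ t, 0 ≤ t →
      ‖(∫ s in (0 : ℝ)..t, a s * f (h s)) - ∫ s in (0 : ℝ)..t, a s * f (k s)‖
        ≤ A * D / K * Real.exp (K * t) := by
    intro h k D hD hh hk hd t ht
    rw [← intervalIntegral.integral_sub (hsrc hh 0 t) (hsrc hk 0 t)]
    refine norm_integral_le_exp hK (by positivity) ht (haA.mono fun s hs hm => ?_)
    rw [← mul_sub, norm_mul, mul_assoc]
    gcongr
    have := hf.dist_le_mul (h s) (k s)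
    rw [NNReal.coe_one, one_mul, dist_eq_norm, dist_eq_norm] at this
    exact this.trans (hd s hm.1.le)
  have hib1 : ∀ {h : ℝ → ℝ} (α : ℝ) (t : ℝ), 0 ≤ t →
      ‖α - ∫ s in (0 : ℝ)..t, a s * f (h s)‖ ≤ (|α| + A / K) * Real.exp (K * t) := by
    intro h α t ht
    have h1 : ‖∫ s in (0 : ℝ)..t, a s * f (h s)‖ ≤ A / K * Real.exp (K * t) := by
      refine norm_integral_le_exp hK hA.le ht (haA.mono fun s hs hm => ?_)
      rw [norm_mul]
      refine (mul_le_mul hs (hf1 _) (norm_nonneg _) hA.le).trans ?_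
      gcongr
      exact Real.one_le_exp (mul_nonneg hK.le hm.1.le)
    refine (norm_sub_le _ _).trans ?_
    rw [Real.norm_eq_abs α, add_mul]
    have := le_mul_of_one_le_right (abs_nonneg α) (Real.one_le_exp (mul_nonneg hK.le ht))
    linarith
  have hexp : Continuous fun x : ℝ => Real.exp (K * max x 0) := by fun_prop
  -- Factoring out the weight allows the fixed point to be sought in the complete space of bounded
  -- continuous functions with its plain sup norm.
  let lift : BoundedContinuousFunction ℝ ℝ → ℝ → ℝ := fun g x => Real.exp (K * max x 0) * g x
  have hlift : ∀ g, Continuous (lift g) := fun g => hexp.mul g.continuous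
  have hliftd : ∀ g k : BoundedContinuousFunction ℝ ℝ, ∀ x,
      ‖lift g x - lift k x‖ ≤ dist g k * Real.exp (K * max x 0) := fun g k x => by
    simp only [lift]
    rw [← mul_sub, norm_mul, Real.norm_of_nonneg (Real.exp_pos _).le, mul_comm, ← dist_eq_norm]
    gcongr
    exact BoundedContinuousFunction.dist_coe_le_dist x
  let out : ℝ → BoundedContinuousFunction ℝ ℝ → ℝ → ℝ := fun α g x =>
    ∫ t in (0 : ℝ)..x, b t * (α - ∫ s in (0 : ℝ)..t, a s * f (lift g s))
  have houtc : ∀ α g, Continuous (out α g) := fun α g =>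
    intervalIntegral.continuous_primitive (hout (hP (hlift g) α)) 0
  let T : ℝ → BoundedContinuousFunction ℝ ℝ → BoundedContinuousFunction ℝ ℝ := fun α g =>
    BoundedContinuousFunction.ofNormedAddCommGroup
      (fun x => (Real.exp (K * max x 0))⁻¹ * out α g x)
      ((hexp.inv₀ fun x => (Real.exp_pos _).ne').mul (houtc α g)) (B * (|α| + A / K) / K) (fun x => by
        rw [norm_mul, norm_inv, Real.norm_of_nonneg (Real.exp_pos _).le,
          inv_mul_le_iff₀ (Real.exp_pos _), mul_comm]
        exact hob (by positivity) (hib1 α) x)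
  have hTd : ∀ (α β : ℝ) (g k : BoundedContinuousFunction ℝ ℝ) (D : ℝ), 0 ≤ D →
      (∀ x, ‖out α g x - out β k x‖ ≤ D * Real.exp (K * max x 0)) → dist (T α g) (T β k) ≤ D := by
    intro α β g k D hD h
    refine (BoundedContinuousFunction.dist_le hD).2 fun x => ?_
    change dist ((Real.exp (K * max x 0))⁻¹ * out α g x) ((Real.exp (K * max x 0))⁻¹ * out β k x) ≤ D
    rw [dist_eq_norm, ← mul_sub, norm_mul, norm_inv, Real.norm_of_nonneg (Real.exp_pos _).le,
      inv_mul_le_iff₀ (Real.exp_pos _), mul_comm]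
    exact h x
  have houtd : ∀ α β g k x, out α g x - out β k x = ∫ t in (0 : ℝ)..x, b t *
      ((α - ∫ s in (0 : ℝ)..t, a s * f (lift g s)) - (β - ∫ s in (0 : ℝ)..t, a s * f (lift k s))) := by
    intro α β g k x
    simp only [out]
    rw [← intervalIntegral.integral_sub (hout (hP (hlift g) α) 0 x) (hout (hP (hlift k) β) 0 x)]
    exact intervalIntegral.integral_congr fun t _ => (mul_sub _ _ _).symm
  have hcontr : ∀ α, ContractingWith (1 / 2) (T α) := by
    intro α
    refine ⟨by rw [← NNReal.coe_lt_coe]; norm_num, LipschitzWith.of_dist_le_mul fun g k => ?_⟩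
    have h1 : dist (T α g) (T α k) ≤ B * (A * dist g k / K) / K := by
      refine hTd α α g k _ (by positivity) fun x => ?_
      rw [houtd]
      refine hob (by positivity) (fun t ht => ?_) x
      rw [sub_sub_sub_cancel_left, norm_sub_rev]
      refine hib dist_nonneg (hlift g) (hlift k) (fun s hs => ?_) t ht
      have := hliftd g k s
      rwa [max_eq_left hs] at this
    refine h1.trans ?_
    have h2 : B * (A * dist g k / K) / K = A * B / (K * K) * dist g k := by
      field_simp
    rw [h2]
    have : ((1 / 2 : NNReal) : ℝ) = 1 / 2 := by norm_num
    rw [this]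
    gcongr
  let G : ℝ → BoundedContinuousFunction ℝ ℝ := fun α => (hcontr α).fixedPoint (T α)
  have hG : ∀ α, T α (G α) = G α := fun α => (hcontr α).fixedPoint_isFixedPt
  have hGd : ∀ α β, dist (G α) (G β) ≤ 2 * B / K * dist α β := by
    intro α β
    -- The maps for α and β differ uniformly by at most B |α - β|/K, so the fixed points are
    -- Lipschitz in the parameter.
    have h1 := (hcontr α).dist_fixedPoint_fixedPoint_of_dist_le' (T β) (x := G α) (y := G β)
      (hG α) (hG β) (C := B * dist α β / K) (fun g => by
        refine hTd α β g g _ (by positivity) fun x => ?_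
        rw [houtd]
        refine hob dist_nonneg (fun t ht => ?_) x
        rw [sub_sub_sub_cancel_right, ← dist_eq_norm]
        exact le_mul_of_one_le_right dist_nonneg (Real.one_le_exp (mul_nonneg hK.le ht)))
    refine h1.trans (le_of_eq ?_)
    have : ((1 / 2 : NNReal) : ℝ) = 1 / 2 := by norm_num
    rw [this]
    field_simp
    ring
  have hLd : ∀ α β x, ‖lift (G α) x - lift (G β) x‖
      ≤ 2 * B / K * dist α β * Real.exp (K * max x 0) := fun α β x =>
    (hliftd _ _ x).trans (by gcongr; exact hGd α β)
  refine ⟨fun α => lift (G α), fun α => hlift _, fun α x => ?_, fun x => ?_, fun x hx => ?_⟩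
  · have h1 : (Real.exp (K * max x 0))⁻¹ * out α (G α) x = G α x := by
      conv_rhs => rw [← hG α]
      rfl
    change Real.exp (K * max x 0) * G α x = out α (G α) x
    rw [← h1, mul_inv_cancel_left₀ (Real.exp_pos _).ne']
  · refine (LipschitzWith.of_dist_le_mul (K := (2 * B / K * Real.exp (K * max x 0)).toNNReal)
      fun α β => ?_).continuous
    rw [Real.coe_toNNReal _ (by positivity), dist_eq_norm]
    refine (hLd α β x).trans (le_of_eq (by ring))
  · refine continuous_id.sub ?_
    refine (LipschitzWith.of_dist_le_mul
      (K := (A * (2 * B / K) / K * Real.exp (K * x)).toNNReal) fun α β => ?_).continuous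
    rw [Real.coe_toNNReal _ (by positivity), dist_eq_norm]
    refine (hib (D := 2 * B / K * dist α β) (by positivity) (hlift (G α)) (hlift (G β))
      (fun s hs => ?_) x hx).trans (le_of_eq (by ring))
    have := hLd α β s
    rwa [max_eq_left hs] at this


/-! ### Existence of half walls by shooting -/

/-- The nonlinearity `sin y cos y`, frozen outside of `[0, π/2]`. -/
noncomputable def clampedSource (y : ℝ) : ℝ :=
  Real.sin (max 0 (min y (Real.pi / 2))) * Real.cos (max 0 (min y (Real.pi / 2)))

theorem lipschitzWith_sin_mul_cos : LipschitzWith 1 fun y : ℝ => Real.sin y * Real.cos y := by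
  refine LipschitzWith.of_dist_le_mul fun x y => ?_
  have h := Real.lipschitzWith_sin.dist_le_mul (2 * x) (2 * y)
  rw [Real.sin_two_mul, Real.sin_two_mul, NNReal.coe_one, one_mul, Real.dist_eq, Real.dist_eq,
    ← mul_sub, mul_assoc, mul_assoc, ← mul_sub, abs_mul, abs_mul, abs_two] at h
  rw [NNReal.coe_one, one_mul, Real.dist_eq, Real.dist_eq]
  linarith

theorem lipschitzWith_clampedSource : LipschitzWith 1 clampedSource := by
  have h : LipschitzWith 1 fun y : ℝ => max 0 (min y (Real.pi / 2)) :=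
    (LipschitzWith.id.min_const _).const_max _
  have h2 := lipschitzWith_sin_mul_cos.comp h
  rwa [one_mul] at h2

theorem norm_clampedSource_le (y : ℝ) : ‖clampedSource y‖ ≤ 1 := norm_sin_mul_cos_le_one _

theorem clampedSource_nonneg (y : ℝ) : 0 ≤ clampedSource y := by
  have h1 : 0 ≤ max 0 (min y (Real.pi / 2)) := le_max_left _ _
  have h2 : max 0 (min y (Real.pi / 2)) ≤ Real.pi / 2 :=
    max_le (by positivity) (min_le_right _ _)
  exact mul_nonneg (Real.sin_nonneg_of_nonneg_of_le_pi h1 (by linarith [Real.pi_pos]))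
    (Real.cos_nonneg_of_neg_pi_div_two_le_of_le (by linarith [Real.pi_pos]) h2)

/-- This freezes the flux beyond π/2 and makes turning back and passing π/2 mutually exclusive. -/
theorem clampedSource_of_le {y : ℝ} (hy : Real.pi / 2 ≤ y) : clampedSource y = 0 := by
  rw [clampedSource, min_eq_right hy, max_eq_right (by positivity), Real.cos_pi_div_two, mul_zero]

theorem clampedSource_of_mem {y : ℝ} (hy : y ∈ Icc 0 (Real.pi / 2)) :
    clampedSource y = Real.sin y * Real.cos y := by
  rw [clampedSource, min_eq_left hy.2, max_eq_right hy.1]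

/-- A solution of the pendulum system with clamped nonlinearity on `[0, ∞)`. -/
structure Trajectory (a φ p : ℝ → ℝ) : Prop where
  locAC : LocAC φ
  flux_locAC : LocAC p
  map_zero : φ 0 = 0
  deriv : ∀ᵐ x, 0 < x → HasDerivAt φ (p x / a x) x
  flux_deriv : ∀ᵐ x, 0 < x → HasDerivAt p (-(a x * clampedSource (φ x))) x

/-! ### Qualitative behaviour of shooting trajectories -/

namespace Trajectory

variable {a φ p : ℝ → ℝ} {a₀ A₀ : ℝ}

theorem flux_antitone (h : Trajectory a φ p) (ha₀ : 0 < a₀) (hb : ∀ᵐ x, a₀ ≤ a x ∧ a x ≤ A₀)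
    {x y : ℝ} (hx : 0 ≤ x) (hxy : x ≤ y) : p y ≤ p x := by
  refine (h.flux_locAC x y).le_of_deriv_nonpos hxy (f' := fun x => -(a x * clampedSource (φ x))) ?_
  filter_upwards [h.flux_deriv, hb] with t ht hbt hm
  exact ⟨ht (hx.trans_lt hm.1),
    neg_nonpos.2 (mul_nonneg (ha₀.le.trans hbt.1) (clampedSource_nonneg _))⟩

theorem mul_le_sub (h : Trajectory a φ p) (ha₀ : 0 < a₀) (hb : ∀ᵐ x, a₀ ≤ a x ∧ a x ≤ A₀)
    {c x y : ℝ} (hc : 0 ≤ c) (hx : 0 ≤ x) (hxy : x ≤ y) (hp : ∀ t ∈ Ioo x y, c ≤ p t) :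
    c / A₀ * (y - x) ≤ φ y - φ x := by
  have hid : LocAC fun x : ℝ => x := LipschitzWith.id.locAC
  have h1 := ((locAC_const (c / A₀)).mul hid).sub h.locAC x y |>.le_of_deriv_nonpos hxy
    (f' := fun x => c / A₀ * 1 - p x / a x) (by
    filter_upwards [h.deriv, hb] with t h1 h4 hm
    refine ⟨((hasDerivAt_id t).const_mul (c / A₀)).sub (h1 (hx.trans_lt hm.1)), ?_⟩
    have := hp t hm
    rw [mul_one, sub_nonpos]
    exact div_le_div₀ (hc.trans this) this (ha₀.trans_le h4.1) h4.2)
  linarith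

theorem mono (h : Trajectory a φ p) (ha₀ : 0 < a₀) (hb : ∀ᵐ x, a₀ ≤ a x ∧ a x ≤ A₀)
    {x y : ℝ} (hx : 0 ≤ x) (hxy : x ≤ y) (hp : ∀ t ∈ Ioo x y, 0 ≤ p t) : φ x ≤ φ y := by
  have := h.mul_le_sub ha₀ hb le_rfl hx hxy hp
  simp at this
  exact this

theorem sub_mul_le_flux (h : Trajectory a φ p) (ha₀ : 0 < a₀) (hb : ∀ᵐ x, a₀ ≤ a x ∧ a x ≤ A₀)
    {x y : ℝ} (hx : 0 ≤ x) (hxy : x ≤ y) : p x - A₀ * (y - x) ≤ p y := by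
  have hid : LocAC fun x : ℝ => x := LipschitzWith.id.locAC
  have h1 := (((locAC_const A₀).mul hid).add h.flux_locAC).neg x y |>.le_of_deriv_nonpos hxy
    (f' := fun x => -(A₀ * 1 + -(a x * clampedSource (φ x)))) (by
    filter_upwards [h.flux_deriv, hb] with t h1 h4 hm
    refine ⟨(((hasDerivAt_id t).const_mul A₀).add (h1 (hx.trans_lt hm.1))).neg, ?_⟩
    have h5 : clampedSource (φ t) ≤ 1 := (le_abs_self _).trans (norm_clampedSource_le _)
    have h6 := mul_le_mul h4.2 h5 (clampedSource_nonneg _) ((ha₀.le.trans h4.1).trans h4.2)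
    linarith)
  linarith

theorem flux_le_sub_mul (h : Trajectory a φ p) (ha₀ : 0 < a₀) (hb : ∀ᵐ x, a₀ ≤ a x ∧ a x ≤ A₀)
    {δ x y : ℝ} (hx : 0 ≤ x) (hxy : x ≤ y) (hδ : 0 ≤ δ)
    (hs : ∀ t ∈ Ioo x y, δ ≤ clampedSource (φ t)) : p y ≤ p x - a₀ * δ * (y - x) := by
  have hid : LocAC fun x : ℝ => x := LipschitzWith.id.locAC
  have h1 := (((locAC_const (a₀ * δ)).mul hid).add h.flux_locAC) x y |>.le_of_deriv_nonpos hxy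
    (f' := fun x => a₀ * δ * 1 + -(a x * clampedSource (φ x))) (by
    filter_upwards [h.flux_deriv, hb] with t h1 h4 hm
    refine ⟨((hasDerivAt_id t).const_mul (a₀ * δ)).add (h1 (hx.trans_lt hm.1)), ?_⟩
    have h6 := mul_le_mul h4.1 (hs t hm) hδ (ha₀.le.trans h4.1)
    linarith)
  linarith

theorem flux_eq_of_le (h : Trajectory a φ p) {x y : ℝ} (hx : 0 ≤ x) (hxy : x ≤ y)
    (hφ : ∀ t ∈ Ioo x y, Real.pi / 2 ≤ φ t) : p y = p x := by
  have := ((h.flux_locAC x y).intervalIntegrable_and_integral_eq hxy (f' := fun _ => 0) (by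
    filter_upwards [h.flux_deriv] with t ht hm
    have := ht (hx.trans_lt hm.1)
    rwa [clampedSource_of_le (hφ t hm), mul_zero, neg_zero] at this)).2
  rw [intervalIntegral.integral_zero] at this
  linarith

/-- A trajectory which has passed `π/2` never turns back. -/
theorem flux_nonneg_of_pi_div_two_lt (h : Trajectory a φ p) (ha₀ : 0 < a₀)
    (hb : ∀ᵐ x, a₀ ≤ a x ∧ a x ≤ A₀) {x₁ : ℝ} (hx₁ : 0 ≤ x₁) (hφ : Real.pi / 2 < φ x₁) {y : ℝ}
    (hy : 0 ≤ y) : 0 ≤ p y := by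
  have hcφ := h.locAC.continuous
  have hcp := h.flux_locAC.continuous
  have hpos : 0 < p x₁ := by
    -- Let x₀ be the last point before x₁ with φ ≤ π/2. Between them the flux equals p(x₁); were it
    -- nonpositive, φ could not have risen above π/2.
    have hK : IsCompact (Icc 0 x₁ ∩ {x | φ x ≤ Real.pi / 2}) :=
      isCompact_Icc.inter_right (isClosed_le hcφ continuous_const)
    obtain ⟨x₀, ⟨hx₀, hφ₀⟩, hmax⟩ := hK.exists_isGreatest
      ⟨0, ⟨le_rfl, hx₁⟩, by rw [mem_ofPred_eq, h.map_zero]; positivity⟩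
    have habove : ∀ t ∈ Ioo x₀ x₁, Real.pi / 2 ≤ φ t := fun t ht => by
      by_contra! hlt
      have := hmax ⟨⟨hx₀.1.trans ht.1.le, ht.2.le⟩, hlt.le⟩
      linarith [ht.1]
    by_contra! hle
    have h1 := h.locAC x₀ x₁ |>.le_of_deriv_nonpos hx₀.2 (f' := fun x => p x / a x) (by
      filter_upwards [h.deriv, hb] with t ht hbt hm
      refine ⟨ht (hx₀.1.trans_lt hm.1), ?_⟩
      have h2 := h.flux_eq_of_le (hx₀.1.trans hm.1.le) hm.2.le fun s hs =>
        habove s ⟨hm.1.trans hs.1, hs.2⟩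
      rw [← h2]
      exact div_nonpos_of_nonpos_of_nonneg hle (ha₀.le.trans hbt.1))
    have hφ₀ : φ x₀ ≤ Real.pi / 2 := hφ₀
    linarith
  rcases le_total y x₁ with hyx | hyx
  · exact hpos.le.trans (h.flux_antitone ha₀ hb hy hyx)
  by_contra! hneg
  -- Let z be the first point after x₁ with nonpositive flux. Until z the angle is non-decreasing,
  -- hence above π/2, so the flux keeps its positive value p(x₁), a contradiction.
  have hK : IsCompact (Icc x₁ y ∩ {x | p x ≤ 0}) :=
    isCompact_Icc.inter_right (isClosed_le hcp continuous_const)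
  obtain ⟨z, ⟨hz, hpz⟩, hmin⟩ := hK.exists_isLeast ⟨y, ⟨hyx, le_rfl⟩, hneg.le⟩
  have hbelow : ∀ t ∈ Ioo x₁ z, 0 ≤ p t := fun t ht => by
    by_contra! hlt
    have := hmin ⟨⟨ht.1.le, ht.2.le.trans hz.2⟩, hlt.le⟩
    linarith [ht.2]
  have h1 := h.flux_eq_of_le hx₁ hz.1 fun t ht => hφ.le.trans
    (h.mono ha₀ hb hx₁ ht.1.le fun s hs => hbelow s ⟨hs.1, hs.2.trans ht.2⟩)
  have hpz : p z ≤ 0 := hpz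
  linarith

/-- If φ stayed below l < π/2, the source would be bounded below once φ has left 0, and the flux
would decrease linearly until negative. -/
theorem exists_lt_of_flux_nonneg (h : Trajectory a φ p) (ha₀ : 0 < a₀)
    (hb : ∀ᵐ x, a₀ ≤ a x ∧ a x ≤ A₀) (hA₀ : a₀ ≤ A₀) (h0 : 0 < p 0) (hp : ∀ x, 0 ≤ x → 0 ≤ p x)
    {l : ℝ} (hl : l < Real.pi / 2) : ∃ x, 0 ≤ x ∧ l < φ x := by
  by_contra! hcon
  have hA : 0 < A₀ := ha₀.trans_le hA₀
  -- The flux falls at rate at most A₀, so it stays above p(0)/2 up to this time and φ(x₁) is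
  -- positive.
  set x₁ := p 0 / (2 * A₀) with hx₁
  have hx₁0 : 0 < x₁ := by positivity
  have h1 : p 0 / 2 / A₀ * (x₁ - 0) ≤ φ x₁ - φ 0 := by
    refine h.mul_le_sub ha₀ hb (by positivity) le_rfl hx₁0.le fun t ht => ?_
    have h2 := h.sub_mul_le_flux ha₀ hb le_rfl ht.1.le
    have h3 : A₀ * t ≤ A₀ * x₁ := by gcongr; exact ht.2.le
    have h4 : A₀ * x₁ = p 0 / 2 := by rw [hx₁]; field_simp
    linarith
  rw [h.map_zero, sub_zero, sub_zero] at h1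
  have hc : 0 < φ x₁ := lt_of_lt_of_le (by positivity) h1
  have hl0 : φ x₁ ≤ l := hcon x₁ hx₁0.le
  set δ := Real.sin (φ x₁) * Real.cos l with hδ
  have hδ0 : 0 < δ := mul_pos
    (Real.sin_pos_of_pos_of_lt_pi hc (by linarith [Real.pi_pos]))
    (Real.cos_pos_of_mem_Ioo ⟨by linarith [Real.pi_pos], hl⟩)
  have key : ∀ y, x₁ ≤ y → p y ≤ p x₁ - a₀ * δ * (y - x₁) := fun y hy => by
    refine h.flux_le_sub_mul ha₀ hb hx₁0.le hy hδ0.le fun t ht => ?_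
    have h2 : φ x₁ ≤ φ t :=
      h.mono ha₀ hb hx₁0.le ht.1.le fun s hs => hp s (hx₁0.le.trans hs.1.le)
    have h3 : φ t ≤ l := hcon t (hx₁0.le.trans ht.1.le)
    rw [clampedSource_of_mem ⟨hc.le.trans h2, h3.trans hl.le⟩]
    refine mul_le_mul ?_ ?_ ?_ ?_
    · exact Real.sin_le_sin_of_le_of_le_pi_div_two (by linarith) (by linarith) h2
    · exact Real.cos_le_cos_of_nonneg_of_le_pi (by linarith) (by linarith [Real.pi_pos]) h3
    · exact (Real.cos_pos_of_mem_Ioo ⟨by linarith [Real.pi_pos], hl⟩).le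
    · exact Real.sin_nonneg_of_nonneg_of_le_pi (by linarith) (by linarith [Real.pi_pos])
  have hp1 := hp x₁ hx₁0.le
  -- At this time the linear upper bound for the flux equals -1.
  have h5 := key (x₁ + (p x₁ + 1) / (a₀ * δ)) (by
    have : 0 ≤ (p x₁ + 1) / (a₀ * δ) := by positivity
    linarith)
  have h6 := hp (x₁ + (p x₁ + 1) / (a₀ * δ)) (by
    have : 0 ≤ (p x₁ + 1) / (a₀ * δ) := by positivity
    linarith)
  rw [add_sub_cancel_left, mul_div_cancel₀ _ (by positivity)] at h5
  linarith

/-- A trajectory with small initial flux turns back. -/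
theorem exists_flux_neg (h : Trajectory a φ p) (ha₀ : 0 < a₀)
    (hb : ∀ᵐ x, a₀ ≤ a x ∧ a x ≤ A₀) (hA₀ : a₀ ≤ A₀) (h0 : p 0 = a₀ / 2) :
    ∃ x, 0 ≤ x ∧ p x < 0 := by
  by_contra! hp
  have hpi := Real.pi_pos
  obtain ⟨x, hx, hlt⟩ := h.exists_lt_of_flux_nonneg ha₀ hb hA₀ (by rw [h0]; positivity) hp
    (l := Real.pi / 4) (by linarith)
  obtain ⟨y, hy, hφy⟩ := intermediate_value_Icc hx h.locAC.continuous.continuousOn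
    (show Real.pi / 4 ∈ Icc (φ 0) (φ x) from ⟨by rw [h.map_zero]; positivity, hlt.le⟩)
  -- While the flux is nonnegative and φ ≤ π/4, this quantity is non-increasing because a₀ ≤ a. It
  -- starts at a₀²/4, yet where φ = π/4 it is at least a₀²/2.
  have hac : LocAC fun x => p x * p x + a₀ ^ 2 * (Real.sin (φ x) * Real.sin (φ x)) :=
    (h.flux_locAC.mul h.flux_locAC).add ((locAC_const _).mul (h.locAC.sin.mul h.locAC.sin))
  have h1 := (hac 0 y).le_of_deriv_nonpos hy.1
    (f' := fun x => 2 * (clampedSource (φ x) * (p x / a x)) * (a₀ ^ 2 - a x ^ 2)) (by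
    filter_upwards [h.deriv, h.flux_deriv, hb] with t e1 e2 e3 hm
    have hat := ha₀.trans_le e3.1
    have k1 : 0 ≤ φ t := by
      have := h.mono ha₀ hb le_rfl hm.1.le fun s hs => hp s hs.1.le
      rwa [h.map_zero] at this
    have k2 : φ t ≤ Real.pi / 4 := by
      rw [← hφy]
      exact h.mono ha₀ hb hm.1.le hm.2.le fun s hs => hp s (hm.1.trans hs.1).le
    refine ⟨?_, mul_nonpos_of_nonneg_of_nonpos (mul_nonneg two_pos.le (mul_nonneg
      (clampedSource_nonneg _) (div_nonneg (hp t hm.1.le) hat.le))) (by nlinarith)⟩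
    have k3 := e1 hm.1
    have k4 := e2 hm.1
    refine ((k4.mul k4).add ((k3.sin.mul k3.sin).const_mul (a₀ ^ 2))).congr_deriv ?_
    rw [clampedSource_of_mem ⟨k1, by linarith⟩]
    field_simp
    ring)
  simp only [h0, h.map_zero, hφy, Real.sin_zero, Real.sin_pi_div_four] at h1
  have h2 : √2 / 2 * (√2 / 2) = (1 / 2 : ℝ) := by
    rw [div_mul_div_comm, Real.mul_self_sqrt two_pos.le]; norm_num
  rw [h2] at h1
  nlinarith [mul_self_nonneg (p y)]

/-- A trajectory with large initial flux passes `π/2`. -/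
theorem exists_pi_div_two_lt (h : Trajectory a φ p) (ha₀ : 0 < a₀)
    (hb : ∀ᵐ x, a₀ ≤ a x ∧ a x ≤ A₀) (hA₀ : a₀ ≤ A₀) (h0 : p 0 = 5 * A₀) :
    ∃ x, 0 ≤ x ∧ Real.pi / 2 < φ x := by
  have hA : 0 < A₀ := ha₀.trans_le hA₀
  refine ⟨1, zero_le_one, ?_⟩
  -- On [0, 1] the flux loses at most A₀, so it stays above 4A₀ and φ(1) ≥ 4 > π/2.
  have h1 := h.mul_le_sub ha₀ hb (c := 4 * A₀) (by positivity) le_rfl zero_le_one (fun t ht => by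
    have h2 := h.sub_mul_le_flux ha₀ hb le_rfl ht.1.le
    nlinarith [ht.2])
  rw [h.map_zero, mul_div_cancel_right₀ _ hA.ne'] at h1
  linarith [Real.pi_lt_four]

/-- A trajectory which neither turns back nor passes `π/2` is a half wall. -/
theorem halfWall (h : Trajectory a φ p) (ha₀ : 0 < a₀) (hb : ∀ᵐ x, a₀ ≤ a x ∧ a x ≤ A₀)
    (hA₀ : a₀ ≤ A₀) (h0 : 0 < p 0) (hp : ∀ x, 0 ≤ x → 0 ≤ p x)
    (hφ : ∀ x, 0 ≤ x → φ x ≤ Real.pi / 2) : HalfWall a φ p := by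
  have hmono : ∀ {x y}, 0 ≤ x → x ≤ y → φ x ≤ φ y := fun {x y} hx hxy =>
    h.mono ha₀ hb hx hxy fun s hs => hp s (hx.trans hs.1.le)
  have hnn : ∀ x, 0 ≤ x → 0 ≤ φ x := fun x hx => by
    rw [← h.map_zero]; exact hmono le_rfl hx
  refine ⟨h.locAC, h.flux_locAC, h.map_zero, ?_, fun x hx => hnn x hx.le, fun x hx => hφ x hx.le,
    ?_, ?_, ?_⟩
  · refine tendsto_order.2 ⟨fun l hl => ?_, fun u hu => ?_⟩
    · obtain ⟨x, hx, hlx⟩ := h.exists_lt_of_flux_nonneg ha₀ hb hA₀ h0 hp hl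
      filter_upwards [eventually_ge_atTop x] with y hy
      exact hlx.trans_le (hmono hx hy)
    · filter_upwards [eventually_ge_atTop 0] with y hy
      exact (hφ y hy).trans_lt hu
  · have hbound : ∀ᵐ x, 0 < x → 0 ≤ _root_.deriv φ x ∧ _root_.deriv φ x ≤ p 0 / a₀ := by
      filter_upwards [h.deriv, hb] with x hx hbx hx0
      rw [(hx hx0).deriv]
      exact ⟨div_nonneg (hp x hx0.le) (ha₀.le.trans hbx.1),
        div_le_div₀ h0.le (h.flux_antitone ha₀ hb le_rfl hx0.le) ha₀ hbx.1⟩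
    -- Square integrability follows since φ' is bounded by p(0)/a₀ and its integral is at most π/2.
    have hD : ∀ᵐ x, 0 < x → ‖_root_.deriv φ x ^ 2‖ ≤ p 0 / a₀ * _root_.deriv φ x := by
      filter_upwards [hbound] with x hx hx0
      obtain ⟨h1, h2⟩ := hx hx0
      rw [Real.norm_of_nonneg (sq_nonneg _), pow_two]
      gcongr
    have hI : ∀ R, 0 ≤ R → IntervalIntegrable (fun x => _root_.deriv φ x ^ 2) volume 0 R :=
      fun R hR => by
        refine ((h.locAC 0 R).intervalIntegrable_deriv.const_mul (p 0 / a₀)).mono_fun'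
          ((measurable_deriv φ).pow_const 2).aestronglyMeasurable ?_
        rw [EventuallyLE, ae_restrict_iff' measurableSet_uIoc]
        filter_upwards [hD] with x hx hm
        rw [uIoc_of_le hR] at hm
        exact hx hm.1
    refine integrableOn_Ioi_of_intervalIntegral_norm_bounded (ι := ℕ) (l := atTop)
      (b := fun n => (n : ℝ)) (p 0 / a₀ * (Real.pi / 2)) 0 (fun n =>
        (intervalIntegrable_iff_integrableOn_Ioc_of_le n.cast_nonneg).1 (hI n n.cast_nonneg))
      tendsto_natCast_atTop_atTop (Eventually.of_forall fun n => ?_)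
    have hn : (0 : ℝ) ≤ n := n.cast_nonneg
    calc ∫ x in (0 : ℝ)..n, ‖_root_.deriv φ x ^ 2‖
        ≤ ∫ x in (0 : ℝ)..n, p 0 / a₀ * _root_.deriv φ x := by
          refine intervalIntegral.integral_mono_ae_restrict hn (hI n hn).norm
            ((h.locAC 0 n).intervalIntegrable_deriv.const_mul _) ?_
          rw [EventuallyLE, ae_restrict_iff' measurableSet_Icc]
          filter_upwards [hD, Measure.ae_ne volume 0] with x hx hx0 hm
          exact hx (lt_of_le_of_ne hm.1 hx0.symm)
      _ = p 0 / a₀ * φ n := by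
          rw [intervalIntegral.integral_const_mul, (h.locAC 0 n).integral_deriv_eq_sub, h.map_zero,
            sub_zero]
      _ ≤ _ := by gcongr; exact hφ n hn
  · filter_upwards [h.deriv, hb] with x hx hbx hx0
    rw [(hx hx0).deriv, mul_div_cancel₀ _ (ha₀.trans_le hbx.1).ne']
  · filter_upwards [h.flux_deriv] with x hx hx0
    have := hx hx0
    rwa [clampedSource_of_mem ⟨hnn x hx0.le, hφ x hx0.le⟩] at this

end Trajectory

theorem exists_halfWall {a : ℝ → ℝ} {a₀ A₀ : ℝ} (ha : AEMeasurable a) (ha₀ : 0 < a₀)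
    (hA₀ : a₀ ≤ A₀) (hb : ∀ᵐ x, a₀ ≤ a x ∧ a x ≤ A₀) :
    ∃ φ p, HalfWall a φ p ∧ ∀ x, x ≤ 0 → φ x = 0 := by
  have hbn := ae_norm_le_of_bounds ha₀ hb
  have hA : 0 < A₀ := ha₀.trans_le hA₀
  -- The reciprocal weight is cut off so that solutions vanish on (-∞, 0], which later lets two half
  -- walls be glued by addition.
  set b : ℝ → ℝ := (Ioi 0).indicator fun x => (a x)⁻¹ with hbdef
  have hbm : AEMeasurable b := ha.inv.indicator measurableSet_Ioi
  have hbB : ∀ᵐ x, ‖b x‖ ≤ a₀⁻¹ := by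
    filter_upwards [hb] with x hx
    refine (norm_indicator_le_norm_self _ _).trans ?_
    rw [norm_inv, Real.norm_of_nonneg (ha₀.le.trans hx.1)]
    exact inv_anti₀ ha₀ hx.1
  have hb0 : ∀ x, x ≤ 0 → b x = 0 := fun x hx =>
    indicator_of_notMem (by simpa using hx) _
  obtain ⟨Φ, hc, heq, hα, hαp⟩ := exists_volterra hA (inv_pos.2 ha₀) ha hbm hbn hbB hb0
    lipschitzWith_clampedSource norm_clampedSource_le
  set P : ℝ → ℝ → ℝ := fun α x => α - ∫ s in (0 : ℝ)..x, a s * clampedSource (Φ α s) with hP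
  have hsrc : ∀ α u v, IntervalIntegrable (fun s => a s * clampedSource (Φ α s)) volume u v :=
    fun α u v => ((locallyIntegrable_of_bound ha hbn).intervalIntegrable_real u v).mul_continuousOn
      (lipschitzWith_clampedSource.continuous.comp (hc α)).continuousOn
  have hPac : ∀ α, LocAC (P α) := fun α => (locAC_const α).sub (locAC_primitive (hsrc α) 0)
  have hbP : ∀ α u v, IntervalIntegrable (fun t => b t * P α t) volume u v :=
    fun α u v => ((locallyIntegrable_of_bound hbm hbB).intervalIntegrable_real u v).mul_continuousOn
      (hPac α).continuous.continuousOn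
  have hΦ : ∀ α, Φ α = fun x => ∫ t in (0 : ℝ)..x, b t * P α t := fun α => funext (heq α)
  have htraj : ∀ α, Trajectory a (Φ α) (P α) := by
    intro α
    refine ⟨?_, hPac α, by rw [hΦ α]; simp, ?_, ?_⟩
    · rw [hΦ α]; exact locAC_primitive (hbP α) 0
    · rw [hΦ α]
      filter_upwards [ae_hasDerivAt_primitive (hbP α) 0] with x hx h0
      refine hx.congr_deriv ?_
      rw [hbdef, indicator_of_mem (mem_Ioi.2 h0), div_eq_inv_mul]
    · filter_upwards [ae_hasDerivAt_primitive (hsrc α) 0] with x hx _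
      exact hx.const_sub α
  have hP0 : ∀ α, P α 0 = α := fun α => by simp [hP]
  have hU : IsOpen {α | ∃ x, 0 ≤ x ∧ P α x < 0} := by
    have : {α | ∃ x, 0 ≤ x ∧ P α x < 0} = ⋃ x ∈ Ici (0 : ℝ), {α | P α x < 0} := by
      ext α; simp
    rw [this]
    exact isOpen_biUnion fun x hx => isOpen_lt (hαp x hx) continuous_const
  have hV : IsOpen {α | ∃ x, 0 ≤ x ∧ Real.pi / 2 < Φ α x} := by
    have : {α | ∃ x, 0 ≤ x ∧ Real.pi / 2 < Φ α x} =
        ⋃ x ∈ Ici (0 : ℝ), {α | Real.pi / 2 < Φ α x} := by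
      ext α; simp
    rw [this]
    exact isOpen_biUnion fun x _ => isOpen_lt continuous_const (hα x)
  obtain ⟨α, hαI, hαU, hαV⟩ : ∃ α ∈ Icc (a₀ / 2) (5 * A₀), (∀ x, 0 ≤ x → 0 ≤ P α x) ∧
      ∀ x, 0 ≤ x → Φ α x ≤ Real.pi / 2 := by
    by_contra! hcon
    have hle : a₀ / 2 ≤ 5 * A₀ := by linarith
    -- If every parameter failed, two open sets meeting the interval would cover it, so some
    -- trajectory would both turn back and pass π/2.
    obtain ⟨α, -, ⟨x, hx, hPx⟩, ⟨y, hy, hφy⟩⟩ := isPreconnected_Icc (a := a₀ / 2) (b := 5 * A₀)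
      _ _ hU hV (fun α hα => by
        by_cases h : ∀ x, 0 ≤ x → 0 ≤ P α x
        · exact Or.inr (hcon α hα h)
        · push Not at h
          exact Or.inl h)
      ⟨a₀ / 2, ⟨le_rfl, hle⟩, (htraj _).exists_flux_neg ha₀ hb hA₀ (hP0 _)⟩
      ⟨5 * A₀, ⟨hle, le_rfl⟩, (htraj _).exists_pi_div_two_lt ha₀ hb hA₀ (hP0 _)⟩
    have := (htraj α).flux_nonneg_of_pi_div_two_lt ha₀ hb hy hφy hx
    linarith
  refine ⟨Φ α, P α, (htraj α).halfWall ha₀ hb hA₀ ?_ hαU hαV, fun x hx => ?_⟩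
  · rw [hP0]; linarith [hαI.1]
  · rw [hΦ α]
    refine intervalIntegral.integral_zero_ae (Eventually.of_forall fun t ht => ?_)
    have h1 : t ≤ max 0 x := ht.2
    rw [max_eq_left hx] at h1
    rw [hb0 t h1, zero_mul]

/-- Gluing two half walls. -/
theorem exists_wall {a : ℝ → ℝ} {a₀ A₀ : ℝ} (ha : AEMeasurable a) (ha₀ : 0 < a₀)
    (hA₀ : a₀ ≤ A₀) (hb : ∀ᵐ x, a₀ ≤ a x ∧ a x ≤ A₀) :
    ∃ φ p q, HalfWall a φ p ∧ HalfWall (fun x => a (-x)) (fun x => -φ (-x)) q := by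
  have glue : ∀ {w f g r : ℝ → ℝ}, HalfWall w f r → LocAC g → (∀ x, 0 ≤ x → g x = 0) →
      HalfWall w (fun x => f x + g x) r := by
    intro w f g r h hg hg0
    have heq : ∀ x, 0 ≤ x → f x + g x = f x := fun x hx => by rw [hg0 x hx, add_zero]
    have hev : ∀ x, 0 < x → (fun x => f x + g x) =ᶠ[𝓝 x] f := fun x hx => by
      filter_upwards [lt_mem_nhds hx] with y hy using heq y hy.le
    refine ⟨h.locAC.add hg, h.flux_locAC, by rw [heq 0 le_rfl, h.map_zero], h.tendsto.congr' ?_,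
      fun x hx => by rw [heq x hx.le]; exact h.nonneg x hx,
      fun x hx => by rw [heq x hx.le]; exact h.le x hx, ?_, ?_, ?_⟩
    · filter_upwards [eventually_ge_atTop 0] with x hx using (heq x hx).symm
    · refine h.sq_integrable.congr_fun (fun x hx => ?_) measurableSet_Ioi
      simp only [(hev x hx).deriv_eq]
    · filter_upwards [h.flux_eq] with x hx h0
      rw [(hev x h0).deriv_eq, hx h0]
    · filter_upwards [h.flux_deriv] with x hx h0
      rw [heq x h0.le]
      exact hx h0
  obtain ⟨f, p, hf, hf0⟩ := exists_halfWall ha ha₀ hA₀ hb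
  obtain ⟨g, q, hg, hg0⟩ := exists_halfWall (aemeasurable_comp_neg ha) ha₀ hA₀ (ae_comp_neg hb)
  refine ⟨fun x => f x + -g (-x), p, q, glue hf hg.locAC.comp_neg.neg fun x hx => ?_, ?_⟩
  · rw [hg0 _ (by linarith), neg_zero]
  · have := glue hg hf.locAC.comp_neg.neg fun x hx => by rw [hf0 _ (by linarith), neg_zero]
    convert this using 2 with x
    simp


/-! ### Square integrable functions with square integrable derivative -/

/-- The scalar Sobolev space `H¹(ℝ)`. -/
def ScalarH1 (f : ℝ → ℝ) : Prop := LocAC f ∧ MemLp f 2 ∧ MemLp (deriv f) 2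

theorem ScalarH1.integrable_mul_deriv {f : ℝ → ℝ} (hf : ScalarH1 f) :
    Integrable fun x => f x * deriv f x := hf.2.1.integrable_mul hf.2.2

/-- Both f² and its derivative 2 f f' are integrable, so f² tends to 0. -/
theorem ScalarH1.tendsto {f : ℝ → ℝ} (hf : ScalarH1 f) :
    Tendsto f atTop (𝓝 0) ∧ Tendsto f atBot (𝓝 0) := by
  have h1 : LocAC fun x => f x * f x := hf.1.mul hf.1
  have h2 : Integrable fun x => f x * f x := hf.2.1.integrable_mul hf.2.1
  have h3 : Integrable (deriv fun x => f x * f x) := by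
    refine (hf.integrable_mul_deriv.const_mul 2).congr ?_
    filter_upwards [hf.1.ae_hasDerivAt] with x hx
    rw [(hx.fun_mul hx).deriv]
    ring
  have key : ∀ l : Filter ℝ, Tendsto (fun x => f x * f x) l (𝓝 0) → Tendsto f l (𝓝 0) := by
    intro l hl
    have h4 := (Real.continuous_sqrt.tendsto 0).comp hl
    simp only [Function.comp_def, Real.sqrt_mul_self_eq_abs, Real.sqrt_zero] at h4
    exact (tendsto_zero_iff_abs_tendsto_zero _).2 h4
  exact ⟨key _ (h1.tendsto_atTop_of_integrable h2 h3), key _ (h1.tendsto_atBot_of_integrable h2 h3)⟩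

theorem ScalarH1.exists_bound {f : ℝ → ℝ} (hf : ScalarH1 f) : ∃ C, ∀ x, |f x| ≤ C := by
  let g : ZeroAtInftyContinuousMap ℝ ℝ := ⟨⟨f, hf.1.continuous⟩, by
    rw [cocompact_eq_atBot_atTop]
    exact tendsto_sup.2 ⟨hf.tendsto.2, hf.tendsto.1⟩⟩
  obtain ⟨C, hC⟩ := g.isBounded_range.exists_norm_le
  exact ⟨C, fun x => hC _ ⟨x, rfl⟩⟩

theorem MemH1.apply {v : ℝ → E3} (hv : MemH1 v) (i : Fin 3) : ScalarH1 fun x => v x i := by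
  refine ⟨hv.1.apply i, ?_, ?_⟩
  · exact hv.2.1.mono (hv.1.apply i).continuous.aestronglyMeasurable
      (Eventually.of_forall fun x => PiLp.norm_apply_le _ _)
  · refine hv.2.2.mono (measurable_deriv _).aestronglyMeasurable ?_
    filter_upwards [hv.1.ae_hasDerivAt] with x hx
    rw [(hasDerivAt_apply hx i).deriv]
    exact PiLp.norm_apply_le _ _

theorem memH1_of_contDiff {w : ℝ → E3} (hw : ContDiff ℝ ∞ w) (hc : HasCompactSupport w) :
    MemH1 w :=
  ⟨hw.locAC, hw.continuous.memLp_of_hasCompactSupport hc,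
    (hw.continuous_deriv (by simp)).memLp_of_hasCompactSupport hc.deriv⟩

/-! ### Walls of even weights -/

/-- `φ` is a wall angle which solves the pendulum equation on the whole line, with flux `P`, and
with `cos φ ≤ φ'`. -/
structure FullWall (a φ P : ℝ → ℝ) (A₀ : ℝ) : Prop where
  locAC : LocAC φ
  flux_locAC : LocAC P
  flux_deriv : ∀ᵐ x, HasDerivAt P (-(a x * (Real.sin (φ x) * Real.cos (φ x)))) x
  flux_eq : ∀ᵐ x, a x * deriv φ x = P x
  cos_pos : ∀ x, 0 < Real.cos (φ x)
  flux_nonneg : ∀ x, 0 ≤ P x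
  flux_le : ∀ x, P x ≤ A₀ * Real.cos (φ x)
  cos_le : ∀ᵐ x, Real.cos (φ x) ≤ deriv φ x
  integrable : Integrable fun x => a x * (deriv φ x ^ 2 + Real.cos (φ x) ^ 2)

/-- The first integral with K = a(x)² applies because a(t) ≥ a(x) for t > x. Monotonicity of the
weight enters the stability proof through this estimate. -/
theorem HalfWall.cos_le_deriv {a φ p : ℝ → ℝ} {a₀ A₀ : ℝ} (h : HalfWall a φ p) (ha₀ : 0 < a₀)
    (hb : ∀ᵐ x, a₀ ≤ a x ∧ a x ≤ A₀) (hmono : MonotoneOn a (Ioi 0)) :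
    ∀ᵐ x, 0 < x → Real.cos (φ x) ≤ deriv φ x := by
  filter_upwards [hb, h.flux_eq, h.deriv_nonneg ha₀ hb] with x hbx h1 h2 h0
  have hax := ha₀.trans_le hbx.1
  have h3 := h.mul_cos_sq_le_flux_sq ha₀ hb h0.le (K := a x ^ 2) (Eventually.of_forall fun t ht => by
    have := hmono (mem_Ioi.2 h0) (mem_Ioi.2 (h0.trans ht)) ht.le
    gcongr)
  rw [← h1 h0, mul_pow] at h3
  exact le_of_sq_le_sq (le_of_mul_le_mul_left h3 (by positivity)) (h2 h0)

theorem exists_fullWall {a φ p q : ℝ → ℝ} {a₀ A₀ : ℝ} (h : HalfWall a φ p)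
    (h' : HalfWall (fun x => a (-x)) (fun x => -φ (-x)) q) (ha : AEMeasurable a) (ha₀ : 0 < a₀)
    (hA₀ : a₀ ≤ A₀) (hb : ∀ᵐ x, a₀ ≤ a x ∧ a x ≤ A₀) (heven : Function.Even a)
    (hodd : Function.Odd φ) (hmono : MonotoneOn a (Ioi 0)) : ∃ P, FullWall a φ P A₀ := by
  have hbn := ae_norm_le_of_bounds ha₀ hb
  have hsrc := (locallyIntegrable_source ha hbn h.locAC.continuous).intervalIntegrable_real
  -- The flux is continued to negative x by integrating the equation from `p 0`. The source is odd,
  -- so P is even and equals p(|x|).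
  set P : ℝ → ℝ := fun x => p 0 - ∫ t in (0 : ℝ)..x, a t * (Real.sin (φ t) * Real.cos (φ t)) with hP
  have hPac : LocAC P := (locAC_const _).sub (locAC_primitive hsrc 0)
  have hPd : ∀ᵐ x, HasDerivAt P (-(a x * (Real.sin (φ x) * Real.cos (φ x)))) x :=
    (ae_hasDerivAt_primitive hsrc 0).mono fun x hx => hx.const_sub _
  have hPp : ∀ x, 0 ≤ x → P x = p x := fun x hx => by
    have h1 := ((h.flux_locAC 0 x).intervalIntegrable_and_integral_eq hx
      (h.flux_deriv.mono fun t ht hm => ht hm.1)).2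
    rw [intervalIntegral.integral_neg] at h1
    simp only [hP]
    linarith
  have hPe : ∀ x, P (-x) = P x := fun x => by
    simp only [hP]
    congr 1
    have h1 := intervalIntegral.integral_comp_neg (a := 0) (b := x)
      (fun t => a t * (Real.sin (φ t) * Real.cos (φ t)))
    rw [neg_zero] at h1
    rw [intervalIntegral.integral_symm, ← h1, ← intervalIntegral.integral_neg]
    exact intervalIntegral.integral_congr fun t _ => by
      simp only [heven t, hodd t, Real.sin_neg, Real.cos_neg]
      ring
  have hPabs : ∀ x, P x = p |x| := fun x => by
    rcases abs_choice x with hx | hx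
    · rw [hx]; exact hPp x (by rw [← hx]; exact abs_nonneg x)
    · rw [hx, ← hPe]; exact hPp _ (by rw [← hx]; exact abs_nonneg x)
  have hcabs : ∀ x, Real.cos (φ x) = Real.cos (φ |x|) := fun x => by
    rcases abs_choice x with hx | hx
    · rw [hx]
    · rw [hx, hodd, Real.cos_neg]
  have hderiv : ∀ x, deriv φ (-x) = deriv φ x := fun x => by
    have h1 : (fun x => φ (-x)) = fun x => -φ x := funext hodd
    have h2 := deriv_comp_neg φ x
    rw [h1, deriv.fun_neg] at h2
    exact (neg_injective h2).symm
  have hext : ∀ {R : ℝ → Prop}, (∀ᵐ x, 0 < x → R x) → (∀ x, R (-x) → R x) → ∀ᵐ x, R x := by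
    intro R hR hneg
    filter_upwards [hR, ae_comp_neg hR, Measure.ae_ne volume 0] with x h1 h2 h3
    rcases lt_or_gt_of_ne h3 with hx | hx
    · exact hneg x (h2 (neg_pos.2 hx))
    · exact h1 hx
  refine ⟨P, h.locAC, hPac, hPd, hext ?_ ?_, fun x => ?_, fun x => ?_, fun x => ?_, hext
    (h.cos_le_deriv ha₀ hb hmono) fun x hx => ?_, ?_⟩
  · filter_upwards [h.flux_eq] with x hx h0
    rw [hPp x h0.le, hx h0]
  · intro x hx
    rwa [heven, hderiv, hPe] at hx
  · rw [hcabs]; exact h.cos_pos ha₀ hA₀ hb (abs_nonneg x)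
  · rw [hPabs]; exact h.flux_nonneg ha₀ hb (abs_nonneg x)
  · rw [hPabs, hcabs]; exact h.flux_le_mul_cos ha₀ hA₀ hb (abs_nonneg x)
  · rwa [hderiv, hodd, Real.cos_neg] at hx
  · have hm : AEStronglyMeasurable (fun x => a x * (deriv φ x ^ 2 + Real.cos (φ x) ^ 2)) :=
      (ha.mul (((measurable_deriv φ).pow_const 2).add
        (h.locAC.cos.continuous.measurable.pow_const 2)).aemeasurable).aestronglyMeasurable
    refine ⟨hm, (hasFiniteIntegral_iff_ofReal (hb.mono fun x hx => ?_)).2 ?_⟩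
    · have := ha₀.le.trans hx.1
      simp only [Pi.zero_apply]
      positivity
    · rw [← energy_planar h.locAC]
      exact energy_planar_lt_top h h' ha ha₀ hA₀ hb

/-! ### Euler–Lagrange equation and nonnegativity of the second variation -/

namespace FullWall

variable {a φ P : ℝ → ℝ} {a₀ A₀ : ℝ}

theorem memLp_of_sq_le (h : FullWall a φ P A₀) (ha₀ : 0 < a₀) (hb : ∀ᵐ x, a₀ ≤ a x ∧ a x ≤ A₀)
    {f : ℝ → ℝ} (hf : Measurable f) (hle : ∀ x, f x ^ 2 ≤ deriv φ x ^ 2 + Real.cos (φ x) ^ 2) :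
    MemLp f 2 := by
  rw [memLp_two_iff_integrable_sq hf.aestronglyMeasurable]
  refine Integrable.mono' (h.integrable.const_mul a₀⁻¹) (hf.pow_const 2).aestronglyMeasurable ?_
  filter_upwards [hb] with x hx
  rw [Real.norm_of_nonneg (sq_nonneg _), le_inv_mul_iff₀ ha₀]
  have := ha₀.trans_le hx.1
  exact mul_le_mul hx.1 (hle x) (sq_nonneg _) this.le

theorem memLp_deriv (h : FullWall a φ P A₀) (ha₀ : 0 < a₀) (hb : ∀ᵐ x, a₀ ≤ a x ∧ a x ≤ A₀) :
    MemLp (deriv φ) 2 :=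
  h.memLp_of_sq_le ha₀ hb (measurable_deriv φ) fun x => by nlinarith [sq_nonneg (Real.cos (φ x))]

theorem memLp_cos (h : FullWall a φ P A₀) (ha₀ : 0 < a₀) (hb : ∀ᵐ x, a₀ ≤ a x ∧ a x ≤ A₀) :
    MemLp (fun x => Real.cos (φ x)) 2 :=
  h.memLp_of_sq_le ha₀ hb h.locAC.cos.continuous.measurable fun x => by
    nlinarith [sq_nonneg (deriv φ x)]

theorem flux_le_const (h : FullWall a φ P A₀) (hA₀ : 0 ≤ A₀) (x : ℝ) : |P x| ≤ A₀ := by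
  rw [abs_of_nonneg (h.flux_nonneg x)]
  exact (h.flux_le x).trans (mul_le_of_le_one_right hA₀ (Real.cos_le_one _))

/-- The bound P ≤ A₀ cos φ cancels the pole of the tangent, so P tan φ |v|² vanishes at infinity for
v in H¹. -/
theorem flux_mul_tan_le (h : FullWall a φ P A₀) (x : ℝ) :
    |P x * (Real.sin (φ x) * (Real.cos (φ x))⁻¹)| ≤ A₀ := by
  have hc := h.cos_pos x
  rw [abs_mul, abs_mul, abs_of_nonneg (h.flux_nonneg x), abs_inv, abs_of_pos hc]
  calc P x * (|Real.sin (φ x)| * (Real.cos (φ x))⁻¹)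
      ≤ A₀ * Real.cos (φ x) * (1 * (Real.cos (φ x))⁻¹) := by
        have := h.flux_nonneg x
        have := this.trans (h.flux_le x)
        gcongr
        · exact h.flux_le x
        · exact Real.abs_sin_le_one _
    _ = A₀ := by field_simp

/-- The Euler-Lagrange equation, tested with functions in `H¹`. -/
theorem integral_eulerLagrange (h : FullWall a φ P A₀) (ha : AEMeasurable a) (ha₀ : 0 < a₀)
    (hA₀ : a₀ ≤ A₀) (hb : ∀ᵐ x, a₀ ≤ a x ∧ a x ≤ A₀) {w₀ w₁ : ℝ → ℝ} (h₀ : ScalarH1 w₀)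
    (h₁ : ScalarH1 w₁) :
    ∫ x, (a x * (deriv φ x * (Real.cos (φ x) * deriv w₀ x - Real.sin (φ x) * deriv w₁ x)) +
        a x * (Real.cos (φ x) * w₁ x)) =
      ∫ x, a x * (deriv φ x ^ 2 + Real.cos (φ x) ^ 2) *
        (Real.sin (φ x) * w₀ x + Real.cos (φ x) * w₁ x) := by
  have hA : 0 ≤ A₀ := ha₀.le.trans hA₀
  have hbn := ae_norm_le_of_bounds ha₀ hb
  have hcos := h.locAC.cos.continuous
  have hsin := h.locAC.sin.continuous
  have hφ' := memLp_weight_mul ha hbn (h.memLp_deriv ha₀ hb)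
  have hc' := memLp_weight_mul ha hbn (h.memLp_cos ha₀ hb)
  have hmc : ∀ {f : ℝ → ℝ}, MemLp f 2 → MemLp (fun x => Real.cos (φ x) * f x) 2 := fun hf =>
    memLp_weight_mul (A := 1) hcos.aemeasurable
      (Eventually.of_forall fun x => Real.abs_cos_le_one _) hf
  have hms : ∀ {f : ℝ → ℝ}, MemLp f 2 → MemLp (fun x => Real.sin (φ x) * f x) 2 := fun hf =>
    memLp_weight_mul (A := 1) hsin.aemeasurable
      (Eventually.of_forall fun x => Real.abs_sin_le_one _) hf
  have i1 : Integrable fun x => a x * (deriv φ x * (Real.cos (φ x) * deriv w₀ x -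
      Real.sin (φ x) * deriv w₁ x)) + a x * (Real.cos (φ x) * w₁ x) := by
    have e1 := hφ'.integrable_mul ((hmc h₀.2.2).sub (hms h₁.2.2))
    have e2 := hc'.integrable_mul h₁.2.1
    refine (e1.add e2).congr (Eventually.of_forall fun x => ?_)
    simp only [Pi.add_apply, Pi.mul_apply, Pi.sub_apply]
    ring
  obtain ⟨C₀, hC₀⟩ := h₀.exists_bound
  obtain ⟨C₁, hC₁⟩ := h₁.exists_bound
  have i2 : Integrable fun x => a x * (deriv φ x ^ 2 + Real.cos (φ x) ^ 2) *
      (Real.sin (φ x) * w₀ x + Real.cos (φ x) * w₁ x) := by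
    refine h.integrable.mul_bdd (c := C₀ + C₁)
      ((hsin.mul h₀.1.continuous).add (hcos.mul h₁.1.continuous)).aestronglyMeasurable
      (Eventually.of_forall fun x => ?_)
    refine (norm_add_le _ _).trans (add_le_add ?_ ?_)
    · rw [norm_mul]
      exact (mul_le_of_le_one_left (norm_nonneg _) (Real.abs_sin_le_one _)).trans (hC₀ x)
    · rw [norm_mul]
      exact (mul_le_of_le_one_left (norm_nonneg _) (Real.abs_cos_le_one _)).trans (hC₁ x)
  have hlim : ∀ l : Filter ℝ, Tendsto w₀ l (𝓝 0) → Tendsto w₁ l (𝓝 0) →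
      Tendsto (fun x => P x * (Real.cos (φ x) * w₀ x - Real.sin (φ x) * w₁ x)) l (𝓝 0) := by
    intro l l0 l1
    have l2 : Tendsto (fun x => A₀ * (|w₀ x| + |w₁ x|)) l (𝓝 0) := by
      simpa using (l0.abs.add l1.abs).const_mul A₀
    refine squeeze_zero_norm (fun x => ?_) l2
    rw [norm_mul]
    refine mul_le_mul (h.flux_le_const hA x) ?_ (norm_nonneg _) hA
    refine (norm_sub_le _ _).trans (add_le_add ?_ ?_)
    · rw [norm_mul]; exact mul_le_of_le_one_left (norm_nonneg _) (Real.abs_cos_le_one _)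
    · rw [norm_mul]; exact mul_le_of_le_one_left (norm_nonneg _) (Real.abs_sin_le_one _)
  -- The difference of the two integrands is the derivative of P times the component of w along the
  -- tangent (cos φ, -sin φ), which vanishes at both ends.
  have key := (h.flux_locAC.mul ((h.locAC.cos.mul h₀.1).sub (h.locAC.sin.mul h₁.1))).integral_eq_zero
    (f' := fun x => (a x * (deriv φ x * (Real.cos (φ x) * deriv w₀ x -
      Real.sin (φ x) * deriv w₁ x)) + a x * (Real.cos (φ x) * w₁ x)) -
      a x * (deriv φ x ^ 2 + Real.cos (φ x) ^ 2) *
        (Real.sin (φ x) * w₀ x + Real.cos (φ x) * w₁ x)) (by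
    filter_upwards [h.flux_deriv, h.flux_eq, h.locAC.ae_hasDerivAt, h₀.1.ae_hasDerivAt,
      h₁.1.ae_hasDerivAt] with x e1 e2 e3 e4 e5
    refine (e1.mul ((e3.cos.fun_mul e4).fun_sub (e3.sin.fun_mul e5))).congr_deriv ?_
    rw [← e2]
    linear_combination (-(a x * Real.cos (φ x) * w₁ x)) * Real.sin_sq_add_cos_sq (φ x) * (-1))
    (i1.sub i2) (hlim _ h₀.tendsto.1 h₁.tendsto.1) (hlim _ h₀.tendsto.2 h₁.tendsto.2)
  rw [integral_sub i1 i2] at key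
  exact sub_eq_zero.1 key

theorem multiplier_ae_eq (h : FullWall a φ P A₀) : ∀ᵐ x,
    multiplier a (planar φ) x = a x * (deriv φ x ^ 2 + Real.cos (φ x) ^ 2) := by
  filter_upwards [h.locAC.ae_hasDerivAt] with x hx
  rw [multiplier, norm_deriv_planar_sq hx, planar_apply_one, mul_add]

theorem inner_deriv_planar {x : ℝ} (hx : HasDerivAt φ (deriv φ x) x) (y : E3) :
    inner ℝ (deriv (planar φ) x) y =
      deriv φ x * (Real.cos (φ x) * y 0 - Real.sin (φ x) * y 1) := by
  rw [deriv_planar hx, inner_eq]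
  simp [e₁, e₂]
  ring

theorem integral_eulerLagrange_vector (h : FullWall a φ P A₀) (ha : AEMeasurable a) (ha₀ : 0 < a₀)
    (hA₀ : a₀ ≤ A₀) (hb : ∀ᵐ x, a₀ ≤ a x ∧ a x ≤ A₀) {w : ℝ → E3} (hw : MemH1 w) :
    ∫ x, (a x * inner ℝ (deriv (planar φ) x) (deriv w x) +
        a x * (planar φ x 1 * w x 1 + planar φ x 2 * w x 2)) =
      ∫ x, multiplier a (planar φ) x * inner ℝ (planar φ x) (w x) := by
  have h1 := h.integral_eulerLagrange ha ha₀ hA₀ hb (hw.apply 0) (hw.apply 1)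
  have h2 : ∫ x, (a x * inner ℝ (deriv (planar φ) x) (deriv w x) +
      a x * (planar φ x 1 * w x 1 + planar φ x 2 * w x 2)) =
      ∫ x, (a x * (deriv φ x * (Real.cos (φ x) * deriv (fun x => w x 0) x -
        Real.sin (φ x) * deriv (fun x => w x 1) x)) + a x * (Real.cos (φ x) * w x 1)) := by
    refine integral_congr_ae ?_
    filter_upwards [h.locAC.ae_hasDerivAt, hw.1.ae_hasDerivAt] with x hx hwx
    rw [inner_deriv_planar hx, (hasDerivAt_apply hwx 0).deriv, (hasDerivAt_apply hwx 1).deriv,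
      planar_apply_one, planar_apply_two, zero_mul, add_zero]
  rw [h2, h1]
  refine integral_congr_ae ?_
  filter_upwards [h.multiplier_ae_eq] with x hx
  rw [hx, inner_eq, planar_apply_zero, planar_apply_one, planar_apply_two, zero_mul, add_zero]

theorem isLagrangeMultiplier (h : FullWall a φ P A₀) (ha : AEMeasurable a) (ha₀ : 0 < a₀)
    (hA₀ : a₀ ≤ A₀) (hb : ∀ᵐ x, a₀ ≤ a x ∧ a x ≤ A₀) :
    IsLagrangeMultiplier a (planar φ) (multiplier a (planar φ)) := fun _ hw hc =>
  h.integral_eulerLagrange_vector ha ha₀ hA₀ hb (memH1_of_contDiff hw hc)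

/-- The pointwise inequality behind the stability of the wall. -/
theorem neg_deriv_le_secondVarIntegrand (h : FullWall a φ P A₀) (ha₀ : 0 < a₀)
    (hb : ∀ᵐ x, a₀ ≤ a x ∧ a x ≤ A₀) {v : ℝ → E3} (hv : LocAC v)
    (ho : ∀ x, inner ℝ (v x) (planar φ x) = 0) : ∃ Q' : ℝ → ℝ,
    (∀ᵐ x, HasDerivAt (fun x => P x * (Real.sin (φ x) * (Real.cos (φ x))⁻¹) *
      (v x 0 * v x 0 + v x 1 * v x 1 + v x 2 * v x 2)) (Q' x) x) ∧
    ∀ᵐ x, -Q' x ≤ secondVarIntegrand a (planar φ) v x := by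
  -- Completing the square, this derivative plus the second variation integrand is a (|v' + φ' tan φ
  -- v|² - v₀²).
  refine ⟨fun x => -(a x * Real.sin (φ x) ^ 2) * ‖v x‖ ^ 2 + a x * deriv φ x ^ 2 *
    (1 + (Real.sin (φ x) * (Real.cos (φ x))⁻¹) ^ 2) * ‖v x‖ ^ 2 + 2 * a x * deriv φ x *
    (Real.sin (φ x) * (Real.cos (φ x))⁻¹) *
      (v x 0 * deriv v x 0 + v x 1 * deriv v x 1 + v x 2 * deriv v x 2), ?_, ?_⟩
  · filter_upwards [h.flux_deriv, h.flux_eq, h.locAC.ae_hasDerivAt, hv.ae_hasDerivAt]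
      with x e1 e2 e3 e4
    have hc := (h.cos_pos x).ne'
    have d0 := hasDerivAt_apply e4 0
    have d1 := hasDerivAt_apply e4 1
    have d2 := hasDerivAt_apply e4 2
    refine ((e1.fun_mul (hasDerivAt_sin_mul_inv_cos e3 hc)).fun_mul
      (((d0.fun_mul d0).fun_add (d1.fun_mul d1)).fun_add (d2.fun_mul d2))).congr_deriv ?_
    have e5 : Real.sin (φ x) * Real.cos (φ x) * (Real.sin (φ x) * (Real.cos (φ x))⁻¹)
        = Real.sin (φ x) ^ 2 := by field_simp
    rw [← e2, norm_sq_eq]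
    generalize Real.sin (φ x) * (Real.cos (φ x))⁻¹ = t at *
    linear_combination (-(a x) * (v x 0 ^ 2 + v x 1 ^ 2 + v x 2 ^ 2)) * e5
  · filter_upwards [h.multiplier_ae_eq, h.locAC.ae_hasDerivAt, hv.ae_hasDerivAt, h.cos_le, hb]
      with x e1 e3 e4 e5 e6
    have hc := h.cos_pos x
    have ho' : ∀ x, v x 0 * Real.sin (φ x) + v x 1 * Real.cos (φ x) = 0 := fun x => by
      simpa [inner_eq] using ho x
    have d0 := hasDerivAt_apply e4 0
    have d1 := hasDerivAt_apply e4 1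
    have d : HasDerivAt (fun x => v x 0 * Real.sin (φ x) + v x 1 * Real.cos (φ x)) 0 x := by
      rw [funext ho']; exact hasDerivAt_const x 0
    have e7 := ((d0.fun_mul e3.sin).fun_add (d1.fun_mul e3.cos)).unique d
    have e8 := ho' x
    rw [secondVarIntegrand, e1, norm_sq_eq, norm_sq_eq]
    have e9 := Real.sin_sq_add_cos_sq (φ x)
    set s := Real.sin (φ x)
    set c := Real.cos (φ x)
    set f := deriv φ x
    set t := s * c⁻¹
    generalize v x 0 = v₀ at *
    generalize v x 1 = v₁ at *
    generalize v x 2 = v₂ at *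
    generalize deriv v x 0 = z₀ at *
    generalize deriv v x 1 = z₁ at *
    generalize deriv v x 2 = z₂ at *
    have hf : 0 < f := hc.trans_le e5
    -- the component of `v' + φ' tan φ v` along `m`
    have k1 : v₀ = c * (v₀ * c - v₁ * s) := by linear_combination s * e8 - v₀ * e9
    have k2 : (z₀ + f * t * v₀) * s + (z₁ + f * t * v₁) * c = -(f * (v₀ * c - v₁ * s)) := by
      linear_combination e7 + f * t * e8
    -- Orthogonality to m gives v₀ = cos φ times the in-plane tangential component; this is where
    -- cos φ ≤ φ' is used.
    have k3 : v₀ ^ 2 ≤ (f * (v₀ * c - v₁ * s)) ^ 2 := by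
      conv_lhs => rw [k1]
      rw [mul_pow, mul_pow]
      gcongr
    have k4 : (f * (v₀ * c - v₁ * s)) ^ 2 ≤ (z₀ + f * t * v₀) ^ 2 + (z₁ + f * t * v₁) ^ 2 := by
      rw [← neg_sq, ← k2]
      have : ((z₀ + f * t * v₀) * s + (z₁ + f * t * v₁) * c) ^ 2 =
          ((z₀ + f * t * v₀) ^ 2 + (z₁ + f * t * v₁) ^ 2) * (s ^ 2 + c ^ 2) -
          ((z₀ + f * t * v₀) * c - (z₁ + f * t * v₁) * s) ^ 2 := by ring
      rw [this, e9]
      nlinarith [sq_nonneg ((z₀ + f * t * v₀) * c - (z₁ + f * t * v₁) * s)]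
    have k5 : 0 ≤ (z₀ + f * t * v₀) ^ 2 + (z₁ + f * t * v₁) ^ 2 + (z₂ + f * t * v₂) ^ 2 - v₀ ^ 2 := by
      nlinarith [sq_nonneg (z₂ + f * t * v₂)]
    have k6 := mul_nonneg (ha₀.le.trans e6.1) k5
    have k7 : s ^ 2 = 1 - c ^ 2 := by linarith
    rw [k7]
    linarith

theorem secondVarIntegrand_ae_eq (h : FullWall a φ P A₀) (v : ℝ → E3) : ∀ᵐ x,
    secondVarIntegrand a (planar φ) v x = a x * (‖deriv v x‖ ^ 2 + (v x 1 ^ 2 + v x 2 ^ 2)) -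
      a x * (deriv φ x ^ 2 + Real.cos (φ x) ^ 2) * ‖v x‖ ^ 2 := by
  filter_upwards [h.multiplier_ae_eq] with x hx
  rw [secondVarIntegrand, hx]
  ring

theorem secondVar_nonneg (h : FullWall a φ P A₀) (ha₀ : 0 < a₀) (hA₀ : a₀ ≤ A₀)
    (hb : ∀ᵐ x, a₀ ≤ a x ∧ a x ≤ A₀) {v : ℝ → E3} (hv : MemH1 v)
    (ho : ∀ x, inner ℝ (v x) (planar φ x) = 0)
    (hi : Integrable (secondVarIntegrand a (planar φ) v)) : 0 ≤ secondVar a (planar φ) v := by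
  obtain ⟨Q', hQ', hle⟩ := h.neg_deriv_le_secondVarIntegrand ha₀ hb hv.1 ho
  have hA : 0 ≤ A₀ := ha₀.le.trans hA₀
  set Q : ℝ → ℝ := fun x => P x * (Real.sin (φ x) * (Real.cos (φ x))⁻¹) *
      (v x 0 * v x 0 + v x 1 * v x 1 + v x 2 * v x 2) with hQ
  have hac : LocAC Q := (h.flux_locAC.mul (h.locAC.sin.mul (h.locAC.cos.inv_of_pos h.cos_pos))).mul
    ((((hv.1.apply 0).mul (hv.1.apply 0)).add ((hv.1.apply 1).mul (hv.1.apply 1))).add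
      ((hv.1.apply 2).mul (hv.1.apply 2)))
  have hlim : ∀ l : Filter ℝ, (∀ i, Tendsto (fun x => v x i) l (𝓝 0)) → Tendsto Q l (𝓝 0) := by
    intro l hl
    have l2 : Tendsto (fun x => A₀ * |v x 0 * v x 0 + v x 1 * v x 1 + v x 2 * v x 2|) l (𝓝 0) := by
      simpa using (((((hl 0).mul (hl 0)).add ((hl 1).mul (hl 1))).add
        ((hl 2).mul (hl 2))).abs).const_mul A₀
    refine squeeze_zero_norm (fun x => ?_) l2
    rw [hQ, norm_mul]
    exact mul_le_mul_of_nonneg_right (h.flux_mul_tan_le x) (norm_nonneg _)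
  have htop := hlim atTop fun i => (hv.apply i).tendsto.1
  have hbot := hlim atBot fun i => (hv.apply i).tendsto.2
  -- The inequality is integrated over [-R, R], where Q' is integrable as the derivative of an
  -- absolutely continuous function, and Q(-R) - Q(R) tends to 0.
  have hT := (hbot.comp tendsto_neg_atTop_atBot).sub htop
  rw [sub_zero] at hT
  refine le_of_tendsto_of_tendsto hT (intervalIntegral_tendsto_integral hi tendsto_neg_atTop_atBot
    tendsto_id) ?_
  filter_upwards [eventually_ge_atTop 0] with R hR
  have hR' : -R ≤ R := by linarith
  obtain ⟨k1, k2⟩ := (hac (-R) R).intervalIntegrable_and_integral_eq hR'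
    (hQ'.mono fun x hx _ => hx)
  have k3 : ∫ x in -R..R, -Q' x ≤ ∫ x in -R..R, secondVarIntegrand a (planar φ) v x :=
    intervalIntegral.integral_mono_ae hR' k1.neg hi.intervalIntegrable hle
  rw [intervalIntegral.integral_neg, k2] at k3
  simpa using k3

end FullWall


/-! ### The energy along a variation -/

/-- Integrals of the form `∫ f / (1 + t² s)ʲ`. -/
noncomputable def ratInt (f s : ℝ → ℝ) (j : ℕ) (t : ℝ) : ℝ :=
  ∫ x, f x * ((1 + t ^ 2 * s x) ^ j)⁻¹

theorem inv_one_add_pow_le_one {t y : ℝ} (hy : 0 ≤ y) (j : ℕ) : ((1 + t ^ 2 * y) ^ j)⁻¹ ≤ 1 := by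
  have : 1 ≤ 1 + t ^ 2 * y := by nlinarith [mul_nonneg (sq_nonneg t) hy]
  exact inv_le_one_of_one_le₀ (one_le_pow₀ this)

theorem hasDerivAt_inv_one_add_pow {y : ℝ} (hy : 0 ≤ y) (j : ℕ) (t : ℝ) :
    HasDerivAt (fun t : ℝ => ((1 + t ^ 2 * y) ^ j)⁻¹)
      (-(2 * j * t) * (y * ((1 + t ^ 2 * y) ^ (j + 1))⁻¹)) t := by
  have h0 : 0 < 1 + t ^ 2 * y := by nlinarith [mul_nonneg (sq_nonneg t) hy]
  have h1 : HasDerivAt (fun t : ℝ => 1 + t ^ 2 * y) (2 * t * y) t := by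
    simpa using (((hasDerivAt_id t).pow 2).mul_const y).const_add 1
  refine ((h1.fun_pow j).fun_inv (pow_ne_zero j h0.ne')).congr_deriv ?_
  rcases j with - | k
  · simp
  · rw [Nat.add_sub_cancel]
    field_simp
    ring

section

variable {f s : ℝ → ℝ} {S : ℝ}

theorem integrable_mul_ratio (hf : Integrable f) (hsm : Continuous s) (hs : ∀ x, 0 ≤ s x)
    (j : ℕ) (t : ℝ) : Integrable fun x => f x * ((1 + t ^ 2 * s x) ^ j)⁻¹ := by
  have hpos : ∀ x, 0 < 1 + t ^ 2 * s x := fun x => by nlinarith [mul_nonneg (sq_nonneg t) (hs x)]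
  refine hf.mul_bdd (c := 1) ?_ (Eventually.of_forall fun x => ?_)
  · exact (Continuous.inv₀ (by fun_prop) fun x => pow_ne_zero j (hpos x).ne').aestronglyMeasurable
  · rw [Real.norm_of_nonneg (inv_nonneg.2 (pow_nonneg (hpos x).le j))]
    exact inv_one_add_pow_le_one (hs x) j

/-- Differentiation stays within the family of these integrals. Domination is uniform for parameters
within distance 1 of t, since the rational factors are at most 1. -/
theorem hasDerivAt_ratInt (hf : Integrable f) (hsm : Continuous s) (hs : ∀ x, 0 ≤ s x)
    (hS : ∀ x, s x ≤ S) (j : ℕ) (t : ℝ) :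
    HasDerivAt (ratInt f s j) (-(2 * j * t) * ratInt (fun x => f x * s x) s (j + 1) t) t := by
  have hfs : Integrable fun x => f x * s x :=
    hf.mul_bdd (c := S) hsm.aestronglyMeasurable (Eventually.of_forall fun x => by
      rw [Real.norm_of_nonneg (hs x)]; exact hS x)
  have key := hasDerivAt_integral_of_dominated_loc_of_deriv_le (μ := volume)
    (F := fun t x => f x * ((1 + t ^ 2 * s x) ^ j)⁻¹)
    (F' := fun t x => -(2 * j * t) * (f x * s x * ((1 + t ^ 2 * s x) ^ (j + 1))⁻¹))
    (bound := fun x => 2 * j * (|t| + 1) * |f x * s x|) (x₀ := t)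
    (Metric.ball_mem_nhds t one_pos)
    (Eventually.of_forall fun r => (integrable_mul_ratio hf hsm hs j r).aestronglyMeasurable)
    (integrable_mul_ratio hf hsm hs j t)
    ((integrable_mul_ratio hfs hsm hs (j + 1) t).const_mul _).aestronglyMeasurable
    (Eventually.of_forall fun x r hr => ?_)
    (hfs.abs.const_mul _)
    (Eventually.of_forall fun x r _ => ?_)
  · have := key.2
    rwa [integral_const_mul] at this
  · have hr1 : |r| ≤ |t| + 1 := by
      have h1 : |r - t| < 1 := hr
      have h2 := abs_add_le (r - t) t
      rw [sub_add_cancel] at h2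
      linarith
    have hpos : 0 < 1 + r ^ 2 * s x := by nlinarith [mul_nonneg (sq_nonneg r) (hs x)]
    rw [norm_mul, norm_neg, norm_mul _ r, norm_mul (f x * s x),
      Real.norm_of_nonneg (by positivity : (0 : ℝ) ≤ 2 * j),
      Real.norm_of_nonneg (inv_nonneg.2 (pow_nonneg hpos.le (j + 1)))]
    refine mul_le_mul (by gcongr; exact hr1) ?_ (by positivity) (by positivity)
    exact mul_le_of_le_one_right (abs_nonneg _) (inv_one_add_pow_le_one (hs x) _)
  · refine ((hasDerivAt_inv_one_add_pow (hs x) j r).const_mul (f x)).congr_deriv ?_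
    ring

/-- First and second derivative at `0` of the functions that describe the energy along a
variation. -/
theorem hasDerivAt_energy_model {X Y Z K : ℝ → ℝ} (hX : Integrable X) (hY : Integrable Y)
    (hZ : Integrable Z) (hK : Integrable K) (hsm : Continuous s) (hs : ∀ x, 0 ≤ s x)
    (hS : ∀ x, s x ≤ S) {E : ℝ → ℝ} (hE : ∀ t, E t = ratInt X s 1 t + 2 * t * ratInt Y s 1 t +
      t ^ 2 * ratInt Z s 1 t - t ^ 4 * ratInt K s 2 t) :
    HasDerivAt E (2 * ∫ x, Y x) 0 ∧ (∀ t, DifferentiableAt ℝ E t) ∧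
      HasDerivAt (deriv E) (2 * ∫ x, (Z x - X x * s x)) 0 := by
  have hmul : ∀ {g : ℝ → ℝ}, Integrable g → Integrable fun x => g x * s x := fun hg =>
    hg.mul_bdd (c := S) hsm.aestronglyMeasurable (Eventually.of_forall fun x => by
      rw [Real.norm_of_nonneg (hs x)]; exact hS x)
  have hd : ∀ {g : ℝ → ℝ}, Integrable g → ∀ (j : ℕ) (t : ℝ), HasDerivAt (ratInt g s j)
      (-(2 * j * t) * ratInt (fun x => g x * s x) s (j + 1) t) t := fun hg j t =>
    hasDerivAt_ratInt hg hsm hs hS j t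
  have hz : ∀ (g : ℝ → ℝ) (j : ℕ), ratInt g s j 0 = ∫ x, g x := fun g j => by simp [ratInt]
  have hE' : E = fun t => ratInt X s 1 t + 2 * t * ratInt Y s 1 t +
      t ^ 2 * ratInt Z s 1 t - t ^ 4 * ratInt K s 2 t := funext hE
  have d1 : ∀ t, HasDerivAt E (-(2 * t) * ratInt (fun x => X x * s x) s 2 t +
      2 * ratInt Y s 1 t - 4 * t ^ 2 * ratInt (fun x => Y x * s x) s 2 t +
      2 * t * ratInt Z s 1 t - 2 * t ^ 3 * ratInt (fun x => Z x * s x) s 2 t -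
      4 * t ^ 3 * ratInt K s 2 t + 4 * t ^ 5 * ratInt (fun x => K x * s x) s 3 t) t := by
    intro t
    rw [hE']
    refine ((((hd hX 1 t).fun_add (((hasDerivAt_id t).const_mul 2).fun_mul (hd hY 1 t))).fun_add
      (((hasDerivAt_id t).fun_pow 2).fun_mul (hd hZ 1 t))).fun_sub
      (((hasDerivAt_id t).fun_pow 4).fun_mul (hd hK 2 t))).congr_deriv ?_
    simp
    ring
  refine ⟨?_, fun t => (d1 t).differentiableAt, ?_⟩
  · have := d1 0
    simpa [hz] using this
  · have hde : deriv E = fun t => -(2 * t) * ratInt (fun x => X x * s x) s 2 t +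
      2 * ratInt Y s 1 t - 4 * t ^ 2 * ratInt (fun x => Y x * s x) s 2 t +
      2 * t * ratInt Z s 1 t - 2 * t ^ 3 * ratInt (fun x => Z x * s x) s 2 t -
      4 * t ^ 3 * ratInt K s 2 t + 4 * t ^ 5 * ratInt (fun x => K x * s x) s 3 t :=
      funext fun t => (d1 t).deriv
    rw [hde]
    have p1 : ∀ (c : ℝ) (n : ℕ), HasDerivAt (fun t : ℝ => c * t ^ n) (c * (n * 0 ^ (n - 1))) 0 :=
      fun c n => (hasDerivAt_pow n 0).const_mul c
    have q1 : HasDerivAt (fun t : ℝ => -(2 * t)) (-2) 0 := by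
      simpa using ((hasDerivAt_id (0 : ℝ)).const_mul 2).fun_neg
    have q2 : HasDerivAt (fun t : ℝ => 2 * t) 2 0 := by
      simpa using (hasDerivAt_id (0 : ℝ)).const_mul 2
    refine (((((((q1.fun_mul (hd (hmul hX) 2 0)).fun_add ((hd hY 1 0).const_mul 2)).fun_sub
      ((p1 4 2).fun_mul (hd (hmul hY) 2 0))).fun_add (q2.fun_mul (hd hZ 1 0))).fun_sub
      ((p1 2 3).fun_mul (hd (hmul hZ) 2 0))).fun_sub ((p1 4 3).fun_mul (hd hK 2 0))).fun_add
      ((p1 4 5).fun_mul (hd (hmul hK) 3 0))).congr_deriv ?_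
    rw [integral_sub hZ (hmul hX)]
    simp [hz]
    ring

end

/-- Normalizing removes the radial part of u' and divides the tangential part by the length of u. -/
theorem norm_deriv_normalize_sq {u : ℝ → E3} {u' : E3} {x : ℝ} (hu : HasDerivAt u u' x)
    (h0 : 0 < ‖u x‖) : ‖deriv (fun x => ‖u x‖⁻¹ • u x) x‖ ^ 2 =
      ‖u'‖ ^ 2 * (‖u x‖ ^ 2)⁻¹ - inner ℝ (u x) u' ^ 2 * ((‖u x‖ ^ 2) ^ 2)⁻¹ := by
  have h1 : HasDerivAt (fun x => ‖u x‖) (inner ℝ (u x) u' / ‖u x‖) x := by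
    have h2 := hu.norm_sq.sqrt (by positivity)
    simp only [Real.sqrt_sq (norm_nonneg _)] at h2
    refine h2.congr_deriv ?_
    field_simp
  have h3 := (h1.fun_inv h0.ne').fun_smul hu
  rw [h3.deriv, @norm_add_sq_real, norm_smul, norm_smul, inner_smul_left, inner_smul_right,
    real_inner_comm]
  simp only [conj_trivial, mul_pow, Real.norm_eq_abs, sq_abs, abs_norm, abs_inv]
  field_simp
  ring

section

variable {m v : ℝ → E3}

theorem norm_add_smul_sq (hm : ∀ x, ‖m x‖ = 1) (ho : ∀ x, inner ℝ (v x) (m x) = 0) (t x : ℝ) :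
    ‖m x + t • v x‖ ^ 2 = 1 + t ^ 2 * ‖v x‖ ^ 2 := by
  rw [norm_add_sq_real, inner_smul_right, real_inner_comm, ho, hm, norm_smul, mul_pow,
    Real.norm_eq_abs, sq_abs]
  ring

theorem one_le_norm_add_smul (hm : ∀ x, ‖m x‖ = 1) (ho : ∀ x, inner ℝ (v x) (m x) = 0) (t x : ℝ) :
    1 ≤ ‖m x + t • v x‖ := by
  have := norm_add_smul_sq hm ho t x
  have h2 := mul_nonneg (sq_nonneg t) (sq_nonneg ‖v x‖)
  nlinarith [norm_nonneg (m x + t • v x)]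

theorem locAC_variation (hm : ∀ x, ‖m x‖ = 1) (ho : ∀ x, inner ℝ (v x) (m x) = 0) (hma : LocAC m)
    (hva : LocAC v) (t : ℝ) : LocAC (variation m v t) := by
  have hu : LocAC fun x => m x + t • v x := hma.add ((locAC_const t).smul hva)
  have hn : LocAC fun x => ‖m x + t • v x‖ := lipschitzWith_one_norm.comp_locAC hu
  exact (hn.inv_of_pos fun x => one_pos.trans_le (one_le_norm_add_smul hm ho t x)).smul hu

/-- Differentiating |m + t v|² = 1 + t²|v|² shows that (m + t v)·(m + t v)' = t² v·v', so the radial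
correction is of order t⁴. The parameter then enters only through explicit rational factors. -/
theorem variation_density_ae_eq (a : ℝ → ℝ) (hm : ∀ x, ‖m x‖ = 1)
    (ho : ∀ x, inner ℝ (v x) (m x) = 0) (hma : LocAC m) (hva : LocAC v) (t : ℝ) : ∀ᵐ x,
    a x * ‖deriv (variation m v t) x‖ ^ 2 +
        a x * ((variation m v t x 1) ^ 2 + (variation m v t x 2) ^ 2) =
      a x * (‖deriv m x‖ ^ 2 + (m x 1 ^ 2 + m x 2 ^ 2)) * ((1 + t ^ 2 * ‖v x‖ ^ 2) ^ 1)⁻¹ +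
      2 * t * (a x * (inner ℝ (deriv m x) (deriv v x) + (m x 1 * v x 1 + m x 2 * v x 2)) *
        ((1 + t ^ 2 * ‖v x‖ ^ 2) ^ 1)⁻¹) +
      t ^ 2 * (a x * (‖deriv v x‖ ^ 2 + (v x 1 ^ 2 + v x 2 ^ 2)) *
        ((1 + t ^ 2 * ‖v x‖ ^ 2) ^ 1)⁻¹) -
      t ^ 4 * (a x * inner ℝ (v x) (deriv v x) ^ 2 * ((1 + t ^ 2 * ‖v x‖ ^ 2) ^ 2)⁻¹) := by
  filter_upwards [hma.ae_hasDerivAt, hva.ae_hasDerivAt] with x h1 h2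
  have hu : HasDerivAt (fun x => m x + t • v x) (deriv m x + t • deriv v x) x :=
    h1.add (h2.const_smul t)
  have hpos := one_pos.trans_le (one_le_norm_add_smul hm ho t x)
  have h3 := norm_deriv_normalize_sq hu hpos
  have h4 : HasDerivAt (fun x => 1 + t ^ 2 * ‖v x‖ ^ 2)
      (t ^ 2 * (2 * inner ℝ (v x) (deriv v x))) x := (h2.norm_sq.const_mul _).const_add 1
  have h5 := hu.norm_sq
  rw [funext (norm_add_smul_sq hm ho t)] at h5
  have h6 : inner ℝ (m x + t • v x) (deriv m x + t • deriv v x) =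
      t ^ 2 * inner ℝ (v x) (deriv v x) := by
    have := h5.unique h4
    linarith
  have h7 : ‖deriv m x + t • deriv v x‖ ^ 2 =
      ‖deriv m x‖ ^ 2 + 2 * t * inner ℝ (deriv m x) (deriv v x) + t ^ 2 * ‖deriv v x‖ ^ 2 := by
    rw [norm_add_sq_real, inner_smul_right, norm_smul, mul_pow, Real.norm_eq_abs, sq_abs]
    ring
  have hn : ∀ i, variation m v t x i = ‖m x + t • v x‖⁻¹ * (m x i + t * v x i) := fun i => by
    simp [variation]
    ring
  change a x * ‖deriv (fun x => ‖m x + t • v x‖⁻¹ • (m x + t • v x)) x‖ ^ 2 + _ = _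
  simp only [h3, h6, h7, hn, mul_pow, inv_pow, norm_add_smul_sq hm ho t x]
  generalize (1 + t ^ 2 * ‖v x‖ ^ 2) = D
  ring

end

namespace FullWall

variable {a φ P : ℝ → ℝ} {a₀ A₀ : ℝ}

/-- The wall is a stable critical point of the energy. -/
theorem stable (h : FullWall a φ P A₀) (ha : AEMeasurable a) (ha₀ : 0 < a₀) (hA₀ : a₀ ≤ A₀)
    (hb : ∀ᵐ x, a₀ ≤ a x ∧ a x ≤ A₀) {v : ℝ → E3} (hv : MemH1 v)
    (ho : ∀ x, inner ℝ (v x) (planar φ x) = 0) :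
    (∀ t, energy a (variation (planar φ) v t) < ⊤) ∧
    HasDerivAt (energyAlong a (planar φ) v) 0 0 ∧
    Integrable (secondVarIntegrand a (planar φ) v) ∧
    (∀ t, DifferentiableAt ℝ (energyAlong a (planar φ) v) t) ∧
    HasDerivAt (deriv (energyAlong a (planar φ) v)) (2 * secondVar a (planar φ) v) 0 ∧
    0 ≤ secondVar a (planar φ) v := by
  have hbn := ae_norm_le_of_bounds ha₀ hb
  have hcos := h.locAC.cos.continuous
  have hsin := h.locAC.sin.continuous
  set m := planar φ with hm
  have hmac : LocAC m := h.locAC.planar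
  obtain ⟨C₀, hC₀⟩ := (hv.apply 0).exists_bound
  obtain ⟨C₁, hC₁⟩ := (hv.apply 1).exists_bound
  obtain ⟨C₂, hC₂⟩ := (hv.apply 2).exists_bound
  have hs : ∀ x, 0 ≤ ‖v x‖ ^ 2 := fun x => sq_nonneg _
  have hS : ∀ x, ‖v x‖ ^ 2 ≤ C₀ ^ 2 + C₁ ^ 2 + C₂ ^ 2 := fun x => by
    rw [norm_sq_eq]
    have e0 := sq_le_sq' (neg_le_of_abs_le (hC₀ x)) (le_of_abs_le (hC₀ x))
    have e1 := sq_le_sq' (neg_le_of_abs_le (hC₁ x)) (le_of_abs_le (hC₁ x))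
    have e2 := sq_le_sq' (neg_le_of_abs_le (hC₂ x)) (le_of_abs_le (hC₂ x))
    linarith
  have hsm : Continuous fun x => ‖v x‖ ^ 2 := hv.1.continuous.norm.pow 2
  have hvi : ∀ i, MemLp (fun x => v x i) 2 := fun i => (hv.apply i).2.1
  have hwt : ∀ {f : ℝ → ℝ}, Integrable f → Integrable fun x => a x * f x := fun hf =>
    memLp_one_iff_integrable.1 (memLp_weight_mul ha hbn (memLp_one_iff_integrable.2 hf))
  have hbX : ∀ᵐ x, a x * (‖deriv m x‖ ^ 2 + (m x 1 ^ 2 + m x 2 ^ 2)) =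
      a x * (deriv φ x ^ 2 + Real.cos (φ x) ^ 2) := by
    filter_upwards [h.locAC.ae_hasDerivAt] with x hx
    rw [hm, norm_deriv_planar_sq hx]
    simp
  have hX : Integrable fun x => a x * (‖deriv m x‖ ^ 2 + (m x 1 ^ 2 + m x 2 ^ 2)) :=
    h.integrable.congr (hbX.mono fun x hx => hx.symm)
  have hY : Integrable fun x => a x * (inner ℝ (deriv m x) (deriv v x) +
      (m x 1 * v x 1 + m x 2 * v x 2)) := by
    refine hwt (Integrable.add ?_ ?_)
    · have hφ' := h.memLp_deriv ha₀ hb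
      have e0 := memLp_weight_mul (A := 1) hcos.aemeasurable
        (Eventually.of_forall fun x => Real.abs_cos_le_one _) (hv.apply 0).2.2
      have e1 := memLp_weight_mul (A := 1) hsin.aemeasurable
        (Eventually.of_forall fun x => Real.abs_sin_le_one _) (hv.apply 1).2.2
      refine (hφ'.integrable_mul (e0.sub e1)).congr ?_
      filter_upwards [h.locAC.ae_hasDerivAt, hv.1.ae_hasDerivAt] with x hx hwx
      rw [inner_deriv_planar hx, ← (hasDerivAt_apply hwx 0).deriv,
        ← (hasDerivAt_apply hwx 1).deriv]
      rfl
    · refine ((h.memLp_cos ha₀ hb).integrable_mul (hvi 1)).congr (Eventually.of_forall fun x => ?_)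
      simp [hm]
  have hZ : Integrable fun x => a x * (‖deriv v x‖ ^ 2 + (v x 1 ^ 2 + v x 2 ^ 2)) := by
    refine hwt (Integrable.add ?_ (Integrable.add ?_ ?_))
    · exact hv.2.2.norm.integrable_sq
    · exact (hvi 1).integrable_sq
    · exact (hvi 2).integrable_sq
  have hK : Integrable fun x => a x * inner ℝ (v x) (deriv v x) ^ 2 := by
    refine hwt (Integrable.mono' ((hv.2.2.norm.integrable_sq).const_mul
      (C₀ ^ 2 + C₁ ^ 2 + C₂ ^ 2)) ?_ (Eventually.of_forall fun x => ?_))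
    · exact ((hv.1.continuous.aestronglyMeasurable.inner hv.2.2.1).pow 2)
    · rw [Real.norm_of_nonneg (sq_nonneg _), ← sq_abs]
      calc |inner ℝ (v x) (deriv v x)| ^ 2 ≤ (‖v x‖ * ‖deriv v x‖) ^ 2 := by
            gcongr; exact abs_real_inner_le_norm _ _
        _ = ‖v x‖ ^ 2 * ‖deriv v x‖ ^ 2 := mul_pow _ _ _
        _ ≤ _ := by gcongr; exact hS x
  have hdens : ∀ t, Integrable fun x => a x * ‖deriv (variation m v t) x‖ ^ 2 +
      a x * ((variation m v t x 1) ^ 2 + (variation m v t x 2) ^ 2) := fun t =>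
    ((((integrable_mul_ratio hX hsm hs 1 t).add
      ((integrable_mul_ratio hY hsm hs 1 t).const_mul (2 * t))).add
      ((integrable_mul_ratio hZ hsm hs 1 t).const_mul (t ^ 2))).sub
      ((integrable_mul_ratio hK hsm hs 2 t).const_mul (t ^ 4))).congr
      ((variation_density_ae_eq a (norm_planar φ) ho hmac hv.1 t).mono fun x hx => hx.symm)
  have hac := fun t => locAC_variation (norm_planar φ) ho hmac hv.1 t
  have hE : ∀ t, energyAlong a m v t =
      ratInt (fun x => a x * (‖deriv m x‖ ^ 2 + (m x 1 ^ 2 + m x 2 ^ 2)))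
        (fun x => ‖v x‖ ^ 2) 1 t +
      2 * t * ratInt (fun x => a x * (inner ℝ (deriv m x) (deriv v x) +
        (m x 1 * v x 1 + m x 2 * v x 2))) (fun x => ‖v x‖ ^ 2) 1 t +
      t ^ 2 * ratInt (fun x => a x * (‖deriv v x‖ ^ 2 + (v x 1 ^ 2 + v x 2 ^ 2)))
        (fun x => ‖v x‖ ^ 2) 1 t -
      t ^ 4 * ratInt (fun x => a x * inner ℝ (v x) (deriv v x) ^ 2)
        (fun x => ‖v x‖ ^ 2) 2 t := by
    intro t
    rw [energyAlong, energy, if_pos (hac t), ← integral_eq_lintegral_of_nonneg_ae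
      (hb.mono fun x hx => by
        have := ha₀.le.trans hx.1
        simp only [Pi.zero_apply]
        positivity) (hdens t).aestronglyMeasurable,
      integral_congr_ae (variation_density_ae_eq a (norm_planar φ) ho hmac hv.1 t)]
    have i1 := integrable_mul_ratio hX hsm hs 1 t
    have i2 := (integrable_mul_ratio hY hsm hs 1 t).const_mul (2 * t)
    have i3 := (integrable_mul_ratio hZ hsm hs 1 t).const_mul (t ^ 2)
    have i4 := (integrable_mul_ratio hK hsm hs 2 t).const_mul (t ^ 4)
    refine (integral_sub ((i1.add i2).add i3) i4).trans ?_
    rw [integral_add' (i1.add i2) i3, integral_add' i1 i2,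
      integral_const_mul, integral_const_mul, integral_const_mul]
    rfl
  obtain ⟨D1, D2, D3⟩ := hasDerivAt_energy_model hX hY hZ hK hsm hs hS hE
  have hsv : ∀ᵐ x, a x * (‖deriv v x‖ ^ 2 + (v x 1 ^ 2 + v x 2 ^ 2)) -
      a x * (‖deriv m x‖ ^ 2 + (m x 1 ^ 2 + m x 2 ^ 2)) * ‖v x‖ ^ 2 =
      secondVarIntegrand a m v x := by
    filter_upwards [hbX, h.secondVarIntegrand_ae_eq v] with x h1 h2
    rw [h1, ← hm] at *
    rw [h2]
  have hi : Integrable (secondVarIntegrand a m v) :=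
    (hZ.sub (hX.mul_bdd hsm.aestronglyMeasurable (Eventually.of_forall fun x => by
      rw [Real.norm_of_nonneg (hs x)]; exact hS x))).congr hsv
  refine ⟨fun t => ?_, ?_, hi, D2, ?_, h.secondVar_nonneg ha₀ hA₀ hb hv ho hi⟩
  · rw [energy, if_pos (hac t)]
    exact (hdens t).lintegral_lt_top
  -- Tested with v itself, the multiplier side vanishes because m·v = 0, and the other side is half
  -- the first derivative of the energy.
  · have h0 := h.integral_eulerLagrange_vector ha ha₀ hA₀ hb hv
    have h1 : ∀ x, inner ℝ (m x) (v x) = 0 := fun x => by rw [real_inner_comm]; exact ho x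
    simp only [← hm, h1, mul_zero, integral_zero, ← mul_add] at h0
    rwa [h0, mul_zero] at D1
  · rwa [integral_congr_ae hsv] at D3

end FullWall

end DomainWall

/-! ### The main theorem -/

open DomainWall

theorem theorem1 (a : ℝ → ℝ) (a₀ A₀ : ℝ) (ha : AEMeasurable a volume) (ha₀ : 0 < a₀)
    (hbound : ∀ᵐ x ∂(volume : Measure ℝ), a₀ ≤ a x ∧ a x ≤ A₀) :
    ∃ (m : ℝ → E3) (φ : ℝ → ℝ),
      -- `m` is the unique minimizer, and its energy is finite
      IsMinimizer a m ∧ energy a m < ⊤ ∧ (∀ n : ℝ → E3, IsMinimizer a n → n = m) ∧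
      -- `m = (sin φ, cos φ, 0)` with `φ` increasing, Lipschitz, and the unique wall angle
      m = planar φ ∧ StrictMono φ ∧ (∃ K, LipschitzWith K φ) ∧
      IsWallAngle a φ ∧ (∀ ψ : ℝ → ℝ, IsWallAngle a ψ → ψ = φ) ∧
      -- the symmetric monotone case
      (Function.Even a → MonotoneOn a (Set.Ioi 0) →
        Function.Odd φ ∧ PendulumIn a φ Set.univ ∧
        IsLagrangeMultiplier a m (multiplier a m) ∧
        ∀ v : ℝ → E3, MemH1 v → (∀ x, inner ℝ (v x) (m x) = 0) →
          -- `m` is a critical point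
          (∀ t : ℝ, energy a (variation m v t) < ⊤) ∧
          HasDerivAt (energyAlong a m v) 0 0 ∧
          -- `T(v)` is half the second derivative of the energy along the variation
          Integrable (secondVarIntegrand a m v) volume ∧
          (∀ᶠ t in 𝓝 (0 : ℝ), DifferentiableAt ℝ (energyAlong a m v) t) ∧
          HasDerivAt (deriv (energyAlong a m v)) (2 * secondVar a m v) 0 ∧
          -- `m` is stable
          0 ≤ secondVar a m v) := by
  have hA₀ : a₀ ≤ A₀ := by
    obtain ⟨x, hx⟩ := hbound.exists
    exact hx.1.trans hx.2
  have hbn := ae_norm_le_of_bounds ha₀ hbound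
  obtain ⟨φ, p, q, h, h'⟩ := exists_wall ha ha₀ hA₀ hbound
  have hwall := isWallAngle_of_halfWall h h' ha hbn
  have huniq : ∀ ψ : ℝ → ℝ, IsWallAngle a ψ → ψ = φ := fun ψ hψ => by
    obtain ⟨p', k⟩ := hψ.exists_halfWall ha ha₀ hbound
    obtain ⟨q', k'⟩ := hψ.reflect.exists_halfWall (aemeasurable_comp_neg ha) ha₀
      (ae_comp_neg hbound)
    exact eq_of_halfWall h h' k k' ha ha₀ hA₀ hbound
  refine ⟨planar φ, φ, isMinimizer_planar h h' ha ha₀ hA₀ hbound,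
    energy_planar_lt_top h h' ha ha₀ hA₀ hbound,
    fun n hn => eq_planar_of_isMinimizer h h' ha ha₀ hA₀ hbound hn, rfl,
    strictMono_of_halfWall h h' ha₀ hA₀ hbound,
    ⟨_, lipschitzWith_of_halfWall h h' ha₀ hA₀ hbound⟩, hwall, huniq, fun heven hmono => ?_⟩
  -- For even a, the reflected angle -φ(-x) is a wall angle for the same weight, so uniqueness
  -- identifies it with φ.
  have hodd : Function.Odd φ := fun x => by
    have h1 := hwall.reflect
    rw [show (fun x => a (-x)) = a from funext heven] at h1
    have h2 := congrFun (huniq _ h1) x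
    linarith
  obtain ⟨P, hP⟩ := exists_fullWall h h' ha ha₀ hA₀ hbound heven hodd hmono
  refine ⟨hodd, (pendulumIn_univ_of_odd h h' ha hbn heven hodd).2,
    hP.isLagrangeMultiplier ha ha₀ hA₀ hbound, fun v hv ho => ?_⟩
  obtain ⟨s1, s2, s3, s4, s5, s6⟩ := hP.stable ha ha₀ hA₀ hbound hv ho
  exact ⟨s1, s2, s3, Eventually.of_forall s4, s5, s6⟩
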